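/- Let $z$ range over the Riemann surface of the logarithm, so that $\arg z\in\mathbb{R}$ is unrestricted, $z^{s}=\exp(s\log|z|+is\arg z)$, and the functions below are continued analytically in $z$ (resp. $w$). Let $b_0(\nu)=1$ and, for $n\ge 1$, $$b_n(\nu)=\frac{\big((4\nu^2-1^2)(4\nu^2-3^2)\cdots(4\nu^2-(2n-3)^2)\big)(4\nu^2+4n^2-1)}{8^n\,n!}$$ (empty products being $1$). Let $K_\nu$, $J_\nu$, $Y_\nu$ be the usual (modified) Bessel functions, and put $\omega=z-\frac{\pi}{2}\nu-\frac{\pi}{4}$. For $N\ge 0$ define the remainder $R_N^{(K')}(z,\nu)$ by $$K'_\nu(z)=-\Big(\frac{\pi}{2z}\Big)^{1/2}e^{-z}\Big(\sum_{n=0}^{N-1}\frac{b_n(\nu)}{z^n}+R_N^{(K')}(z,\nu)\Big),$$ and the remainders $R_n^{(J')}(z,\nu)$, $n\ge 0$, by requiring that for all $N,M\ge 0$ $$J'_\nu(z)=-\Big(\frac{2}{\pi z}\Big)^{1/2}\big(A\sin\omega+B\cos\omega\big),\qquad Y'_\nu(z)=\Big(\frac{2}{\pi z}\Big)^{1/2}\big(A\cos\omega-B\sin\omega\big),$$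 where $$A=\sum_{n=0}^{N-1}(-1)^n\frac{b_{2n}(\nu)}{z^{2n}}+R_{2N}^{(J')}(z,\nu),\qquad B=\sum_{m=0}^{M-1}(-1)^m\frac{b_{2m+1}(\nu)}{z^{2m+1}}-R_{2M+1}^{(J')}(z,\nu).$$ Let $\Lambda_p(w)=w^pe^w\Gamma(1-p,w)$, with $\Gamma(a,w)$ the (multivalued) incomplete gamma function, and $\Pi_p(w)=\frac12\big(\Lambda_p(we^{\pi i/2})+\Lambda_p(we^{-\pi i/2})\big)$. Theorem. Let $N$ be a positive integer and let $\nu$ be a complex number with $|\Re(\nu)|<N-\frac12$. Then $$\big|R_N^{(K')}(z,\nu)\big|\le\frac{|\cos(\pi\nu)|}{|\cos(\pi\Re(\nu))|}\,\frac{|b_N(\Re(\nu))|}{|z|^N}\,\sup_{r\ge1}\big|\Lambda_{N+\frac12}(2zr)\big|\qquad\text{for }|\arg z|<\tfrac{3\pi}{2},$$ $$\big|R_N^{(J')}(z,\nu)\big|\le\frac{|\cos(\pi\nu)|}{|\cos(\pi\Re(\nu))|}\,\frac{|b_N(\Re(\nu))|}{|z|^N}\,\sup_{r\ge1}\big|\Pi_{N+\frac12}(2zr)\big|\qquad\text{for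 }|\arg z|<\pi,$$ and both suprema are finite. If $2\Re(\nu)$ is an odd integer, then $|b_N(\Re(\nu))|/|\cos(\pi\Re(\nu))|$ is to be read as the (existing, finite) limit of $|b_N(x)|/|\cos(\pi x)|$ as the real variable $x$ tends to $\Re(\nu)$, $x\ne\Re(\nu)$. -/

import Mathlib

open Filter Topology

/-!
Points of the Riemann surface of the logarithm are represented by their logarithm: the complex
number `ζ` stands for the point `z = e ^ ζ` with `|z| = e ^ (Re ζ)` and `arg z = Im ζ`, where
`arg z` is not restricted to one turn. Multivalued functions of `z` are single-valued functions of
`ζ`; for example `z ^ s` is `exp (s * ζ)`, and `z * e ^ (i * π / 2)` is `ζ + i * π / 2`.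
-/

namespace BesselRemainder

noncomputable section

/-- The modified Bessel function of the first kind
`I_ν(z) = (z / 2) ^ ν * ∑ (z / 2) ^ (2 k) / (k! Γ(ν + k + 1))` at `z = e ^ ζ`.
(Where `Γ` has a pole, `1 / Γ` is `0`, also in Mathlib's convention.) -/
def besselI (ν ζ : ℂ) : ℂ :=
  Complex.exp (ν * (ζ - (Real.log 2 : ℂ))) *
    ∑' k : ℕ, (Complex.exp ζ / 2) ^ (2 * k) /
      ((Nat.factorial k : ℂ) * Complex.Gamma (ν + (k : ℂ) + 1))

/-- The Bessel function of the first kind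
`J_ν(z) = (z / 2) ^ ν * ∑ (-1) ^ k (z / 2) ^ (2 k) / (k! Γ(ν + k + 1))` at `z = e ^ ζ`. -/
def besselJ (ν ζ : ℂ) : ℂ :=
  Complex.exp (ν * (ζ - (Real.log 2 : ℂ))) *
    ∑' k : ℕ, (-1) ^ k * (Complex.exp ζ / 2) ^ (2 * k) /
      ((Nat.factorial k : ℂ) * Complex.Gamma (ν + (k : ℂ) + 1))

open Classical in
/-- The modified Bessel function of the second kind
`K_ν(z) = (π / 2) (I_{-ν}(z) - I_ν(z)) / sin (π ν)` at `z = e ^ ζ`; for an integer `ν` it is the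
limit of this expression in the order. -/
def besselK (ν ζ : ℂ) : ℂ :=
  if Complex.sin (Real.pi * ν) = 0 then
    limUnder (𝓝[≠] ν) fun μ : ℂ =>
      (Real.pi : ℂ) / 2 * (besselI (-μ) ζ - besselI μ ζ) / Complex.sin (Real.pi * μ)
  else (Real.pi : ℂ) / 2 * (besselI (-ν) ζ - besselI ν ζ) / Complex.sin (Real.pi * ν)

open Classical in
/-- The Bessel function of the second kind
`Y_ν(z) = (J_ν(z) cos (π ν) - J_{-ν}(z)) / sin (π ν)` at `z = e ^ ζ`; for an integer `ν` it is the
limit of this expression in the order. -/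
def besselY (ν ζ : ℂ) : ℂ :=
  if Complex.sin (Real.pi * ν) = 0 then
    limUnder (𝓝[≠] ν) fun μ : ℂ =>
      (besselJ μ ζ * Complex.cos (Real.pi * μ) - besselJ (-μ) ζ) / Complex.sin (Real.pi * μ)
  else (besselJ ν ζ * Complex.cos (Real.pi * ν) - besselJ (-ν) ζ) / Complex.sin (Real.pi * ν)

/-- The derivative `df/dz = (df/dζ) / z` with respect to `z = e ^ ζ`. -/
def derivZ (f : ℂ → ℂ) (ζ : ℂ) : ℂ := deriv f ζ / Complex.exp ζ

/-- The coefficients `b_n(ν)`: `b_0(ν) = 1` and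
`b_n(ν) = (4ν² - 1²)(4ν² - 3²) ⋯ (4ν² - (2n - 3)²) (4ν² + 4n² - 1) / (8 ^ n n!)` for `n ≥ 1`. -/
def coeffB (n : ℕ) (ν : ℂ) : ℂ :=
  if n = 0 then 1
  else (∏ k ∈ Finset.range (n - 1), (4 * ν ^ 2 - (2 * (k : ℂ) + 1) ^ 2)) *
    (4 * ν ^ 2 + 4 * (n : ℂ) ^ 2 - 1) / (8 ^ n * (Nat.factorial n : ℂ))

/-- The remainder `R_N^{(K')}(z, ν)` at `z = e ^ ζ`, which is defined by
`K_ν'(z) = - (π / (2z)) ^ (1/2) e ^ (-z) (∑_{n < N} b_n(ν) / z ^ n + R_N^{(K')}(z, ν))`. -/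
def remK' (N : ℕ) (ν ζ : ℂ) : ℂ :=
  -(derivZ (besselK ν) ζ / ((Real.sqrt (Real.pi / 2) : ℂ) * Complex.exp (-ζ / 2) *
      Complex.exp (-Complex.exp ζ))) -
    ∑ n ∈ Finset.range N, coeffB n ν / Complex.exp ζ ^ n

/-- The phase `ω = z - π ν / 2 - π / 4` at `z = e ^ ζ`. -/
def omega (ν ζ : ℂ) : ℂ := Complex.exp ζ - Real.pi / 2 * ν - Real.pi / 4

/-- The amplitude factor `(2 / (π z)) ^ (1/2)` at `z = e ^ ζ`. -/
def amp (ζ : ℂ) : ℂ := (Real.sqrt (2 / Real.pi) : ℂ) * Complex.exp (-ζ / 2)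

/-- With `oscB`, the solution `(A, B)` of the linear system
`J_ν' = -(2 / (π z)) ^ (1/2) (A sin ω + B cos ω)`,
`Y_ν' = (2 / (π z)) ^ (1/2) (A cos ω - B sin ω)`. -/
def oscA (ν ζ : ℂ) : ℂ :=
  (Complex.cos (omega ν ζ) * derivZ (besselY ν) ζ -
    Complex.sin (omega ν ζ) * derivZ (besselJ ν) ζ) / amp ζ

/-- The second component of the solution of the system described at `oscA`. -/
def oscB (ν ζ : ℂ) : ℂ :=
  -(Complex.cos (omega ν ζ) * derivZ (besselJ ν) ζ +
    Complex.sin (omega ν ζ) * derivZ (besselY ν) ζ) / amp ζ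

/-- The remainders `R_n^{(J')}(z, ν)` at `z = e ^ ζ`: the numbers for which
`J_ν'(z) = -(2 / (π z)) ^ (1/2) (A sin ω + B cos ω)` and
`Y_ν'(z) = (2 / (π z)) ^ (1/2) (A cos ω - B sin ω)`, where, for all `N` and `M`,
`A = ∑_{n < N} (-1) ^ n b_{2n}(ν) / z ^ (2n) + R_{2N}^{(J')}(z, ν)` and
`B = ∑_{m < M} (-1) ^ m b_{2m+1}(ν) / z ^ (2m+1) - R_{2M+1}^{(J')}(z, ν)`.
See `derivZ_besselJ_eq` and `derivZ_besselY_eq`. -/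
def remJ' (n : ℕ) (ν ζ : ℂ) : ℂ :=
  if n % 2 = 0 then
    oscA ν ζ - ∑ k ∈ Finset.range (n / 2),
      (-1) ^ k * coeffB (2 * k) ν / Complex.exp ζ ^ (2 * k)
  else
    (∑ k ∈ Finset.range (n / 2),
      (-1) ^ k * coeffB (2 * k + 1) ν / Complex.exp ζ ^ (2 * k + 1)) - oscB ν ζ

theorem amp_ne_zero (ζ : ℂ) : amp ζ ≠ 0 := by
  have h : Real.sqrt (2 / Real.pi) ≠ 0 := (Real.sqrt_pos.2 (by positivity)).ne'
  exact mul_ne_zero (by exact_mod_cast h) (Complex.exp_ne_zero _)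

/-- The expansion of `J_ν'(z)` with its remainders. -/
theorem derivZ_besselJ_eq (N M : ℕ) (ν ζ : ℂ) :
    derivZ (besselJ ν) ζ = -amp ζ *
      (Complex.sin (omega ν ζ) *
          ((∑ n ∈ Finset.range N, (-1) ^ n * coeffB (2 * n) ν / Complex.exp ζ ^ (2 * n)) +
            remJ' (2 * N) ν ζ) +
        Complex.cos (omega ν ζ) *
          ((∑ m ∈ Finset.range M,
              (-1) ^ m * coeffB (2 * m + 1) ν / Complex.exp ζ ^ (2 * m + 1)) -
            remJ' (2 * M + 1) ν ζ)) := by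
  have h1 : (2 * M + 1) / 2 = M := by omega
  have h2 : (2 * M + 1) % 2 = 1 := by omega
  have h3 := Complex.sin_sq_add_cos_sq (omega ν ζ)
  have h4 := amp_ne_zero ζ
  simp only [remJ', h1, h2, Nat.mul_mod_right, if_true, one_ne_zero, if_false,
    Nat.mul_div_cancel_left N two_pos, add_sub_cancel, sub_sub_cancel, oscA, oscB]
  field_simp
  linear_combination (-derivZ (besselJ ν) ζ) * h3

/-- The expansion of `Y_ν'(z)` with its remainders. -/
theorem derivZ_besselY_eq (N M : ℕ) (ν ζ : ℂ) :
    derivZ (besselY ν) ζ = amp ζ *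
      (Complex.cos (omega ν ζ) *
          ((∑ n ∈ Finset.range N, (-1) ^ n * coeffB (2 * n) ν / Complex.exp ζ ^ (2 * n)) +
            remJ' (2 * N) ν ζ) -
        Complex.sin (omega ν ζ) *
          ((∑ m ∈ Finset.range M,
              (-1) ^ m * coeffB (2 * m + 1) ν / Complex.exp ζ ^ (2 * m + 1)) -
            remJ' (2 * M + 1) ν ζ)) := by
  have h1 : (2 * M + 1) / 2 = M := by omega
  have h2 : (2 * M + 1) % 2 = 1 := by omega
  have h3 := Complex.sin_sq_add_cos_sq (omega ν ζ)
  have h4 := amp_ne_zero ζ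
  simp only [remJ', h1, h2, Nat.mul_mod_right, if_true, one_ne_zero, if_false,
    Nat.mul_div_cancel_left N two_pos, add_sub_cancel, sub_sub_cancel, oscA, oscB]
  field_simp
  linear_combination (-derivZ (besselY ν) ζ) * h3

/-- The incomplete gamma function `Γ(a, w) = ∫_w^∞ t ^ (a - 1) e ^ (-t) dt` at `w = e ^ ζ`, with
the path of integration on the Riemann surface of the logarithm: from `∞` on the positive real
half-line, `arg t = 0`, down to `|w|`, and then on the circle `t = |w| e ^ (i φ)` up to
`φ = arg w`. -/
def incGamma (a ζ : ℂ) : ℂ :=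
  (∫ t in Set.Ioi (Real.exp ζ.re), (t : ℂ) ^ (a - 1) * Complex.exp (-(t : ℂ))) -
    Complex.I * ∫ φ in (0 : ℝ)..ζ.im,
      Complex.exp (a * ((ζ.re : ℂ) + φ * Complex.I) - Complex.exp ((ζ.re : ℂ) + φ * Complex.I))

/-- The basic terminant `Λ_p(w) = w ^ p e ^ w Γ(1 - p, w)` at `w = e ^ ζ`. -/
def termLambda (p ζ : ℂ) : ℂ :=
  Complex.exp (p * ζ) * Complex.exp (Complex.exp ζ) * incGamma (1 - p) ζ

/-- The basic terminant `Π_p(w) = (Λ_p(w e ^ (π i / 2)) + Λ_p(w e ^ (-π i / 2))) / 2` at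
`w = e ^ ζ`. -/
def termPi (p ζ : ℂ) : ℂ :=
  (termLambda p (ζ + Real.pi / 2 * Complex.I) + termLambda p (ζ - Real.pi / 2 * Complex.I)) / 2

end

end BesselRemainder

/-!
The proof rests on one exact formula: for `|Re ν| < N - 1/2` and `|arg z| < 3 π / 2`,
`R_N^{(K')}(z, ν) = -C_N cos (π ν) z ^ (-N) ∫ e ^ (ν u) ω_N(u) Λ_{N + 1/2}((1 + cosh u) z) du`
over the real line, with an explicit constant `C_N` and the positive weight
`ω_N(u) = cosh u (1 + cosh u) ^ (-N - 1/2)` (`remK'_eq`). With `Λ` replaced by `1` the same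
expression is, up to the power of `z`, the coefficient `b_N(ν)` (`coeffB_eq_integral`, a beta
integral). Since `1 + cosh u = 2 r` with `r ≥ 1`, and since `|e ^ (ν u)| = e ^ (Re ν u)`, bounding
`Λ` by its supremum gives the first inequality; the quotient `|b_N(x)| / |cos (π x)|` is
`|C_N| ∫ e ^ (x u) ω_N(u) du`, which is continuous in `x` and so provides the limit at the odd
values of `2 x`. The supremum is finite because the incomplete gamma function is a Laplace integral
along any ray `arg s = φ` with `|φ| < π / 2` and `|arg z - φ| < π`, and `φ = arg z / 3` is
admissible in the whole sector (`norm_termLambda_le`).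

The formula for `K_ν'` follows from `K_ν' = -(K_{ν+1} + K_{ν-1}) / 2` and the analogous formula
for `K_ν` itself, whose remainder is `C_N cos (π ν)` times the superposition
`psi = ∫ e ^ (ν u) q((1 + cosh u) z) du` of the functions `q(z) = z ^ (-p) Λ_p(z)`, `p = N + 1/2`
(`besselK_eq_expansionK`). This is proved through differential equations. Integration by parts in
`u` shows that `psi` solves an inhomogeneous Bessel equation (`psi_ode`) whose right-hand side is
exactly what the truncated sum fails to satisfy, so the sum and `psi` together solve the
homogeneous equation (`expansionK_ode`). As `z → ∞` this solution has the leading behaviour of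
`h_ν(z) = 1/2 ∫ e ^ (-z cosh u + ν u) du`, also a solution, so that their Wronskian and then their
difference vanish on a half-line (`eventually_besselKInt_eq`). Finally `h_ν` is
`(π / 2) (I_{-ν} - I_ν) / sin (π ν)` because the Wronskian `z (h_ν I_{ν+1} + h_{ν+1} I_ν)` is the
constant `1`, by its limit at `z → 0` (`besselK_eq_besselKInt`). The identity theorem carries the
formula to the whole sector, and continuity in `ν` carries it to integer orders.

For the second inequality, `J_ν` and `Y_ν` are combinations of `K_ν(z e ^ (± π i / 2))`
(`besselJ_besselY_eq`). Hence `A` and `B` are half the sum and `i / 2` times the difference of the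
expansions of `K_ν'` at these two points, and their remainders combine to the same integral with
`Π` in place of `Λ` (`norm_remJ'_eq`).
-/

namespace BesselRemainder
open MeasureTheory Metric

/-! ### Integrals of holomorphic families -/

/-- A family `F · u`, `u : ℝ`, of functions that are holomorphic on the open set `U` and are, near
each point of `U`, dominated by an integrable function of `u` alone. -/
structure HoloFamily (μ : Measure ℝ) (U : Set ℂ) (F : ℂ → ℝ → ℂ) : Prop where
  meas : ∀ ζ ∈ U, AEStronglyMeasurable (F ζ) μ
  diff : ∀ᵐ u ∂μ, DifferentiableOn ℂ (fun ζ => F ζ u) U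
  dom : ∀ ζ₀ ∈ U, ∃ r > 0, ball ζ₀ r ⊆ U ∧ ∃ B : ℝ → ℝ, Integrable B μ ∧
    ∀ᵐ u ∂μ, ∀ ζ ∈ ball ζ₀ r, ‖F ζ u‖ ≤ B u

namespace HoloFamily

variable {μ : Measure ℝ} {U : Set ℂ} {F : ℂ → ℝ → ℂ}

theorem integrable (h : HoloFamily μ U F) {ζ : ℂ} (hζ : ζ ∈ U) : Integrable (F ζ) μ := by
  obtain ⟨r, hr, -, B, hB, hFB⟩ := h.dom ζ hζ
  exact hB.mono' (h.meas ζ hζ) (hFB.mono fun u hu => hu ζ (mem_ball_self hr))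

theorem isOpen (h : HoloFamily μ U F) : IsOpen U := by
  refine isOpen_iff.2 fun ζ hζ => ?_
  obtain ⟨r, hr, hU, -⟩ := h.dom ζ hζ
  exact ⟨r, hr, hU⟩

theorem congr {G : ℂ → ℝ → ℂ} (h : HoloFamily μ U F) (hFG : ∀ ζ ∈ U, ∀ u, F ζ u = G ζ u) :
    HoloFamily μ U G where
  meas ζ hζ := (funext (hFG ζ hζ) : F ζ = G ζ) ▸ h.meas ζ hζ
  diff := h.diff.mono fun u hu => hu.congr fun ζ hζ => (hFG ζ hζ u).symm
  dom ζ₀ hζ₀ := by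
    obtain ⟨r, hr, hU, B, hB, hFB⟩ := h.dom ζ₀ hζ₀
    exact ⟨r, hr, hU, B, hB, hFB.mono fun u hu ζ hζ => hFG ζ (hU hζ) u ▸ hu ζ hζ⟩

/-- By Cauchy's estimate the derivatives are again locally dominated. -/
theorem deriv (h : HoloFamily μ U F) :
    HoloFamily μ U fun ζ u => deriv (fun ξ => F ξ u) ζ where
  meas ζ hζ := by
    obtain ⟨r, hr, hU, -⟩ := h.dom ζ hζ
    obtain ⟨k, hk⟩ := exists_nat_one_div_lt hr
    have hmem (n : ℕ) : ζ + 1 / ((n + k : ℕ) + 1 : ℂ) ∈ ball ζ r := by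
      have h1 : (1 / (((n + k : ℕ) : ℂ) + 1)) = ((1 / (((n + k : ℕ) : ℝ) + 1) : ℝ) : ℂ) := by
        push_cast; rfl
      rw [mem_ball, dist_eq_norm, add_sub_cancel_left, h1, Complex.norm_real, Real.norm_eq_abs,
        abs_of_nonneg (by positivity)]
      refine lt_of_le_of_lt ?_ hk
      gcongr
      omega
    have hlim : Tendsto (fun n : ℕ => 1 / ((n + k : ℕ) + 1 : ℂ)) atTop (𝓝[≠] 0) := by
      refine tendsto_nhdsWithin_iff.2 ⟨?_, Eventually.of_forall fun n => ?_⟩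
      · exact (tendsto_add_atTop_iff_nat k).2 (tendsto_one_div_add_atTop_nhds_zero_nat (𝕜 := ℂ))
      · exact one_div_ne_zero (Nat.cast_add_one_ne_zero _)
    refine aestronglyMeasurable_of_tendsto_ae (u := atTop)
      (f := fun (n : ℕ) u => (1 / ((n + k : ℕ) + 1 : ℂ))⁻¹ •
        (F (ζ + 1 / ((n + k : ℕ) + 1 : ℂ)) u - F ζ u)) (fun n => ?_) ?_
    · exact AEStronglyMeasurable.const_smul ((h.meas _ (hU (hmem n))).sub (h.meas ζ hζ)) (_ : ℂ)
    · filter_upwards [h.diff] with u hu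
      have := (hu.differentiableAt (h.isOpen.mem_nhds hζ)).hasDerivAt.tendsto_slope_zero
      exact this.comp hlim
  diff := by
    filter_upwards [h.diff] with u hu
    exact hu.deriv h.isOpen
  dom ζ₀ hζ₀ := by
    obtain ⟨r, hr, hU, B, hB, hFB⟩ := h.dom ζ₀ hζ₀
    refine ⟨r / 2, by positivity, (ball_subset_ball (by linarith)).trans hU,
      fun u => B u / (r / 4), hB.div_const _, ?_⟩
    filter_upwards [hFB, h.diff] with u hu hd ζ hζ
    have hsub : closedBall ζ (r / 4) ⊆ ball ζ₀ r := fun x hx => by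
      rw [mem_closedBall] at hx
      rw [mem_ball] at hζ ⊢
      linarith [dist_triangle x ζ ζ₀]
    refine Complex.norm_deriv_le_of_forall_mem_sphere_norm_le (by positivity) ?_ fun z hz =>
      hu z (hsub (sphere_subset_closedBall hz))
    exact ((hd.mono hU).mono hsub).diffContOnCl_ball subset_rfl

theorem hasDerivAt_integral (h : HoloFamily μ U F) {ζ : ℂ} (hζ : ζ ∈ U) :
    HasDerivAt (fun ξ => ∫ u, F ξ u ∂μ) (∫ u, _root_.deriv (fun ξ => F ξ u) ζ ∂μ) ζ := by
  obtain ⟨r, hr, hU, B, hB, hFB⟩ := h.deriv.dom ζ hζ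
  refine (hasDerivAt_integral_of_dominated_loc_of_deriv_le (ball_mem_nhds ζ hr) ?_
    (h.integrable hζ) (h.deriv.meas ζ hζ) hFB hB ?_).2
  · exact (h.isOpen.eventually_mem hζ).mono fun x hx => h.meas x hx
  · filter_upwards [h.diff] with u hu x hx
    exact (hu.differentiableAt (h.isOpen.mem_nhds (hU hx))).hasDerivAt

end HoloFamily

/-! ### The power series of the Bessel functions -/

/-- The entire function `∑ w ^ k / (k! Γ(ν + k + 1))` of `w`: with `w = z² / 4` it is
`(z / 2) ^ (-ν) I_ν(z)`, with `w = -z² / 4` it is `(z / 2) ^ (-ν) J_ν(z)`. -/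
noncomputable def besselS (ν w : ℂ) : ℂ :=
  ∑' k : ℕ, w ^ k / ((Nat.factorial k : ℂ) * Complex.Gamma (ν + (k : ℂ) + 1))

theorem exists_norm_inv_Gamma_le (ν : ℂ) :
    ∃ C : ℝ, ∀ᶠ μ in 𝓝 ν, ∀ k : ℕ, ‖(Complex.Gamma (μ + k + 1))⁻¹‖ ≤ C := by
  obtain ⟨m, hm⟩ := exists_nat_gt ‖ν‖
  set g : ℕ → ℂ → ℝ := fun k μ => ‖(Complex.Gamma (μ + k + 1))⁻¹‖
  have hstep (μ : ℂ) (hμ : ‖μ‖ < m) (k : ℕ) (hk : m ≤ k) : g (k + 1) μ ≤ g k μ := by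
    have h1 : (1 : ℝ) ≤ ‖μ + k + 1‖ := by
      have h2 : ‖((k + 1 : ℕ) : ℂ)‖ ≤ ‖μ + k + 1‖ + ‖μ‖ := by
        have := norm_sub_le (μ + k + 1) μ
        rwa [show μ + k + 1 - μ = ((k + 1 : ℕ) : ℂ) by push_cast; ring] at this
      rw [Complex.norm_natCast] at h2
      have h3 : (m : ℝ) ≤ k := by exact_mod_cast hk
      push_cast at h2
      linarith
    have h2 := Complex.one_div_Gamma_eq_self_mul_one_div_Gamma_add_one (μ + k + 1)
    have h3 : g k μ = ‖μ + k + 1‖ * g (k + 1) μ := by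
      simp only [g]
      rw [h2, norm_mul]
      push_cast
      ring_nf
    rw [h3]
    exact le_mul_of_one_le_left (norm_nonneg _) h1
  have hle (μ : ℂ) (hμ : ‖μ‖ < m) (n : ℕ) : g (m + n) μ ≤ g m μ := by
    induction n with
    | zero => simp
    | succ n ih => exact (hstep μ hμ (m + n) (by omega)).trans ih
  have hcont : Continuous fun μ => ∑ k ∈ Finset.range (m + 1), g k μ := by
    refine continuous_finsetSum _ fun k _ => ?_
    exact (Complex.differentiable_one_div_Gamma.continuous.comp (by fun_prop)).norm
  refine ⟨(∑ k ∈ Finset.range (m + 1), g k ν) + 1, ?_⟩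
  filter_upwards [hcont.continuousAt.eventually (gt_mem_nhds (lt_add_one _)),
    continuous_norm.continuousAt.eventually (gt_mem_nhds hm)] with μ hμ hμm k
  refine le_trans ?_ hμ.le
  rcases le_total k m with hk | hk
  · exact Finset.single_le_sum (f := fun k => g k μ) (fun i _ => norm_nonneg _)
      (Finset.mem_range.2 (by omega))
  · obtain ⟨n, rfl⟩ := Nat.exists_eq_add_of_le hk
    exact (hle μ hμm n).trans (Finset.single_le_sum (f := fun k => g k μ)
      (fun i _ => norm_nonneg _) (Finset.mem_range.2 (by omega)))

theorem exists_summable_bound_besselS (ν : ℂ) (R : ℝ) :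
    ∃ u : ℕ → ℝ, Summable u ∧ ∀ᶠ μ in 𝓝 ν, ∀ (k : ℕ) (w : ℂ), w ∈ Metric.ball 0 R →
      ‖w ^ k / ((Nat.factorial k : ℂ) * Complex.Gamma (μ + (k : ℂ) + 1))‖ ≤ u k := by
  obtain ⟨C, hC⟩ := exists_norm_inv_Gamma_le ν
  refine ⟨fun k => R ^ k / (Nat.factorial k) * C, (Real.summable_pow_div_factorial R).mul_right C,
    hC.mono fun μ hμ k w hw => ?_⟩
  have hw : ‖w‖ ≤ R := (mem_ball_zero_iff.1 hw).le
  rw [← div_div, div_eq_mul_inv _ (Complex.Gamma _), norm_mul, norm_div, norm_pow,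
    Complex.norm_natCast]
  have hR : 0 ≤ R := (norm_nonneg w).trans hw
  exact mul_le_mul (by gcongr) (hμ k) (norm_nonneg _) (by positivity)

theorem hasSum_besselS (ν w : ℂ) :
    HasSum (fun k : ℕ => w ^ k / ((Nat.factorial k : ℂ) * Complex.Gamma (ν + (k : ℂ) + 1)))
      (besselS ν w) := by
  obtain ⟨u, hu, hle⟩ := exists_summable_bound_besselS ν (‖w‖ + 1)
  exact (Summable.of_norm_bounded hu fun k => hle.self_of_nhds k w (by simp)).hasSum

theorem differentiable_besselS (ν : ℂ) : Differentiable ℂ (besselS ν) := fun w => by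
  obtain ⟨u, hu, hle⟩ := exists_summable_bound_besselS ν (‖w‖ + 1)
  exact (Complex.differentiableOn_tsum_of_summable_norm hu (fun k => by fun_prop) Metric.isOpen_ball
    hle.self_of_nhds).differentiableAt (Metric.isOpen_ball.mem_nhds (by simp))

theorem continuous_besselS_order (w : ℂ) : Continuous fun ν => besselS ν w := by
  refine continuous_iff_continuousAt.2 fun ν => ?_
  obtain ⟨u, hu, hle⟩ := exists_summable_bound_besselS ν (‖w‖ + 1)
  refine tendsto_tsum_of_dominated_convergence hu (fun k => ?_)
    (hle.mono fun μ hμ k => hμ k w (by simp))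
  have h : Continuous fun μ : ℂ => (Complex.Gamma (μ + k + 1))⁻¹ :=
    Complex.differentiable_one_div_Gamma.continuous.comp (by fun_prop)
  simp only [← div_div, div_eq_mul_inv _ (Complex.Gamma _)]
  exact (continuous_const.mul h).continuousAt

theorem hasSum_deriv_besselS (ν w : ℂ) :
    HasSum (fun k : ℕ => (k * w ^ (k - 1)) /
      ((Nat.factorial k : ℂ) * Complex.Gamma (ν + (k : ℂ) + 1))) (deriv (besselS ν) w) := by
  obtain ⟨u, hu, hle⟩ := exists_summable_bound_besselS ν (‖w‖ + 1)
  have := Complex.hasSum_deriv_of_summable_norm hu (fun k => by fun_prop) Metric.isOpen_ball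
    hle.self_of_nhds (show w ∈ Metric.ball 0 (‖w‖ + 1) by simp)
  simpa using! this

theorem hasDerivAt_besselS (ν w : ℂ) : HasDerivAt (besselS ν) (besselS (ν + 1) w) w := by
  have h := hasSum_deriv_besselS ν w
  rw [← hasSum_nat_add_iff' 1] at h
  have h2 : deriv (besselS ν) w = besselS (ν + 1) w := by
    simp only [Finset.range_one, Finset.sum_singleton, Nat.cast_zero, zero_mul, zero_div,
      sub_zero] at h
    refine h.unique ?_
    convert! hasSum_besselS (ν + 1) w using 2 with k
    have : (k : ℂ) + 1 ≠ 0 := Nat.cast_add_one_ne_zero k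
    rw [Nat.factorial_succ, add_tsub_cancel_right]
    push_cast
    rw [mul_assoc, mul_div_mul_left _ _ this]
    ring_nf
  exact h2 ▸ (differentiable_besselS ν w).hasDerivAt

theorem besselS_rec (ν w : ℂ) :
    besselS ν w = (ν + 1) * besselS (ν + 1) w + w * besselS (ν + 2) w := by
  have h1 := (hasSum_besselS (ν + 1) w).mul_left (ν + 1)
  have h2 := (hasSum_deriv_besselS (ν + 1) w).mul_left w
  rw [(hasDerivAt_besselS (ν + 1) w).deriv, show ν + 1 + 1 = ν + 2 by ring] at h2
  refine (hasSum_besselS ν w).unique ?_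
  convert! h1.add h2 using 2 with k
  have h3 := Complex.one_div_Gamma_eq_self_mul_one_div_Gamma_add_one (ν + k + 1)
  rw [show ν + 1 + (k : ℂ) + 1 = ν + k + 1 + 1 by ring, ← div_div, div_eq_mul_inv _ (Complex.Gamma _),
    h3]
  rcases k with _ | k
  · simp
  · rw [add_tsub_cancel_right]
    simp only [div_eq_mul_inv, mul_inv]
    ring

/-- The Wronskian of `I_{-ν}` and `I_ν`, up to a constant factor. -/
theorem besselS_wronskian (ν w : ℂ) :
    besselS ν w * besselS (-ν - 1) w - w * besselS (-ν) w * besselS (ν + 1) w =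
      -(Complex.sin (Real.pi * ν) / Real.pi) := by
  have hd (x : ℂ) : HasDerivAt (fun w => besselS ν w * besselS (-ν - 1) w -
      w * besselS (-ν) w * besselS (ν + 1) w) 0 x := by
    have h1 := (hasDerivAt_besselS ν x).mul (hasDerivAt_besselS (-ν - 1) x)
    have h2 := ((hasDerivAt_id x).mul (hasDerivAt_besselS (-ν) x)).mul
      (hasDerivAt_besselS (ν + 1) x)
    convert! h1.sub h2 using 1
    have e1 := besselS_rec ν x
    have e2 := besselS_rec (-ν - 1) x
    rw [show -ν - 1 + 1 = -ν by ring, show -ν - 1 + 2 = -ν + 1 by ring] at e2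
    rw [show -ν - 1 + 1 = -ν by ring, show ν + 1 + 1 = ν + 2 by ring]
    simp only [id, Pi.mul_apply]
    linear_combination (besselS (ν + 1) x) * -e2 + besselS (-ν) x * (-e1)
  have hc := is_const_of_deriv_eq_zero (fun x => (hd x).differentiableAt) (fun x => (hd x).deriv)
    w 0
  have h0 (μ : ℂ) : besselS μ 0 = (Complex.Gamma (μ + 1))⁻¹ := by
    rw [besselS, tsum_eq_single 0 fun k hk => by simp [hk]]
    simp
  simp only [h0] at hc
  rw [hc, zero_mul, zero_mul, sub_zero, ← mul_inv]
  have h1 := Complex.Gamma_mul_Gamma_one_sub (-ν)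
  rw [show -ν - 1 + 1 = -ν by ring, mul_comm, show ν + 1 = 1 - -ν by ring, h1, inv_div, mul_neg,
    Complex.sin_neg, neg_div]

/-! ### The modified Bessel functions -/

theorem besselI_eq (ν ζ : ℂ) :
    besselI ν ζ = Complex.exp (ν * (ζ - (Real.log 2 : ℂ))) * besselS ν ((Complex.exp ζ / 2) ^ 2) := by
  simp only [besselI, besselS, pow_mul]

theorem besselJ_eq (ν ζ : ℂ) :
    besselJ ν ζ =
      Complex.exp (ν * (ζ - (Real.log 2 : ℂ))) * besselS ν (-(Complex.exp ζ / 2) ^ 2) := by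
  simp only [besselJ, besselS, pow_mul, ← mul_pow, neg_mul, one_mul]

theorem exp_sub_log_two (ζ : ℂ) : Complex.exp (ζ - (Real.log 2 : ℂ)) = Complex.exp ζ / 2 := by
  rw [Complex.exp_sub, ← Complex.ofReal_exp, Real.exp_log two_pos, Complex.ofReal_ofNat]

theorem hasDerivAt_besselI (ν ζ : ℂ) :
    HasDerivAt (besselI ν) (ν * besselI ν ζ + Complex.exp ζ * besselI (ν + 1) ζ) ζ := by
  have e : besselI ν = fun ζ => Complex.exp (ν * (ζ - (Real.log 2 : ℂ))) *
      besselS ν ((Complex.exp ζ / 2) ^ 2) := funext (besselI_eq ν)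
  have h1 : HasDerivAt (fun ζ : ℂ => Complex.exp (ν * (ζ - (Real.log 2 : ℂ))))
      (Complex.exp (ν * (ζ - (Real.log 2 : ℂ))) * (ν * 1)) ζ :=
    (((hasDerivAt_id ζ).sub_const _).const_mul ν).cexp
  have h2 : HasDerivAt (fun ζ : ℂ => (Complex.exp ζ / 2) ^ 2)
      (2 * (Complex.exp ζ / 2) * (Complex.exp ζ / 2)) ζ := by
    simpa using! ((Complex.hasDerivAt_exp ζ).div_const 2).pow 2
  have h3 := h1.mul ((hasDerivAt_besselS ν ((Complex.exp ζ / 2) ^ 2)).comp ζ h2)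
  rw [e]
  convert! h3 using 1
  rw [besselI_eq (ν + 1), add_mul, Complex.exp_add, one_mul, exp_sub_log_two]
  simp only [Function.comp]
  ring

theorem besselI_rec (ν ζ : ℂ) :
    Complex.exp ζ * besselI ν ζ = 2 * (ν + 1) * besselI (ν + 1) ζ +
      Complex.exp ζ * besselI (ν + 2) ζ := by
  rw [besselI_eq, besselI_eq, besselI_eq, besselS_rec ν]
  have h1 := exp_sub_log_two ζ
  set s := ζ - (Real.log 2 : ℂ)
  have e1 : Complex.exp ((ν + 1) * s) = Complex.exp (ν * s) * (Complex.exp ζ / 2) := by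
    rw [← h1, ← Complex.exp_add]; ring_nf
  have e2 : Complex.exp ((ν + 2) * s) = Complex.exp (ν * s) * (Complex.exp ζ / 2) ^ 2 := by
    rw [← h1, ← Complex.exp_nat_mul, ← Complex.exp_add]; push_cast; ring_nf
  rw [e1, e2]
  ring

theorem besselI_wronskian (ν ζ : ℂ) :
    Complex.exp ζ * (besselI (-ν) ζ * besselI (ν + 1) ζ - besselI ν ζ * besselI (-ν - 1) ζ) =
      2 * (Complex.sin (Real.pi * ν) / Real.pi) := by
  have h := besselS_wronskian ν ((Complex.exp ζ / 2) ^ 2)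
  have h1 := exp_sub_log_two ζ
  simp only [besselI_eq]
  set s := ζ - (Real.log 2 : ℂ)
  set w := (Complex.exp ζ / 2) ^ 2
  have h0 := Complex.exp_ne_zero ζ
  have e0 : Complex.exp (-ν * s) = (Complex.exp (ν * s))⁻¹ := by rw [neg_mul, Complex.exp_neg]
  have e1 : Complex.exp ((ν + 1) * s) = Complex.exp (ν * s) * (Complex.exp ζ / 2) := by
    rw [← h1, ← Complex.exp_add]; ring_nf
  have e2 : Complex.exp ((-ν - 1) * s) = (Complex.exp (ν * s))⁻¹ * (Complex.exp ζ / 2)⁻¹ := by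
    rw [← h1, ← Complex.exp_neg, ← Complex.exp_neg, ← Complex.exp_add]; ring_nf
  have e3 : w = Complex.exp ζ ^ 2 / 4 := by simp only [w]; ring
  rw [e0, e1, e2]
  have := Complex.exp_ne_zero (ν * s)
  field_simp
  rw [e3] at h ⊢
  field_simp at h
  linear_combination -h

/-! ### The integral representation of the modified Bessel function `K_ν` -/

theorem one_add_sq_div_two_le_cosh (u : ℝ) : 1 + u ^ 2 / 2 ≤ Real.cosh u := by
  have h1 : Real.cosh u = 1 + 2 * Real.sinh (u / 2) ^ 2 := by
    have h := Real.cosh_two_mul (u / 2)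
    rw [mul_div_cancel₀ u two_ne_zero] at h
    linarith [Real.cosh_sq (u / 2)]
  have h2 : |u / 2| ≤ |Real.sinh (u / 2)| := by
    rw [Real.abs_sinh]
    exact Real.self_le_sinh_iff.2 (abs_nonneg _)
  have h3 := sq_le_sq' (by linarith [abs_nonneg (u / 2), abs_nonneg (Real.sinh (u / 2))]) h2
  rw [sq_abs, sq_abs] at h3
  rw [h1]
  linarith

theorem integrable_exp_neg_sq_add {δ : ℝ} (hδ : 0 < δ) (a : ℝ) :
    Integrable fun u : ℝ => Real.exp (-(δ * u ^ 2) + a * u) := by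
  have h := (integrable_cexp_quadratic (b := (δ : ℂ)) (by simpa using hδ) a 0).norm
  refine h.congr (Eventually.of_forall fun u => ?_)
  simp only [Complex.norm_exp]
  congr 1
  simp [← Complex.ofReal_pow]

theorem exp_abs_mul_le (a u : ℝ) : Real.exp (a * |u|) ≤ Real.exp (a * u) + Real.exp (-a * u) := by
  rcases abs_cases u with ⟨h, -⟩ | ⟨h, -⟩ <;> rw [h]
  · linarith [Real.exp_pos (-a * u)]
  · rw [mul_neg, ← neg_mul]
    linarith [Real.exp_pos (a * u)]

/-- The integrand of the integral representation of `K_ν` at `z = e ^ ζ`. -/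
noncomputable def besselKernel (ν ζ : ℂ) (u : ℝ) : ℂ :=
  Complex.exp (-Complex.exp ζ * (Real.cosh u : ℂ) + ν * u)

/-- `K_ν(z) = ∫_0^∞ e ^ (-z cosh u) cosh (ν u) du`, `Re z > 0`, written as half of an integral over
the whole line. -/
noncomputable def besselKInt (ν ζ : ℂ) : ℂ := 1 / 2 * ∫ u : ℝ, besselKernel ν ζ u

/-- The logarithmic form of the half-plane `Re z > 0`, on all its sheets. -/
def rightHalf : Set ℂ := {ζ | 0 < (Complex.exp ζ).re}

theorem ofReal_mem_rightHalf (x : ℝ) : (x : ℂ) ∈ rightHalf := by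
  rw [rightHalf, Set.mem_ofPred_eq, ← Complex.ofReal_exp]
  exact Real.exp_pos x

theorem holoFamily_besselKernel (ν : ℂ) : HoloFamily volume rightHalf (besselKernel ν) where
  meas ζ _ := by
    unfold besselKernel
    exact Continuous.aestronglyMeasurable (by fun_prop)
  diff := Eventually.of_forall fun u => by
    unfold besselKernel
    exact Differentiable.differentiableOn (by fun_prop)
  dom ζ₀ hζ₀ := by
    have hc : Continuous fun ζ : ℂ => (Complex.exp ζ).re := by fun_prop
    have hζ₀ : 0 < (Complex.exp ζ₀).re := hζ₀
    obtain ⟨r, hr, hball⟩ := Metric.isOpen_iff.1 (isOpen_Ioi.preimage hc) ζ₀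
      (show (Complex.exp ζ₀).re / 2 < (Complex.exp ζ₀).re by linarith)
    refine ⟨r, hr, fun ζ hζ => (half_pos hζ₀).trans (hball hζ), _,
      integrable_exp_neg_sq_add (δ := (Complex.exp ζ₀).re / 4) (by positivity) ν.re,
      Eventually.of_forall fun u ζ hζ => ?_⟩
    have h1 : (Complex.exp ζ₀).re / 2 < (Complex.exp ζ).re := hball hζ
    have h2 := one_add_sq_div_two_le_cosh u
    rw [besselKernel, Complex.norm_exp, Real.exp_le_exp]
    simp only [Complex.add_re, Complex.mul_re, Complex.neg_re, Complex.ofReal_re, Complex.ofReal_im,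
      mul_zero, sub_zero]
    have h3 : (Complex.exp ζ₀).re / 2 * (u ^ 2 / 2) ≤ (Complex.exp ζ).re * Real.cosh u :=
      mul_le_mul h1.le (by linarith) (by positivity) (by linarith)
    linarith

theorem integrable_besselKernel (ν : ℂ) {ζ : ℂ} (hζ : ζ ∈ rightHalf) :
    Integrable (besselKernel ν ζ) := (holoFamily_besselKernel ν).integrable hζ

theorem besselKernel_add (ν μ ζ : ℂ) (u : ℝ) :
    besselKernel (ν + μ) ζ u = Complex.exp (μ * u) * besselKernel ν ζ u := by
  rw [besselKernel, besselKernel, ← Complex.exp_add]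
  ring_nf

theorem besselKernel_add_one_add_sub_one (ν ζ : ℂ) (u : ℝ) :
    besselKernel (ν + 1) ζ u + besselKernel (ν - 1) ζ u =
      2 * (Real.cosh u : ℂ) * besselKernel ν ζ u := by
  rw [sub_eq_add_neg, besselKernel_add, besselKernel_add, Complex.ofReal_cosh, Complex.cosh]
  ring_nf

theorem besselKernel_add_one_sub_sub_one (ν ζ : ℂ) (u : ℝ) :
    besselKernel (ν + 1) ζ u - besselKernel (ν - 1) ζ u =
      2 * (Real.sinh u : ℂ) * besselKernel ν ζ u := by
  rw [sub_eq_add_neg ν, besselKernel_add, besselKernel_add, Complex.ofReal_sinh, Complex.sinh]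
  ring_nf

theorem hasDerivAt_besselKInt (ν : ℂ) {ζ : ℂ} (hζ : ζ ∈ rightHalf) :
    HasDerivAt (besselKInt ν)
      (-(Complex.exp ζ / 2) * (besselKInt (ν + 1) ζ + besselKInt (ν - 1) ζ)) ζ := by
  have h := ((holoFamily_besselKernel ν).hasDerivAt_integral hζ).const_mul (1 / 2)
  refine h.congr_deriv ?_
  have hd (u : ℝ) : deriv (fun ξ => besselKernel ν ξ u) ζ =
      -(Complex.exp ζ / 2) * (besselKernel (ν + 1) ζ u + besselKernel (ν - 1) ζ u) := by
    rw [besselKernel_add_one_add_sub_one]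
    have h1 : HasDerivAt (fun ξ => besselKernel ν ξ u)
        (besselKernel ν ζ u * (-Complex.exp ζ * (Real.cosh u : ℂ))) ζ :=
      ((((Complex.hasDerivAt_exp ζ).neg).mul_const _).add_const _).cexp
    rw [h1.deriv]
    ring
  simp only [hd]
  rw [integral_const_mul, integral_add (integrable_besselKernel _ hζ)
    (integrable_besselKernel _ hζ), besselKInt, besselKInt]
  ring

theorem besselKInt_rec (ν : ℂ) {ζ : ℂ} (hζ : ζ ∈ rightHalf) :
    Complex.exp ζ * (besselKInt (ν + 1) ζ - besselKInt (ν - 1) ζ) = 2 * ν * besselKInt ν ζ := by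
  have hd (u : ℝ) : HasDerivAt (besselKernel ν ζ)
      (ν * besselKernel ν ζ u -
        Complex.exp ζ / 2 * (besselKernel (ν + 1) ζ u - besselKernel (ν - 1) ζ u)) u := by
    have h1 : HasDerivAt (besselKernel ν ζ) (besselKernel ν ζ u *
        (-Complex.exp ζ * ((Real.sinh u : ℝ) : ℂ) + ν * ((1 : ℝ) : ℂ))) u :=
      (((Real.hasDerivAt_cosh u).ofReal_comp.const_mul _).add
        ((hasDerivAt_id u).ofReal_comp.const_mul ν)).cexp
    refine h1.congr_deriv ?_
    rw [besselKernel_add_one_sub_sub_one]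
    push_cast
    ring
  have i0 := integrable_besselKernel ν hζ
  have i1 := integrable_besselKernel (ν + 1) hζ
  have i2 := integrable_besselKernel (ν - 1) hζ
  have h := integral_eq_zero_of_hasDerivAt_of_integrable hd
    ((i0.const_mul ν).sub ((i1.sub i2).const_mul _)) i0
  have i3 : Integrable fun u => Complex.exp ζ / 2 *
      (besselKernel (ν + 1) ζ u - besselKernel (ν - 1) ζ u) := (i1.sub i2).const_mul _
  rw [integral_sub (i0.const_mul ν) i3, integral_const_mul, integral_const_mul,
    integral_sub i1 i2] at h
  simp only [besselKInt]
  linear_combination -h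

theorem besselKInt_neg (ν ζ : ℂ) : besselKInt (-ν) ζ = besselKInt ν ζ := by
  rw [besselKInt, besselKInt, ← integral_neg_eq_self]
  congr 2
  ext u
  simp [besselKernel]

theorem integral_exp_neg_exp_add_mul {ν : ℂ} (hν : 0 < ν.re) :
    Integrable (fun u : ℝ => Complex.exp (-(Real.exp u : ℂ) + ν * u)) ∧
      ∫ u : ℝ, Complex.exp (-(Real.exp u : ℂ) + ν * u) = Complex.Gamma ν := by
  have himg : Real.exp '' Set.univ = Set.Ioi 0 := by rw [Set.image_univ, Real.range_exp]
  have hd : ∀ x ∈ Set.univ, HasDerivWithinAt Real.exp (Real.exp x) Set.univ x :=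
    fun x _ => (Real.hasDerivAt_exp x).hasDerivWithinAt
  have he (u : ℝ) : |Real.exp u| •
      (((Real.exp (-Real.exp u) : ℝ) : ℂ) * ((Real.exp u : ℝ) : ℂ) ^ (ν - 1)) =
      Complex.exp (-(Real.exp u : ℂ) + ν * u) := by
    rw [abs_of_pos (Real.exp_pos u), Complex.real_smul,
      Complex.cpow_def_of_ne_zero (by exact_mod_cast (Real.exp_pos u).ne'),
      ← Complex.ofReal_log (Real.exp_pos u).le, Real.log_exp, Complex.ofReal_exp (-_),
      Complex.ofReal_exp u, ← Complex.exp_add, ← Complex.exp_add]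
    push_cast
    ring_nf
  constructor
  · have h := Complex.GammaIntegral_convergent hν
    rw [← himg, integrableOn_image_iff_integrableOn_abs_deriv_smul MeasurableSet.univ hd
      Real.exp_injective.injOn, integrableOn_univ] at h
    simpa only [he] using h
  · rw [Complex.Gamma_eq_integral hν, Complex.GammaIntegral, ← himg,
      integral_image_eq_integral_abs_deriv_smul MeasurableSet.univ hd Real.exp_injective.injOn,
      setIntegral_univ]
    simp only [he]

/-- The behaviour of `K_ν(z)` as `z → 0`. -/
theorem tendsto_besselKInt_atBot {ν : ℂ} (hν : 0 < ν.re) :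
    Tendsto (fun x : ℝ => Complex.exp (ν * (x - (Real.log 2 : ℂ))) * besselKInt ν x) atBot
      (𝓝 (1 / 2 * Complex.Gamma ν)) := by
  obtain ⟨hi, hG⟩ := integral_exp_neg_exp_add_mul hν
  -- translating `u` by `x - log 2` separates the two exponentials in `cosh u`
  have key (x : ℝ) : Complex.exp (ν * (x - (Real.log 2 : ℂ))) * besselKInt ν x =
      1 / 2 * ∫ u : ℝ, Complex.exp
        (-(Real.exp u : ℂ) - ((Real.exp (2 * x) / 4 * Real.exp (-u) : ℝ) : ℂ) + ν * u) := by
    rw [besselKInt, ← integral_sub_right_eq_self _ (x - Real.log 2), mul_left_comm,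
      ← integral_const_mul]
    congr 2
    ext u
    rw [besselKernel, ← Complex.exp_add]
    congr 1
    have e : Real.exp x * Real.cosh (u - (x - Real.log 2)) =
        Real.exp u + Real.exp (2 * x) / 4 * Real.exp (-u) := by
      rw [Real.cosh_eq, neg_sub, Real.exp_sub, Real.exp_sub (x - _), Real.exp_sub x,
        Real.exp_log two_pos, two_mul, Real.exp_add, Real.exp_neg]
      have := Real.exp_pos x
      have := Real.exp_pos u
      field_simp
      ring
    have e' := congrArg (fun t : ℝ => (t : ℂ)) e
    simp only [Complex.ofReal_mul, Complex.ofReal_add] at e'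
    rw [← Complex.ofReal_exp x, neg_mul, e']
    push_cast
    ring
  simp only [key]
  refine Tendsto.const_mul _ ?_
  rw [← hG]
  refine tendsto_integral_filter_of_dominated_convergence
    (fun u => ‖Complex.exp (-(Real.exp u : ℂ) + ν * u)‖) ?_ ?_ hi.norm ?_
  · exact Eventually.of_forall fun x => Continuous.aestronglyMeasurable (by fun_prop)
  · refine Eventually.of_forall fun x => Eventually.of_forall fun u => ?_
    rw [Complex.norm_exp, Complex.norm_exp, Real.exp_le_exp]
    simp only [Complex.add_re, Complex.sub_re, Complex.neg_re, Complex.ofReal_re]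
    have : 0 ≤ Real.exp (2 * x) / 4 * Real.exp (-u) := by positivity
    linarith
  · refine Eventually.of_forall fun u => ?_
    have h1 : Tendsto (fun x : ℝ => Real.exp (2 * x) / 4 * Real.exp (-u)) atBot (𝓝 0) := by
      have := (Real.tendsto_exp_atBot.comp
        (tendsto_id.const_mul_atBot (two_pos : (0 : ℝ) < 2))).div_const 4 |>.mul_const (Real.exp (-u))
      simpa using this
    have h2 : Continuous fun t : ℝ => Complex.exp (-(Real.exp u : ℂ) - (t : ℂ) + ν * u) := by
      fun_prop
    have h3 := (h2.tendsto 0).comp h1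
    simpa [Function.comp_def] using h3

/-- `K_ν(z) √z e ^ z → √(π / 2)` as `z → ∞` on the positive half-line, by Laplace's method. -/
theorem tendsto_besselKInt_atTop (ν : ℂ) :
    Tendsto (fun x : ℝ => Complex.exp (Complex.exp x + x / 2) * besselKInt ν x) atTop
      (𝓝 (Real.sqrt (Real.pi / 2) : ℂ)) := by
  have key (x : ℝ) : Complex.exp (Complex.exp x + x / 2) * besselKInt ν x =
      1 / 2 * ∫ s : ℝ, Complex.exp
        (-((Real.exp x * (Real.cosh (Real.exp (-(x / 2)) * s) - 1) : ℝ) : ℂ) +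
          ν * ((Real.exp (-(x / 2)) * s : ℝ) : ℂ)) := by
    have hsub := Measure.integral_comp_mul_left (besselKernel ν x) (Real.exp (-(x / 2)))
    rw [abs_of_pos (by positivity), ← Real.exp_neg, neg_neg, Complex.real_smul,
      Complex.ofReal_exp] at hsub
    rw [Complex.exp_add, besselKInt, show (x : ℂ) / 2 = ((x / 2 : ℝ) : ℂ) by push_cast; rfl]
    calc _ = 1 / 2 * (Complex.exp (Complex.exp x) *
        (Complex.exp ((x / 2 : ℝ) : ℂ) * ∫ u : ℝ, besselKernel ν x u)) := by ring
      _ = _ := by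
        rw [← hsub, ← integral_const_mul]
        congr 2
        ext s
        rw [besselKernel, ← Complex.exp_add]
        congr 1
        push_cast
        ring
  simp only [key]
  have hgauss : ∫ s : ℝ, Complex.exp (-((s ^ 2 / 2 : ℝ) : ℂ)) =
      2 * (Real.sqrt (Real.pi / 2) : ℂ) := by
    have h1 := integral_gaussian (1 / 2)
    have h2 : Real.sqrt (Real.pi / (1 / 2)) = 2 * Real.sqrt (Real.pi / 2) := by
      rw [show Real.pi / (1 / 2) = 2 ^ 2 * (Real.pi / 2) by ring, Real.sqrt_mul (by positivity),
        Real.sqrt_sq two_pos.le]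
    rw [h2] at h1
    have h3 := congrArg (fun t : ℝ => (t : ℂ)) h1
    simp only [← integral_complex_ofReal] at h3
    rw [show (2 : ℂ) * (Real.sqrt (Real.pi / 2) : ℂ) = ((2 * Real.sqrt (Real.pi / 2) : ℝ) : ℂ) by
      push_cast; rfl, ← h3]
    congr 1
    ext s
    push_cast
    ring_nf
  rw [show (Real.sqrt (Real.pi / 2) : ℂ) = 1 / 2 * (2 * (Real.sqrt (Real.pi / 2) : ℂ)) by ring,
    ← hgauss]
  refine Tendsto.const_mul _ ?_
  refine tendsto_integral_filter_of_dominated_convergence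
    (fun s => Real.exp (-(1 / 2 * s ^ 2) + |ν.re| * s) + Real.exp (-(1 / 2 * s ^ 2) + -|ν.re| * s))
    ?_ ?_ ((integrable_exp_neg_sq_add (by norm_num) _).add
      (integrable_exp_neg_sq_add (by norm_num) _)) ?_
  · exact Eventually.of_forall fun x => Continuous.aestronglyMeasurable (by fun_prop)
  · refine (eventually_ge_atTop 0).mono fun x hx => Eventually.of_forall fun s => ?_
    have h1 := one_add_sq_div_two_le_cosh (Real.exp (-(x / 2)) * s)
    have h2 : Real.exp x * (Real.exp (-(x / 2)) * s) ^ 2 = s ^ 2 := by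
      rw [mul_pow, ← Real.exp_nat_mul, ← mul_assoc, ← Real.exp_add]
      push_cast
      ring_nf
      simp
    have h3 : 1 / 2 * s ^ 2 ≤ Real.exp x * (Real.cosh (Real.exp (-(x / 2)) * s) - 1) := by
      rw [← h2]
      nlinarith [Real.exp_pos x]
    have h4 : ν.re * (Real.exp (-(x / 2)) * s) ≤ |ν.re| * |s| := by
      refine (le_abs_self _).trans ?_
      rw [abs_mul, abs_mul, abs_of_pos (Real.exp_pos _)]
      refine mul_le_mul_of_nonneg_left ?_ (abs_nonneg _)
      exact mul_le_of_le_one_left (abs_nonneg s) (Real.exp_le_one_iff.2 (by linarith))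
    rw [Complex.norm_exp]
    simp only [Complex.add_re, Complex.mul_re, Complex.neg_re, Complex.ofReal_re, Complex.ofReal_im,
      mul_zero, sub_zero]
    calc _ ≤ Real.exp (-(1 / 2 * s ^ 2) + |ν.re| * |s|) := Real.exp_le_exp.2 (by linarith)
      _ ≤ _ := by
        rw [Real.exp_add, Real.exp_add, Real.exp_add, ← mul_add]
        exact mul_le_mul_of_nonneg_left (exp_abs_mul_le _ _) (Real.exp_pos _).le
  · refine Eventually.of_forall fun s => ?_
    have ht : Tendsto (fun x : ℝ => Real.exp (-(x / 2))) atTop (𝓝[≠] 0) := by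
      refine tendsto_nhdsWithin_iff.2 ⟨?_, Eventually.of_forall fun x => (Real.exp_pos _).ne'⟩
      exact Real.tendsto_exp_neg_atTop_nhds_zero.comp (tendsto_id.atTop_div_const two_pos)
    have h1 : Tendsto (fun x : ℝ => Real.exp x * (Real.cosh (Real.exp (-(x / 2)) * s) - 1)) atTop
        (𝓝 (s ^ 2 / 2)) := by
      have hd : HasDerivAt (fun t : ℝ => Real.sinh (t * (s / 2))) (s / 2) 0 := by
        have := ((hasDerivAt_id (0 : ℝ)).mul_const (s / 2)).sinh
        simpa using! this
      have h2 := ((hd.tendsto_slope_zero.comp ht).pow 2).const_mul 2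
      rw [show 2 * (s / 2) ^ 2 = s ^ 2 / 2 by ring] at h2
      refine h2.congr fun x => ?_
      have h3 := Real.cosh_two_mul (Real.exp (-(x / 2)) * (s / 2))
      rw [Real.cosh_sq, show 2 * (Real.exp (-(x / 2)) * (s / 2)) = Real.exp (-(x / 2)) * s by ring]
        at h3
      have h4 : (Real.exp (-(x / 2)))⁻¹ ^ 2 = Real.exp x := by
        rw [← Real.exp_neg, neg_neg, ← Real.exp_nat_mul]
        push_cast
        ring_nf
      simp only [Function.comp, zero_add, zero_mul, Real.sinh_zero, sub_zero, smul_eq_mul]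
      rw [h3, mul_pow, h4]
      ring
    have h5 : Tendsto (fun x : ℝ => Real.exp (-(x / 2)) * s) atTop (𝓝 0) := by
      simpa using (tendsto_nhdsWithin_iff.1 ht).1.mul_const s
    have h6 : Continuous fun p : ℝ × ℝ => Complex.exp (-(p.1 : ℂ) + ν * (p.2 : ℂ)) := by fun_prop
    have h7 := (h6.tendsto (s ^ 2 / 2, 0)).comp (h1.prodMk_nhds h5)
    simpa [Function.comp_def] using h7

/-- The Wronskian of `K_ν` and `I_ν`, in terms of contiguous functions. -/
theorem besselKInt_wronskian (ν : ℂ) (x : ℝ) :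
    Complex.exp x * (besselKInt ν x * besselI (ν + 1) x + besselKInt (ν + 1) x * besselI ν x) =
      1 := by
  -- for `Re ν > 0` the expression is constant in `x` and tends to `1` as `x → -∞`
  have hpos {ν : ℂ} (hν : 0 < ν.re) (x : ℝ) :
      Complex.exp x * (besselKInt ν x * besselI (ν + 1) x + besselKInt (ν + 1) x * besselI ν x) =
        1 := by
    set W : ℝ → ℂ := fun x : ℝ => Complex.exp x *
      (besselKInt ν x * besselI (ν + 1) x + besselKInt (ν + 1) x * besselI ν x) with hW
    have hd (x : ℝ) : HasDerivAt W 0 x := by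
      have hx := ofReal_mem_rightHalf x
      have d1 := hasDerivAt_besselKInt ν hx
      have d2 := hasDerivAt_besselKInt (ν + 1) hx
      have d3 := hasDerivAt_besselI ν x
      have d4 := hasDerivAt_besselI (ν + 1) x
      have d5 := ((Complex.hasDerivAt_exp (x : ℂ)).mul ((d1.mul d4).add (d2.mul d3))).comp_ofReal
      refine d5.congr_deriv ?_
      have e1 := besselKInt_rec ν hx
      have e2 := besselKInt_rec (ν + 1) hx
      have e3 := besselI_rec ν x
      rw [show ν + 1 + 1 = ν + 2 by ring, add_sub_cancel_right] at *
      simp only [Pi.add_apply, Pi.mul_apply]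
      linear_combination (Complex.exp x * besselI (ν + 1) x / 2) * e1 -
        (Complex.exp x * besselI ν x / 2) * e2 - (Complex.exp x * besselKInt ν x) * e3
    have hc (y : ℝ) : W y = W x :=
      is_const_of_deriv_eq_zero (fun x => (hd x).differentiableAt) (fun x => (hd x).deriv) y x
    have hlim : Tendsto W atBot (𝓝 1) := by
      have l1 := tendsto_besselKInt_atBot hν
      have l2 := tendsto_besselKInt_atBot (ν := ν + 1) (by simp; linarith)
      have l0 : Tendsto (fun x : ℝ => Complex.exp x) atBot (𝓝 0) := by
        have := (Complex.continuous_ofReal.tendsto 0).comp Real.tendsto_exp_atBot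
        simpa [Function.comp_def] using this
      have lw : Tendsto (fun x : ℝ => (Complex.exp x / 2) ^ 2) atBot (𝓝 0) := by
        simpa using (l0.div_const 2).pow 2
      have l3 (μ : ℂ) : Tendsto (fun x : ℝ => besselS μ ((Complex.exp x / 2) ^ 2)) atBot
          (𝓝 (Complex.Gamma (μ + 1))⁻¹) := by
        have := ((differentiable_besselS μ).continuous.tendsto 0).comp lw
        rwa [besselS, tsum_eq_single 0 fun k hk => by simp [hk], pow_zero, Nat.factorial_zero,
          Nat.cast_one, one_mul, Nat.cast_zero, add_zero, one_div] at this
      have l4 := ((l0.pow 2).div_const 2).mul (l1.mul (l3 (ν + 1)))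
      have l5 := l4.add ((l2.mul (l3 ν)).const_mul 2)
      have hG : Complex.Gamma (ν + 1) ≠ 0 :=
        Complex.Gamma_ne_zero_of_re_pos (by simp; linarith)
      rw [zero_pow two_ne_zero, zero_div, zero_mul, zero_add, mul_assoc, mul_inv_cancel₀ hG, mul_one,
        mul_one_div_cancel two_ne_zero] at l5
      refine l5.congr fun x => ?_
      have h1 := exp_sub_log_two x
      simp only [hW, besselI_eq]
      set s := (x : ℂ) - (Real.log 2 : ℂ)
      have e1 : Complex.exp ((ν + 1) * s) = Complex.exp (ν * s) * (Complex.exp x / 2) := by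
        rw [← h1, ← Complex.exp_add]; ring_nf
      rw [e1]
      ring
    exact tendsto_nhds_unique (tendsto_const_nhds.congr fun y => (hc y).symm) hlim
  have hstep (ν : ℂ) :
      Complex.exp x * (besselKInt ν x * besselI (ν + 1) x + besselKInt (ν + 1) x * besselI ν x) =
      Complex.exp x * (besselKInt (ν + 1) x * besselI (ν + 1 + 1) x +
        besselKInt (ν + 1 + 1) x * besselI (ν + 1) x) := by
    have e2 := besselKInt_rec (ν + 1) (ofReal_mem_rightHalf x)
    have e3 := besselI_rec ν x
    rw [show ν + 1 + 1 = ν + 2 by ring, add_sub_cancel_right] at *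
    linear_combination (-besselI (ν + 1) x) * e2 + besselKInt (ν + 1) x * e3
  obtain ⟨n, hn⟩ := exists_nat_gt (-ν.re)
  have hall (n : ℕ) : ∀ ν : ℂ, 0 < ν.re + n → Complex.exp x *
      (besselKInt ν x * besselI (ν + 1) x + besselKInt (ν + 1) x * besselI ν x) = 1 := by
    induction n with
    | zero => exact fun ν hν => hpos (by simpa using hν) x
    | succ n ih =>
      intro ν hν
      rw [hstep]
      refine ih (ν + 1) ?_
      push_cast at hν
      simp only [Complex.add_re, Complex.one_re]
      linarith
  exact hall n ν (by linarith)

/-- On the positive half-line and for `ν ∉ ℤ`, `K_ν` is given by its integral representation. -/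
theorem besselK_eq_besselKInt {ν : ℂ} (hν : Complex.sin (Real.pi * ν) ≠ 0) (x : ℝ) :
    besselK ν x = besselKInt ν x := by
  have hπ : (Real.pi : ℂ) ≠ 0 := by exact_mod_cast Real.pi_ne_zero
  have h1 := besselKInt_wronskian ν x
  have h2 := besselKInt_wronskian (-ν - 1) x
  have h3 := besselI_wronskian ν x
  rw [show -ν - 1 + 1 = -ν by ring, besselKInt_neg, show -ν - 1 = -(ν + 1) by ring,
    besselKInt_neg] at h2
  rw [show -ν - 1 = -(ν + 1) by ring] at h3
  rw [besselK, if_neg hν]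
  have h4 : Complex.sin (Real.pi * ν) =
      Real.pi / 2 * (Complex.exp x * (besselI (-ν) x * besselI (ν + 1) x -
        besselI ν x * besselI (-(ν + 1)) x)) := by
    rw [h3]
    field_simp
  rw [div_eq_iff hν, h4]
  linear_combination (Real.pi / 2) * (besselI ν x * h2 - besselI (-ν) x * h1)

/-! ### The basic terminant -/

theorem one_add_mul_exp_mem_slitPlane {s : ℝ} (hs : 0 ≤ s) {w : ℂ} (hw : |w.im| < Real.pi) :
    1 + s * Complex.exp w ∈ Complex.slitPlane := by
  rw [Complex.mem_slitPlane_iff]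
  rcases hs.eq_or_lt with rfl | hs
  · simp
  by_cases h0 : w.im = 0
  · left
    simp only [Complex.add_re, Complex.one_re, Complex.mul_re, Complex.ofReal_re, Complex.ofReal_im,
      zero_mul, sub_zero, Complex.exp_re, h0, Real.cos_zero, mul_one]
    positivity
  · right
    have h1 : Real.sin w.im ≠ 0 := by
      rw [abs_lt] at hw
      exact fun h => h0 ((Real.sin_eq_zero_iff_of_lt_of_lt hw.1 hw.2).1 h)
    simp only [Complex.add_im, Complex.one_im, Complex.mul_im, Complex.ofReal_re, Complex.ofReal_im,
      zero_mul, add_zero, zero_add, Complex.exp_im]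
    have := Real.exp_pos w.re
    positivity

theorem cos_half_le_norm_one_add_mul_exp {s : ℝ} (hs : 0 ≤ s) (w : ℂ) :
    Real.cos (w.im / 2) ≤ ‖1 + s * Complex.exp w‖ := by
  refine Real.le_sqrt_of_sq_le ?_ |>.trans_eq (Complex.norm_def _).symm
  set r := s * Real.exp w.re with hr
  have hr0 : 0 ≤ r := by positivity
  have h1 : Complex.normSq (1 + s * Complex.exp w) = 1 + 2 * r * Real.cos w.im + r ^ 2 := by
    rw [Complex.normSq_apply]
    simp only [Complex.add_im, Complex.one_im, Complex.mul_im, Complex.ofReal_re, Complex.ofReal_im,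
      zero_mul, add_zero, zero_add, Complex.exp_im, Complex.exp_re, Complex.add_re, Complex.one_re,
      Complex.mul_re, sub_zero]
    rw [hr]
    linear_combination (s * Real.exp w.re) ^ 2 * Real.sin_sq_add_cos_sq w.im
  have h2 : Real.cos w.im = 2 * Real.cos (w.im / 2) ^ 2 - 1 := by
    rw [← Real.cos_two_mul, mul_div_cancel₀ _ two_ne_zero]
  rw [h1, h2]
  have h3 := Real.cos_sq_le_one (w.im / 2)
  nlinarith [mul_nonneg hr0 (sq_nonneg (Real.cos (w.im / 2))), sq_nonneg (1 - r),
    mul_nonneg (sq_nonneg r) (sq_nonneg (Real.cos (w.im / 2))),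
    mul_nonneg (sub_nonneg.2 h3) (sq_nonneg (1 - r))]

/-- The horizontal strip of width `2π` around `Im ζ = φ`. -/
def strip (φ : ℝ) : Set ℂ := {ζ | |ζ.im - φ| < Real.pi}

theorem isOpen_strip (φ : ℝ) : IsOpen (strip φ) :=
  isOpen_lt (by fun_prop) continuous_const

/-- The integrand of `Λ_p(z) = ∫ (1 + τ / z) ^ (-p) e ^ (-τ) dτ` on the ray `τ = s e ^ (i φ)`. -/
noncomputable def termKernel (p φ : ℝ) (ζ : ℂ) (s : ℝ) : ℂ :=
  (1 + s * Complex.exp (φ * Complex.I - ζ)) ^ (-(p : ℂ)) *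
    Complex.exp (-(s * Complex.exp (φ * Complex.I)))

/-- The integral `∫ (1 + τ / z) ^ (-p) e ^ (-τ) dτ` over the ray `arg τ = φ`, at `z = e ^ ζ`. -/
noncomputable def termRay (p φ : ℝ) (ζ : ℂ) : ℂ :=
  Complex.exp (φ * Complex.I) * ∫ s in Set.Ioi 0, termKernel p φ ζ s

theorem abs_im_lt_of_mem_strip {φ : ℝ} {ζ : ℂ} (hζ : ζ ∈ strip φ) :
    |(φ * Complex.I - ζ).im| < Real.pi := by
  have : |ζ.im - φ| < Real.pi := hζ
  rw [abs_sub_comm] at this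
  simpa using this

theorem norm_termKernel_le {p φ m s : ℝ} (hp : 0 < p) (hs : 0 ≤ s) {ζ : ℂ} (hm : 0 < m)
    (hmc : m ≤ Real.cos ((φ - ζ.im) / 2)) :
    ‖termKernel p φ ζ s‖ ≤ m ^ (-p) * Real.exp (-Real.cos φ * s) := by
  have h1 := cos_half_le_norm_one_add_mul_exp hs (φ * Complex.I - ζ)
  rw [show (φ * Complex.I - ζ).im = φ - ζ.im by simp] at h1
  rw [termKernel, norm_mul, ← Complex.ofReal_neg, Complex.norm_cpow_real, Complex.norm_exp]
  refine mul_le_mul ?_ (le_of_eq ?_) (Real.exp_pos _).le (Real.rpow_nonneg hm.le _)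
  · exact Real.rpow_le_rpow_of_nonpos hm (hmc.trans h1) (by linarith)
  · rw [Complex.neg_re, Complex.re_ofReal_mul, Complex.exp_ofReal_mul_I_re]
    ring_nf

theorem continuousOn_termKernel (p φ : ℝ) {ζ : ℂ} (hζ : ζ ∈ strip φ) :
    ContinuousOn (termKernel p φ ζ) (Set.Ici 0) := by
  unfold termKernel
  refine ContinuousOn.mul (ContinuousOn.cpow_const (by fun_prop) fun s hs => ?_) (by fun_prop)
  exact one_add_mul_exp_mem_slitPlane hs (abs_im_lt_of_mem_strip hζ)

theorem hasDerivAt_termKernel (p φ : ℝ) {ζ : ℂ} (hζ : ζ ∈ strip φ) {s : ℝ} (hs : 0 ≤ s) :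
    HasDerivAt (fun ξ => termKernel p φ ξ s)
      (p * (1 + s * Complex.exp (φ * Complex.I - ζ)) ^ (-(p : ℂ) - 1) *
        (s * Complex.exp (φ * Complex.I - ζ)) * Complex.exp (-(s * Complex.exp (φ * Complex.I))))
      ζ := by
  have h1 : HasDerivAt (fun ξ : ℂ => 1 + s * Complex.exp (φ * Complex.I - ξ))
      (s * (Complex.exp (φ * Complex.I - ζ) * -1)) ζ :=
    ((((hasDerivAt_id ζ).const_sub _).cexp).const_mul _).const_add _
  have h2 := (h1.cpow_const (c := -(p : ℂ))
    (one_add_mul_exp_mem_slitPlane hs (abs_im_lt_of_mem_strip hζ))).mul_const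
      (Complex.exp (-(s * Complex.exp (φ * Complex.I))))
  refine h2.congr_deriv ?_
  ring

theorem cos_half_pos {φ : ℝ} {ζ : ℂ} (hζ : ζ ∈ strip φ) : 0 < Real.cos ((φ - ζ.im) / 2) := by
  have h : |ζ.im - φ| < Real.pi := hζ
  rw [abs_lt] at h
  exact Real.cos_pos_of_mem_Ioo ⟨by linarith, by linarith⟩

theorem holoFamily_termKernel {p φ : ℝ} (hp : 0 < p) (hφ : 0 < Real.cos φ) :
    HoloFamily (volume.restrict (Set.Ioi 0)) (strip φ) (termKernel p φ) where
  meas ζ hζ := ((continuousOn_termKernel p φ hζ).mono Set.Ioi_subset_Ici_self).aestronglyMeasurable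
    measurableSet_Ioi
  diff := ae_restrict_of_forall_mem measurableSet_Ioi fun s (hs : 0 < s) ζ hζ =>
    (hasDerivAt_termKernel p φ hζ hs.le).differentiableAt.differentiableWithinAt
  dom ζ₀ hζ₀ := by
    have hm := cos_half_pos hζ₀
    have hc : Continuous fun ζ : ℂ => Real.cos ((φ - ζ.im) / 2) := by fun_prop
    obtain ⟨r, hr, hball⟩ := Metric.isOpen_iff.1 ((isOpen_Ioi.preimage hc).inter (isOpen_strip φ))
      ζ₀ ⟨half_lt_self hm, hζ₀⟩
    refine ⟨r, hr, fun ζ hζ => (hball hζ).2, _, (integrableOn_exp_mul_Ioi (neg_neg_of_pos hφ)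
      0).const_mul ((Real.cos ((φ - ζ₀.im) / 2) / 2) ^ (-p)), ?_⟩
    refine ae_restrict_of_forall_mem measurableSet_Ioi fun s (hs : 0 < s) ζ hζ => ?_
    exact norm_termKernel_le hp hs.le (half_pos hm) (le_of_lt (hball hζ).1)

theorem norm_termRay_le {p φ : ℝ} (hp : 0 < p) (hφ : 0 < Real.cos φ) {ζ : ℂ} (hζ : ζ ∈ strip φ) :
    ‖termRay p φ ζ‖ ≤ Real.cos ((φ - ζ.im) / 2) ^ (-p) / Real.cos φ := by
  rw [termRay, norm_mul, Complex.norm_exp_ofReal_mul_I, one_mul]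
  have h : ∫ s in Set.Ioi 0, Real.cos ((φ - ζ.im) / 2) ^ (-p) * Real.exp (-Real.cos φ * s) =
      Real.cos ((φ - ζ.im) / 2) ^ (-p) / Real.cos φ := by
    rw [integral_const_mul, integral_exp_mul_Ioi (neg_neg_of_pos hφ)]
    simp
    rfl
  rw [← h]
  refine norm_integral_le_of_norm_le ((integrableOn_exp_mul_Ioi (neg_neg_of_pos hφ) 0).const_mul _)
    (ae_restrict_of_forall_mem measurableSet_Ioi fun s (hs : 0 < s) => ?_)
  exact norm_termKernel_le hp hs.le (cos_half_pos hζ) le_rfl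

/-- The differential equation of the terminant, by an integration by parts. -/
theorem hasDerivAt_termRay {p φ : ℝ} (hp : 0 < p) (hφ : 0 < Real.cos φ) {ζ : ℂ}
    (hζ : ζ ∈ strip φ) :
    HasDerivAt (termRay p φ) ((p + Complex.exp ζ) * termRay p φ ζ - Complex.exp ζ) ζ := by
  have hF := holoFamily_termKernel hp hφ
  have h := (hF.hasDerivAt_integral hζ).const_mul (Complex.exp (φ * Complex.I))
  refine h.congr_deriv ?_
  set e := Complex.exp (φ * Complex.I) with he
  set F' : ℝ → ℂ := fun s => deriv (fun ξ => termKernel p φ ξ s) ζ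
  have hi1 : IntegrableOn (termKernel p φ ζ) (Set.Ioi 0) := hF.integrable hζ
  have hi2 : IntegrableOn F' (Set.Ioi 0) := hF.deriv.integrable hζ
  have hi3 : IntegrableOn (fun s => e * (F' s - (p + Complex.exp ζ) * termKernel p φ ζ s))
      (Set.Ioi 0) := (hi2.sub (hi1.const_mul _)).const_mul _
  have hlim : Tendsto (fun s => Complex.exp ζ * termKernel p φ ζ s) atTop (𝓝 0) := by
    have h1 : Tendsto (fun s => Real.cos ((φ - ζ.im) / 2) ^ (-p) * Real.exp (-Real.cos φ * s)) atTop
        (𝓝 0) := by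
      have := (Real.tendsto_exp_atBot.comp
        (tendsto_id.const_mul_atTop_of_neg (neg_neg_of_pos hφ))).const_mul
          (Real.cos ((φ - ζ.im) / 2) ^ (-p))
      simpa using this
    have h2 : Tendsto (termKernel p φ ζ) atTop (𝓝 0) :=
      squeeze_zero_norm' ((eventually_ge_atTop 0).mono fun s hs =>
        norm_termKernel_le hp hs (cos_half_pos hζ) le_rfl) h1
    simpa using h2.const_mul (Complex.exp ζ)
  have hd (s : ℝ) (hs : s ∈ Set.Ioi 0) : HasDerivAt (fun s => Complex.exp ζ * termKernel p φ ζ s)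
      (e * (F' s - (p + Complex.exp ζ) * termKernel p φ ζ s)) s := by
    have hs : 0 < s := hs
    have hmem := one_add_mul_exp_mem_slitPlane hs.le (abs_im_lt_of_mem_strip hζ)
    have h1 : HasDerivAt (fun x : ℝ => 1 + (x : ℂ) * Complex.exp (φ * Complex.I - ζ))
        (((1 : ℝ) : ℂ) * Complex.exp (φ * Complex.I - ζ)) s :=
      ((hasDerivAt_id s).ofReal_comp.mul_const _).const_add _
    have h2 : HasDerivAt (fun x : ℝ => Complex.exp (-((x : ℂ) * e)))
        (Complex.exp (-((s : ℂ) * e)) * -(((1 : ℝ) : ℂ) * e)) s :=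
      ((hasDerivAt_id s).ofReal_comp.mul_const e).neg.cexp
    have h3 : HasDerivAt (fun x : ℝ => (1 + (x : ℂ) * Complex.exp (φ * Complex.I - ζ)) ^ (-(p : ℂ)))
        (-(p : ℂ) * (1 + (s : ℂ) * Complex.exp (φ * Complex.I - ζ)) ^ (-(p : ℂ) - 1) *
          (((1 : ℝ) : ℂ) * Complex.exp (φ * Complex.I - ζ))) s := by
      have h4 : HasDerivAt (fun y : ℂ => y ^ (-(p : ℂ)))
          (-(p : ℂ) * (1 + (s : ℂ) * Complex.exp (φ * Complex.I - ζ)) ^ (-(p : ℂ) - 1) * 1)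
          (1 + (s : ℂ) * Complex.exp (φ * Complex.I - ζ)) :=
        (hasDerivAt_id _).cpow_const hmem
      have h5 := HasDerivAt.comp (h₂ := fun y : ℂ => y ^ (-(p : ℂ))) s h4 h1
      simpa [Function.comp_def] using! h5
    refine ((h3.mul h2).const_mul (Complex.exp ζ)).congr_deriv ?_
    have h6 : F' s = _ := (hasDerivAt_termKernel p φ hζ hs.le).deriv
    rw [h6, termKernel, ← he]
    have h7 : (1 + (s : ℂ) * Complex.exp (φ * Complex.I - ζ)) ^ (-(p : ℂ)) =
        (1 + (s : ℂ) * Complex.exp (φ * Complex.I - ζ)) ^ (-(p : ℂ) - 1) *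
          (1 + (s : ℂ) * Complex.exp (φ * Complex.I - ζ)) := by
      rw [Complex.cpow_sub _ _ (Complex.slitPlane_ne_zero hmem), Complex.cpow_one,
        div_mul_cancel₀ _ (Complex.slitPlane_ne_zero hmem)]
    rw [h7]
    have h8 : Complex.exp (φ * Complex.I - ζ) = e / Complex.exp ζ := Complex.exp_sub _ _
    rw [h8]
    generalize (1 + (s : ℂ) * (e / Complex.exp ζ)) ^ (-(p : ℂ) - 1) = q
    have := Complex.exp_ne_zero ζ
    push_cast
    field_simp
    ring
  have hcont : ContinuousWithinAt (fun s => Complex.exp ζ * termKernel p φ ζ s) (Set.Ici 0) 0 :=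
    (continuousOn_const.mul (continuousOn_termKernel p φ hζ)) 0 Set.self_mem_Ici
  have key := integral_Ioi_of_hasDerivAt_of_tendsto hcont hd hi3 hlim
  have h0 : termKernel p φ ζ 0 = 1 := by simp [termKernel]
  rw [integral_const_mul, integral_sub hi2 (hi1.const_mul _), integral_const_mul, h0] at key
  rw [termRay, ← he]
  linear_combination key

theorem hasDerivAt_termRay_mul_exp {p φ : ℝ} (hp : 0 < p) (hφ : 0 < Real.cos φ) {ζ : ℂ}
    (hζ : ζ ∈ strip φ) :
    HasDerivAt (fun ζ => termRay p φ ζ * Complex.exp (-(p * ζ) - Complex.exp ζ))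
      (-Complex.exp ((1 - p) * ζ - Complex.exp ζ)) ζ := by
  have h1 : HasDerivAt (fun ζ : ℂ => Complex.exp (-(p * ζ) - Complex.exp ζ))
      (Complex.exp (-(p * ζ) - Complex.exp ζ) * (-(p * 1) - Complex.exp ζ)) ζ :=
    (((hasDerivAt_id ζ).const_mul (p : ℂ)).neg.sub (Complex.hasDerivAt_exp ζ)).cexp
  refine ((hasDerivAt_termRay hp hφ hζ).mul h1).congr_deriv ?_
  rw [show (1 - p) * ζ - Complex.exp ζ = ζ + (-(p * ζ) - Complex.exp ζ) by ring, Complex.exp_add ζ]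
  ring

/-- All rays on which the integral converges and which avoid the pole give the terminant. -/
theorem termLambda_eq_termRay {p φ : ℝ} (hp : 0 < p) (hφ : 0 < Real.cos φ) (hφπ : |φ| < Real.pi)
    {ζ : ℂ} (hζ : ζ ∈ strip φ) : termLambda p ζ = termRay p φ ζ := by
  set G : ℂ → ℂ := fun ζ => termRay p φ ζ * Complex.exp (-(p * ζ) - Complex.exp ζ) with hG
  have hreal (x : ℝ) : (x : ℂ) ∈ strip φ := by
    rw [strip, Set.mem_ofPred_eq, Complex.ofReal_im, zero_sub, abs_neg]
    exact hφπ
  have h1 : ∫ t in Set.Ioi (Real.exp ζ.re), (t : ℂ) ^ (1 - (p : ℂ) - 1) * Complex.exp (-(t : ℂ)) =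
      G ζ.re := by
    have hd : ∀ t ∈ Set.Ici (Real.exp ζ.re), HasDerivAt (fun t : ℝ => G (Real.log t : ℝ))
        (-((t : ℂ) ^ (1 - (p : ℂ) - 1) * Complex.exp (-(t : ℂ)))) t := by
      intro t ht
      have ht : 0 < t := (Real.exp_pos _).trans_le ht
      have e := (hasDerivAt_termRay_mul_exp hp hφ (hreal (Real.log t))).comp_ofReal
      have e2 := e.scomp t (Real.hasDerivAt_log ht.ne')
      refine e2.congr_deriv ?_
      rw [Complex.cpow_def_of_ne_zero (by exact_mod_cast ht.ne'), Complex.ofReal_log ht.le,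
        Complex.exp_log (by exact_mod_cast ht.ne'), Complex.real_smul, ← Complex.exp_add]
      rw [show (1 - (p : ℂ)) * Complex.log t - t =
        Complex.log t + (Complex.log t * (1 - p - 1) + -(t : ℂ)) by ring, Complex.exp_add,
        Complex.exp_log (by exact_mod_cast ht.ne')]
      push_cast
      have : (t : ℂ) ≠ 0 := by exact_mod_cast ht.ne'
      field_simp
    have hlim : Tendsto (fun t : ℝ => G (Real.log t : ℝ)) atTop (𝓝 0) := by
      have hx : Tendsto (fun x : ℝ => G x) atTop (𝓝 0) := by
        have hb (x : ℝ) (hx : 0 ≤ x) :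
            ‖G x‖ ≤ Real.cos (φ / 2) ^ (-p) / Real.cos φ * Real.exp (-(Real.exp x)) := by
          have hr := norm_termRay_le hp hφ (hreal x)
          rw [Complex.ofReal_im, sub_zero] at hr
          rw [hG, norm_mul]
          refine mul_le_mul hr ?_ (norm_nonneg _) ((norm_nonneg _).trans hr)
          rw [Complex.norm_exp, Real.exp_le_exp, ← Complex.ofReal_exp, ← Complex.ofReal_mul,
            Complex.sub_re, Complex.neg_re, Complex.ofReal_re, Complex.ofReal_re]
          nlinarith
        refine squeeze_zero_norm' ((eventually_ge_atTop 0).mono hb) ?_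
        simpa using (Real.tendsto_exp_neg_atTop_nhds_zero.comp Real.tendsto_exp_atTop).const_mul
          (Real.cos (φ / 2) ^ (-p) / Real.cos φ)
      exact hx.comp Real.tendsto_log_atTop
    have hint : IntegrableOn (fun t : ℝ => -((t : ℂ) ^ (1 - (p : ℂ) - 1) * Complex.exp (-(t : ℂ))))
        (Set.Ioi (Real.exp ζ.re)) := by
      refine Integrable.neg ?_
      refine Integrable.mono' ((integrableOn_exp_mul_Ioi (a := -1) (by norm_num)
        (Real.exp ζ.re)).const_mul (Real.exp ζ.re ^ (-p))) ?_ ?_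
      · refine ContinuousOn.aestronglyMeasurable (fun t ht => ?_) measurableSet_Ioi
        have ht : 0 < t := (Real.exp_pos _).trans ht
        refine ContinuousAt.continuousWithinAt (ContinuousAt.mul ?_ (by fun_prop))
        exact Complex.continuousAt_ofReal_cpow_const t _ (Or.inr ht.ne')
      · refine ae_restrict_of_forall_mem measurableSet_Ioi fun t ht => ?_
        have ht0 : 0 < t := (Real.exp_pos _).trans ht
        rw [norm_mul, Complex.norm_cpow_eq_rpow_re_of_pos ht0, Complex.norm_exp]
        refine mul_le_mul ?_ (le_of_eq ?_) (Real.exp_pos _).le (by positivity)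
        · simp only [Complex.sub_re, Complex.one_re, Complex.ofReal_re]
          rw [show 1 - p - 1 = -p by ring]
          exact Real.rpow_le_rpow_of_nonpos (Real.exp_pos _) (le_of_lt ht) (by linarith)
        · simp
    have h := integral_Ioi_of_hasDerivAt_of_tendsto' hd hint hlim
    rw [integral_neg, Real.log_exp, zero_sub, neg_inj] at h
    exact h
  have h2 : Complex.I * ∫ y in (0 : ℝ)..ζ.im,
      Complex.exp ((1 - p) * ((ζ.re : ℂ) + y * Complex.I) -
        Complex.exp ((ζ.re : ℂ) + y * Complex.I)) = G ζ.re - G ζ := by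
    have hd : ∀ y ∈ Set.uIcc 0 ζ.im, HasDerivAt (fun y : ℝ => G ((ζ.re : ℂ) + y * Complex.I))
        (-Complex.I * Complex.exp ((1 - p) * ((ζ.re : ℂ) + y * Complex.I) -
          Complex.exp ((ζ.re : ℂ) + y * Complex.I))) y := by
      intro y hy
      have hmem : (ζ.re : ℂ) + y * Complex.I ∈ strip φ := by
        have hζ : |ζ.im - φ| < Real.pi := hζ
        rw [strip, Set.mem_ofPred_eq]
        simp only [Complex.add_im, Complex.ofReal_im, zero_add, Complex.mul_im,
          Complex.ofReal_re, Complex.I_im, mul_one, Complex.I_re, mul_zero, add_zero]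
        rw [abs_lt] at *
        rcases Set.mem_uIcc.1 hy with hy | hy <;> constructor <;> linarith
      have e1 : HasDerivAt (fun y : ℝ => (ζ.re : ℂ) + y * Complex.I)
          (((1 : ℝ) : ℂ) * Complex.I) y :=
        ((hasDerivAt_id y).ofReal_comp.mul_const _).const_add _
      have e2 := HasDerivAt.comp y (hasDerivAt_termRay_mul_exp hp hφ hmem) e1
      refine e2.congr_deriv ?_
      push_cast
      ring
    have h := intervalIntegral.integral_eq_sub_of_hasDerivAt hd
      (Continuous.intervalIntegrable (by fun_prop) _ _)
    rw [intervalIntegral.integral_const_mul, Complex.re_add_im, Complex.ofReal_zero, zero_mul,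
      add_zero] at h
    linear_combination -h
  rw [termLambda, incGamma, h1, h2, sub_sub_cancel, hG, mul_left_comm, ← Complex.exp_add,
    ← Complex.exp_add]
  ring_nf
  simp

/-- The part of the Riemann surface of the logarithm with `|arg z| < 3π/2`. -/
def wideStrip : Set ℂ := {ζ | |ζ.im| < 3 * Real.pi / 2}

theorem isOpen_wideStrip : IsOpen wideStrip := isOpen_lt (by fun_prop) continuous_const

theorem cos_third_pos {ζ : ℂ} (hζ : ζ ∈ wideStrip) : 0 < Real.cos (ζ.im / 3) := by
  have hζ : |ζ.im| < 3 * Real.pi / 2 := hζ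
  rw [abs_lt] at hζ
  exact Real.cos_pos_of_mem_Ioo ⟨by linarith, by linarith⟩

theorem mem_strip_third {ζ : ℂ} (hζ : ζ ∈ wideStrip) : ζ ∈ strip (ζ.im / 3) := by
  have hζ : |ζ.im| < 3 * Real.pi / 2 := hζ
  rw [strip, Set.mem_ofPred_eq]
  rw [abs_lt] at *
  constructor <;> linarith

theorem abs_third_lt {ζ : ℂ} (hζ : ζ ∈ wideStrip) : |ζ.im / 3| < Real.pi := by
  have hζ : |ζ.im| < 3 * Real.pi / 2 := hζ
  rw [abs_lt] at *
  constructor <;> linarith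

/-- The ray `arg τ = (arg z) / 3` is admissible on the whole of `|arg z| < 3π/2`. -/
theorem norm_termLambda_le {p : ℝ} (hp : 0 < p) {ζ : ℂ} (hζ : ζ ∈ wideStrip) :
    ‖termLambda p ζ‖ ≤ Real.cos (ζ.im / 3) ^ (-p) / Real.cos (ζ.im / 3) := by
  rw [termLambda_eq_termRay hp (cos_third_pos hζ) (abs_third_lt hζ) (mem_strip_third hζ)]
  have h := norm_termRay_le hp (cos_third_pos hζ) (mem_strip_third hζ)
  rwa [show (ζ.im / 3 - ζ.im) / 2 = -(ζ.im / 3) by ring, Real.cos_neg] at h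

theorem hasDerivAt_termLambda {p : ℝ} (hp : 0 < p) {ζ : ℂ} (hζ : ζ ∈ wideStrip) :
    HasDerivAt (termLambda p) ((p + Complex.exp ζ) * termLambda p ζ - Complex.exp ζ) ζ := by
  have h1 := cos_third_pos hζ
  have h2 := abs_third_lt hζ
  rw [termLambda_eq_termRay hp h1 h2 (mem_strip_third hζ)]
  refine (hasDerivAt_termRay hp h1 (mem_strip_third hζ)).congr_of_eventuallyEq ?_
  filter_upwards [(isOpen_strip _).mem_nhds (mem_strip_third hζ)] with ξ hξ
  exact termLambda_eq_termRay hp h1 h2 hξ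

/-! ### The coefficients as moments -/

/-- `∫ e ^ (ν u) (1 + cosh u) ^ (-p) du` over the real line. -/
noncomputable def moment (p : ℝ) (ν : ℂ) : ℂ :=
  ∫ u : ℝ, Complex.exp (ν * u) * (((1 + Real.cosh u) ^ (-p) : ℝ) : ℂ)

theorem one_add_cosh_pos (u : ℝ) : 0 < 1 + Real.cosh u := by linarith [Real.cosh_pos u]

theorem integrable_moment {p : ℝ} {ν : ℂ} (hν : |ν.re| < p) :
    Integrable (fun u : ℝ => Complex.exp (ν * u) * (((1 + Real.cosh u) ^ (-p) : ℝ) : ℂ)) ∧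
    moment p ν =
      2 ^ (p : ℂ) * (Complex.Gamma (p + ν) * Complex.Gamma (p - ν) / Complex.Gamma (2 * p)) := by
  rw [abs_lt] at hν
  have hp : 0 < p := by linarith
  have ha : 0 < (p + ν).re := by simp; linarith
  have hb : 0 < (p - ν).re := by simp; linarith
  -- the substitution `x = e ^ u / (1 + e ^ u)` turns the integral into Euler's beta integral
  have himg : Real.sigmoid '' Set.univ = Set.Ioo 0 1 := by rw [Set.image_univ, Real.range_sigmoid]
  have hd : ∀ x ∈ Set.univ, HasDerivWithinAt Real.sigmoid
      (Real.sigmoid x * (1 - Real.sigmoid x)) Set.univ x :=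
    fun x _ => (Real.hasDerivAt_sigmoid x).hasDerivWithinAt
  have he (u : ℝ) : |Real.sigmoid u * (1 - Real.sigmoid u)| •
      ((Real.sigmoid u : ℂ) ^ (p + ν - 1) * (1 - (Real.sigmoid u : ℂ)) ^ (p - ν - 1)) =
      ((2 : ℂ) ^ (p : ℂ))⁻¹ *
        (Complex.exp (ν * u) * (((1 + Real.cosh u) ^ (-p) : ℝ) : ℂ)) := by
    have h0 : 0 < Real.sigmoid u := Real.sigmoid_pos u
    have h1 : 0 < 1 - Real.sigmoid u := sub_pos.2 (Real.sigmoid_lt_one u)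
    have hE : 0 < 1 + Real.exp u := by positivity
    have e1 : Real.sigmoid u = Real.exp u / (1 + Real.exp u) := by
      rw [Real.sigmoid, Real.exp_neg]
      have := Real.exp_pos u
      field_simp
      ring
    have e2 : 1 - Real.sigmoid u = 1 / (1 + Real.exp u) := by
      rw [e1]
      field_simp
      ring
    have l1 : Real.log (Real.sigmoid u) = u - Real.log (1 + Real.exp u) := by
      rw [e1, Real.log_div (Real.exp_pos u).ne' hE.ne', Real.log_exp]
    have l2 : Real.log (1 - Real.sigmoid u) = -Real.log (1 + Real.exp u) := by
      rw [e2, one_div, Real.log_inv]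
    have l3 : Real.log (1 + Real.cosh u) = 2 * Real.log (1 + Real.exp u) - u - Real.log 2 := by
      have : 1 + Real.cosh u = (1 + Real.exp u) ^ 2 / (Real.exp u * 2) := by
        rw [Real.cosh_eq, Real.exp_neg]
        have := Real.exp_pos u
        field_simp
        ring
      rw [this, Real.log_div (by positivity) (by positivity), Real.log_pow,
        Real.log_mul (by positivity) (by positivity), Real.log_exp]
      push_cast
      ring
    have hpow (x : ℝ) (hx : 0 < x) (a : ℂ) : (x : ℂ) ^ a = Complex.exp (Real.log x * a) := by
      rw [Complex.cpow_def_of_ne_zero (by exact_mod_cast hx.ne'), Complex.ofReal_log hx.le]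
    have hpow2 : (2 : ℂ) ^ (p : ℂ) = Complex.exp (Real.log 2 * p) := by
      have := hpow 2 two_pos p
      rwa [Complex.ofReal_ofNat] at this
    have hpre : ((Real.sigmoid u * (1 - Real.sigmoid u) : ℝ) : ℂ) =
        Complex.exp (Real.log (Real.sigmoid u) : ℝ) *
          Complex.exp (Real.log (1 - Real.sigmoid u) : ℝ) := by
      rw [← Complex.ofReal_exp, ← Complex.ofReal_exp, Real.exp_log h0, Real.exp_log h1,
        Complex.ofReal_mul]
    have hsub : 1 - (Real.sigmoid u : ℂ) = ((1 - Real.sigmoid u : ℝ) : ℂ) := by push_cast; rfl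
    rw [abs_of_pos (mul_pos h0 h1), Complex.real_smul, hpre, hsub, hpow _ h0, hpow _ h1, hpow2, ← Complex.exp_neg,
      Real.rpow_def_of_pos (one_add_cosh_pos u), Complex.ofReal_exp, ← Complex.exp_add,
      ← Complex.exp_add, ← Complex.exp_add, ← Complex.exp_add, ← Complex.exp_add, l1, l2, l3]
    congr 1
    push_cast
    ring
  have h2 : (2 : ℂ) ^ (p : ℂ) ≠ 0 := by simp [Complex.cpow_eq_zero_iff]
  constructor
  · have h := (Complex.betaIntegral_convergent ha hb).1
    rw [integrableOn_Ioc_iff_integrableOn_Ioo, ← himg,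
      integrableOn_image_iff_integrableOn_abs_deriv_smul MeasurableSet.univ hd
        Real.sigmoid_injective.injOn, integrableOn_univ] at h
    simp only [he] at h
    have h3 := h.const_mul ((2 : ℂ) ^ (p : ℂ))
    simpa only [mul_inv_cancel_left₀ h2] using h3
  · have h := Complex.Gamma_mul_Gamma_eq_betaIntegral ha hb
    rw [Complex.betaIntegral, intervalIntegral.integral_of_le zero_le_one,
      integral_Ioc_eq_integral_Ioo, ← himg,
      integral_image_eq_integral_abs_deriv_smul MeasurableSet.univ hd
        Real.sigmoid_injective.injOn, setIntegral_univ] at h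
    simp only [he] at h
    rw [integral_const_mul] at h
    have hG : Complex.Gamma (2 * p) ≠ 0 := Complex.Gamma_ne_zero_of_re_pos (by simpa using hp)
    rw [show (p : ℂ) + ν + (p - ν) = 2 * p by ring] at h
    rw [h, mul_div_cancel_left₀ _ hG, mul_inv_cancel_left₀ h2, moment]

theorem cos_mul_Gamma_mul_Gamma {N : ℕ} {ν : ℂ} (hν : |ν.re| < N + 1 / 2) :
    Complex.cos (Real.pi * ν) *
      (Complex.Gamma (N + 1 / 2 + ν) * Complex.Gamma (N + 1 / 2 - ν)) =
      Real.pi * ∏ k ∈ Finset.range N, (((k : ℂ) + 1 / 2) ^ 2 - ν ^ 2) := by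
  have hπ : (Real.pi : ℂ) ≠ 0 := by exact_mod_cast Real.pi_ne_zero
  -- reciprocals of gamma functions have no poles, so no case distinction is needed
  have key (n : ℕ) : (Complex.Gamma (n + 1 / 2 + ν))⁻¹ * (Complex.Gamma (n + 1 / 2 - ν))⁻¹ *
      ∏ k ∈ Finset.range n, (((k : ℂ) + 1 / 2) ^ 2 - ν ^ 2) =
      Complex.cos (Real.pi * ν) / Real.pi := by
    induction n with
    | zero =>
      have h := Complex.Gamma_mul_Gamma_one_sub (1 / 2 + ν)
      rw [show 1 - (1 / 2 + ν) = 1 / 2 - ν by ring,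
        show (Real.pi : ℂ) * (1 / 2 + ν) = Real.pi * ν + Real.pi / 2 by ring,
        Complex.sin_add_pi_div_two] at h
      rw [Nat.cast_zero, zero_add, ← mul_inv, h, Finset.prod_range_zero, mul_one, inv_div]
    | succ n ih =>
      rw [← ih, Finset.prod_range_succ,
        Complex.one_div_Gamma_eq_self_mul_one_div_Gamma_add_one (n + 1 / 2 + ν),
        Complex.one_div_Gamma_eq_self_mul_one_div_Gamma_add_one (n + 1 / 2 - ν)]
      rw [show (n : ℂ) + 1 / 2 + ν + 1 = ((n + 1 : ℕ) : ℂ) + 1 / 2 + ν by push_cast; ring,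
        show (n : ℂ) + 1 / 2 - ν + 1 = ((n + 1 : ℕ) : ℂ) + 1 / 2 - ν by push_cast; ring]
      ring
  rw [abs_lt] at hν
  have h12 : (1 / 2 : ℂ).re = 1 / 2 := by norm_num
  have h1 : Complex.Gamma (N + 1 / 2 + ν) ≠ 0 := Complex.Gamma_ne_zero_of_re_pos (by
    simp only [Complex.add_re, Complex.natCast_re, h12]; linarith)
  have h2 : Complex.Gamma (N + 1 / 2 - ν) ≠ 0 := Complex.Gamma_ne_zero_of_re_pos (by
    simp only [Complex.add_re, Complex.sub_re, Complex.natCast_re, h12]; linarith)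
  have h := key N
  generalize Complex.Gamma (N + 1 / 2 + ν) = g₁ at *
  generalize Complex.Gamma (N + 1 / 2 - ν) = g₂ at *
  generalize ∏ k ∈ Finset.range N, (((k : ℂ) + 1 / 2) ^ 2 - ν ^ 2) = P at *
  generalize Complex.cos (Real.pi * ν) = c at *
  field_simp at h
  linear_combination -h

/-- The coefficients `a_n(ν)` of the asymptotic expansion of `K_ν`. -/
noncomputable def coeffA (n : ℕ) (ν : ℂ) : ℂ :=
  (∏ k ∈ Finset.range n, (4 * ν ^ 2 - (2 * (k : ℂ) + 1) ^ 2)) / (8 ^ n * (Nat.factorial n : ℂ))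

theorem coeffA_succ (n : ℕ) (ν : ℂ) :
    2 * ((n : ℂ) + 1) * coeffA (n + 1) ν = -(((n : ℂ) + 1 / 2) ^ 2 - ν ^ 2) * coeffA n ν := by
  have h1 : (n : ℂ) + 1 ≠ 0 := Nat.cast_add_one_ne_zero n
  have h2 : (Nat.factorial n : ℂ) ≠ 0 := by exact_mod_cast (Nat.factorial_pos n).ne'
  rw [coeffA, coeffA, Finset.prod_range_succ, Nat.factorial_succ]
  push_cast
  field_simp
  ring

/-- The constant `C` in `a_N(ν) = C cos (π ν) ∫ e ^ (ν u) (1 + cosh u) ^ (-N - 1/2) du`. -/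
noncomputable def momentConst (N : ℕ) : ℝ :=
  (-1) ^ N * (Nat.factorial (2 * N)) /
    (2 ^ N * Nat.factorial N * Real.pi * 2 ^ ((N : ℝ) + 1 / 2))

theorem coeffA_eq_moment {N : ℕ} {ν : ℂ} (hν : |ν.re| < N + 1 / 2) :
    coeffA N ν =
      (momentConst N : ℂ) * Complex.cos (Real.pi * ν) * moment ((N : ℝ) + 1 / 2) ν := by
  have hG : Complex.Gamma (2 * ((N : ℂ) + 1 / 2)) = (Nat.factorial (2 * N) : ℂ) := by
    rw [← Complex.Gamma_nat_eq_factorial]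
    push_cast
    ring_nf
  have h1 := cos_mul_Gamma_mul_Gamma hν
  rw [(integrable_moment hν).2, momentConst]
  push_cast
  rw [hG]
  have hπ : (Real.pi : ℂ) ≠ 0 := by exact_mod_cast Real.pi_ne_zero
  have h2 : (Nat.factorial (2 * N) : ℂ) ≠ 0 := by exact_mod_cast (Nat.factorial_pos _).ne'
  have h3 : (Nat.factorial N : ℂ) ≠ 0 := by exact_mod_cast (Nat.factorial_pos _).ne'
  have h4 : ((2 ^ ((N : ℝ) + 1 / 2) : ℝ) : ℂ) = (2 : ℂ) ^ ((N : ℂ) + 1 / 2) := by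
    rw [Complex.ofReal_cpow two_pos.le]
    push_cast
    rfl
  have h5 : (2 : ℂ) ^ ((N : ℂ) + 1 / 2) ≠ 0 := by simp [Complex.cpow_eq_zero_iff]
  have h6 : ∏ k ∈ Finset.range N, (4 * ν ^ 2 - (2 * (k : ℂ) + 1) ^ 2) =
      (-1) ^ N * 4 ^ N * ∏ k ∈ Finset.range N, (((k : ℂ) + 1 / 2) ^ 2 - ν ^ 2) := by
    rw [← mul_pow, ← Finset.card_range N, ← Finset.prod_const, Finset.card_range,
      ← Finset.prod_mul_distrib]
    refine Finset.prod_congr rfl fun k _ => by ring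
  rw [coeffA, h6, h4, show (8 : ℂ) = 2 * 4 by norm_num, mul_pow]
  generalize Complex.Gamma (N + 1 / 2 + ν) = g₁ at *
  generalize Complex.Gamma (N + 1 / 2 - ν) = g₂ at *
  generalize ∏ k ∈ Finset.range N, (((k : ℂ) + 1 / 2) ^ 2 - ν ^ 2) = P at *
  generalize Complex.cos (Real.pi * ν) = c at *
  generalize (2 : ℂ) ^ ((N : ℂ) + 1 / 2) = d at *
  field_simp
  linear_combination -h1

theorem coeffB_eq_coeffA (n : ℕ) (ν : ℂ) :
    coeffB n ν = 1 / 2 * (coeffA n (ν + 1) + coeffA n (ν - 1)) := by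
  rcases n with _ | n
  · simp [coeffB, coeffA]
    norm_num
  have hprod (ν : ℂ) (n : ℕ) : ∏ k ∈ Finset.range (n + 1), (4 * (ν + 1) ^ 2 - (2 * (k : ℂ) + 1) ^ 2) =
      (∏ k ∈ Finset.range n, (4 * ν ^ 2 - (2 * (k : ℂ) + 1) ^ 2)) *
        ((2 * ν + 2 * (n + 1)) ^ 2 - 1) := by
    induction n with
    | zero => simp; ring
    | succ n ih =>
      rw [Finset.prod_range_succ, ih, Finset.prod_range_succ]
      push_cast
      ring
  have h1 := hprod ν n
  have h2 := hprod (-ν) n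
  rw [show -ν + 1 = -(ν - 1) by ring] at h2
  simp only [neg_sq] at h2
  rw [coeffB, if_neg n.succ_ne_zero, coeffA, coeffA, h1, h2, add_tsub_cancel_right]
  push_cast
  ring

/-- Integrals `∫ e ^ (ν u) f(u) du` are holomorphic in `ν`. -/
theorem holoFamily_exp_mul {p C : ℝ} {f : ℝ → ℂ} (hf : AEStronglyMeasurable f volume)
    (hfC : ∀ u, ‖f u‖ ≤ C * (1 + Real.cosh u) ^ (-p)) :
    HoloFamily volume {ν | |ν.re| < p} fun ν u => Complex.exp (ν * u) * f u where
  meas ν _ := (Continuous.aestronglyMeasurable (by fun_prop)).mul hf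
  diff := Eventually.of_forall fun u => Differentiable.differentiableOn (by fun_prop)
  dom ν₀ hν₀ := by
    have hν₀ : |ν₀.re| < p := hν₀
    set a := (|ν₀.re| + p) / 2 with ha
    have ha0 : 0 ≤ a := by linarith [abs_nonneg ν₀.re]
    have hball (ν : ℂ) (hν : ν ∈ Metric.ball ν₀ ((p - |ν₀.re|) / 2)) : |ν.re| < a := by
      rw [Metric.mem_ball, dist_eq_norm] at hν
      have h1 := (Complex.abs_re_le_norm (ν - ν₀)).trans_lt hν
      rw [Complex.sub_re] at h1
      linarith [abs_sub_abs_le_abs_sub ν.re ν₀.re]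
    have hi (b : ℝ) (hb : |b| = a) :
        Integrable fun u : ℝ => Real.exp (b * u) * (1 + Real.cosh u) ^ (-p) := by
      have h := (integrable_moment (p := p) (ν := (b : ℂ)) (by simp [hb, ha]; linarith)).1.norm
      refine h.congr (Eventually.of_forall fun u => ?_)
      simp only [norm_mul, ← Complex.ofReal_mul, ← Complex.ofReal_exp, Complex.norm_real,
        Real.norm_eq_abs]
      rw [abs_of_pos (Real.exp_pos _), abs_of_pos (Real.rpow_pos_of_pos (one_add_cosh_pos u) _)]
    refine ⟨(p - |ν₀.re|) / 2, by linarith, fun ν hν => ?_, _,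
      ((hi a (abs_of_nonneg ha0)).add (hi (-a) (by rw [abs_neg, abs_of_nonneg ha0]))).const_mul C,
      Eventually.of_forall fun u ν hν => ?_⟩
    · exact (hball ν hν).trans (by rw [ha]; linarith)
    · have h1 : ‖Complex.exp (ν * u)‖ ≤ Real.exp (a * u) + Real.exp (-a * u) := by
        refine le_trans ?_ (exp_abs_mul_le a u)
        rw [Complex.norm_exp, Real.exp_le_exp, Complex.re_mul_ofReal]
        calc ν.re * u ≤ |ν.re * u| := le_abs_self _
          _ = |ν.re| * |u| := abs_mul _ _
          _ ≤ a * |u| := mul_le_mul_of_nonneg_right (hball ν hν).le (abs_nonneg u)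
      rw [norm_mul]
      refine (mul_le_mul h1 (hfC u) (norm_nonneg _) (by positivity)).trans_eq ?_
      simp only [Pi.add_apply]
      ring

/-! ### The superposition of terminants and its differential equation -/

/-- `z ^ (-p) Λ_p(z) = e ^ z Γ(1 - p, z)` at `z = e ^ ζ`. -/
noncomputable def termQ (p : ℝ) (ζ : ℂ) : ℂ := Complex.exp (-(p * ζ)) * termLambda p ζ

/-- The first derivative of `termQ`. -/
noncomputable def termQ₁ (p : ℝ) (ζ : ℂ) : ℂ :=
  Complex.exp ζ * termQ p ζ - Complex.exp ((1 - p) * ζ)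

/-- The second derivative of `termQ`. -/
noncomputable def termQ₂ (p : ℝ) (ζ : ℂ) : ℂ :=
  Complex.exp ζ * termQ p ζ + Complex.exp ζ * termQ₁ p ζ - (1 - p) * Complex.exp ((1 - p) * ζ)

theorem hasDerivAt_termQ {p : ℝ} (hp : 0 < p) {ζ : ℂ} (hζ : ζ ∈ wideStrip) :
    HasDerivAt (termQ p) (termQ₁ p ζ) ζ := by
  have h1 : HasDerivAt (fun ζ : ℂ => Complex.exp (-(p * ζ))) (Complex.exp (-(p * ζ)) * -(p * 1)) ζ :=
    (((hasDerivAt_id ζ).const_mul (p : ℂ)).neg).cexp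
  refine (h1.mul (hasDerivAt_termLambda hp hζ)).congr_deriv ?_
  rw [termQ₁, termQ, show (1 - p) * ζ = -(p * ζ) + ζ by ring, Complex.exp_add]
  ring

theorem hasDerivAt_termQ₁ {p : ℝ} (hp : 0 < p) {ζ : ℂ} (hζ : ζ ∈ wideStrip) :
    HasDerivAt (termQ₁ p) (termQ₂ p ζ) ζ := by
  have h1 : HasDerivAt (fun ζ : ℂ => Complex.exp ((1 - p) * ζ))
      (Complex.exp ((1 - p) * ζ) * ((1 - p) * 1)) ζ :=
    ((hasDerivAt_id ζ).const_mul (1 - (p : ℂ))).cexp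
  refine (((Complex.hasDerivAt_exp ζ).mul (hasDerivAt_termQ hp hζ)).sub h1).congr_deriv ?_
  rw [termQ₂]
  ring

/-- `log (1 + cosh u)`. -/
noncomputable def shift (u : ℝ) : ℝ := Real.log (1 + Real.cosh u)

theorem exp_shift (u : ℝ) : Complex.exp (shift u) = ((1 + Real.cosh u : ℝ) : ℂ) := by
  rw [← Complex.ofReal_exp, shift, Real.exp_log (one_add_cosh_pos u)]

theorem exp_mul_shift (a u : ℝ) : Real.exp (a * shift u) = (1 + Real.cosh u) ^ a := by
  rw [shift, Real.rpow_def_of_pos (one_add_cosh_pos u), mul_comm]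

theorem continuous_shift : Continuous shift :=
  Continuous.log (by fun_prop) fun u => (one_add_cosh_pos u).ne'

theorem hasDerivAt_shift (u : ℝ) : HasDerivAt shift (Real.sinh u / (1 + Real.cosh u)) u :=
  ((Real.hasDerivAt_cosh u).const_add 1).log (one_add_cosh_pos u).ne'

theorem add_ofReal_mem_wideStrip {ζ : ℂ} (hζ : ζ ∈ wideStrip) (s : ℝ) : ζ + s ∈ wideStrip := by
  have : |ζ.im| < 3 * Real.pi / 2 := hζ
  simpa [wideStrip] using! this

theorem ofReal_mem_wideStrip (x : ℝ) : (x : ℂ) ∈ wideStrip := by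
  have : |(0 : ℝ)| < 3 * Real.pi / 2 := by rw [abs_zero]; positivity
  simpa [wideStrip] using! this

/-- A bound for `|z ^ (-p) Λ_p(w)|` on the ray `arg w = arg z`. -/
noncomputable def termBound (p : ℝ) (ζ : ℂ) : ℝ :=
  Real.exp (-p * ζ.re) * (Real.cos (ζ.im / 3) ^ (-p) / Real.cos (ζ.im / 3))

theorem norm_termQ_shift_le {p : ℝ} (hp : 0 < p) {ζ : ℂ} (hζ : ζ ∈ wideStrip) (u : ℝ) :
    ‖termQ p (ζ + shift u)‖ ≤ termBound p ζ * (1 + Real.cosh u) ^ (-p) := by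
  have h := norm_termLambda_le hp (add_ofReal_mem_wideStrip hζ (shift u))
  rw [Complex.add_im, Complex.ofReal_im, add_zero] at h
  have h1 : ‖Complex.exp (-(p * (ζ + shift u)))‖ =
      Real.exp (-p * ζ.re) * (1 + Real.cosh u) ^ (-p) := by
    rw [Complex.norm_exp, ← exp_mul_shift, ← Real.exp_add]
    congr 1
    rw [Complex.neg_re, Complex.re_ofReal_mul, Complex.add_re, Complex.ofReal_re]
    ring
  rw [termQ, norm_mul, h1, termBound]
  refine (mul_le_mul_of_nonneg_left h (mul_nonneg (Real.exp_pos _).le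
    (Real.rpow_nonneg (one_add_cosh_pos u).le _))).trans_eq ?_
  ring

theorem continuous_termQ_shift {p : ℝ} (hp : 0 < p) {ζ : ℂ} (hζ : ζ ∈ wideStrip) :
    Continuous fun u => termQ p (ζ + shift u) := by
  refine continuous_iff_continuousAt.2 fun u => ?_
  refine ContinuousAt.comp (g := termQ p)
    (hasDerivAt_termQ hp (add_ofReal_mem_wideStrip hζ (shift u))).continuousAt ?_
  exact (continuous_const.add (Complex.continuous_ofReal.comp continuous_shift)).continuousAt

theorem holoFamily_termQ {p : ℝ} {ν : ℂ} (hν : |ν.re| < p) :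
    HoloFamily volume wideStrip fun ζ u => Complex.exp (ν * u) * termQ p (ζ + shift u) where
  meas ζ hζ := by
    have := continuous_termQ_shift ((abs_nonneg _).trans_lt hν) hζ
    exact Continuous.aestronglyMeasurable (by fun_prop)
  diff := Eventually.of_forall fun u ζ hζ => by
    have h := hasDerivAt_termQ ((abs_nonneg _).trans_lt hν) (add_ofReal_mem_wideStrip hζ (shift u))
    exact ((h.comp_add_const ζ (shift u : ℂ)).differentiableAt.const_mul _).differentiableWithinAt
  dom ζ₀ hζ₀ := by
    have hp : 0 < p := (abs_nonneg _).trans_lt hν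
    have h0 := cos_third_pos hζ₀
    have hc : ContinuousAt (termBound p) ζ₀ := by
      unfold termBound
      have h1 : ContinuousAt (fun ζ : ℂ => Real.cos (ζ.im / 3)) ζ₀ := by fun_prop
      exact ContinuousAt.mul (by fun_prop) ((h1.rpow_const (Or.inl h0.ne')).div h1 h0.ne')
    obtain ⟨r, hr, hball⟩ := Metric.mem_nhds_iff.1
      ((hc.eventually (gt_mem_nhds (lt_add_one _))).and (isOpen_wideStrip.eventually_mem hζ₀))
    refine ⟨r, hr, fun ζ hζ => (hball hζ).2, _,
      ((integrable_moment hν).1.norm).const_mul (termBound p ζ₀ + 1),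
      Eventually.of_forall fun u ζ hζ => ?_⟩
    have h1 := norm_termQ_shift_le hp (hball hζ).2 u
    have h2 : 0 ≤ (1 + Real.cosh u) ^ (-p) := Real.rpow_nonneg (one_add_cosh_pos u).le _
    rw [norm_mul, norm_mul, Complex.norm_real, Real.norm_of_nonneg h2, mul_left_comm]
    exact mul_le_mul_of_nonneg_left
      (h1.trans (mul_le_mul_of_nonneg_right (le_of_lt (hball hζ).1) h2)) (norm_nonneg _)

theorem holoFamily_termQ₁ {p : ℝ} {ν : ℂ} (hν : |ν.re| < p) :
    HoloFamily volume wideStrip fun ζ u => Complex.exp (ν * u) * termQ₁ p (ζ + shift u) :=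
  (holoFamily_termQ hν).deriv.congr fun ζ hζ u =>
    (((hasDerivAt_termQ ((abs_nonneg _).trans_lt hν)
      (add_ofReal_mem_wideStrip hζ (shift u))).comp_add_const ζ (shift u : ℂ)).const_mul _).deriv

theorem holoFamily_termQ₂ {p : ℝ} {ν : ℂ} (hν : |ν.re| < p) :
    HoloFamily volume wideStrip fun ζ u => Complex.exp (ν * u) * termQ₂ p (ζ + shift u) :=
  (holoFamily_termQ₁ hν).deriv.congr fun ζ hζ u =>
    (((hasDerivAt_termQ₁ ((abs_nonneg _).trans_lt hν)
      (add_ofReal_mem_wideStrip hζ (shift u))).comp_add_const ζ (shift u : ℂ)).const_mul _).deriv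

/-- `∫ e ^ (ν u) (z c) ^ (-p) Λ_p(z c) du` with `c = 1 + cosh u`, at `z = e ^ ζ`. -/
noncomputable def psi (p : ℝ) (ν ζ : ℂ) : ℂ :=
  ∫ u : ℝ, Complex.exp (ν * u) * termQ p (ζ + shift u)

/-- The first derivative of `psi`. -/
noncomputable def psi₁ (p : ℝ) (ν ζ : ℂ) : ℂ :=
  ∫ u : ℝ, Complex.exp (ν * u) * termQ₁ p (ζ + shift u)

/-- The second derivative of `psi`. -/
noncomputable def psi₂ (p : ℝ) (ν ζ : ℂ) : ℂ :=
  ∫ u : ℝ, Complex.exp (ν * u) * termQ₂ p (ζ + shift u)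

theorem hasDerivAt_psi {p : ℝ} {ν : ℂ} (hν : |ν.re| < p) {ζ : ℂ} (hζ : ζ ∈ wideStrip) :
    HasDerivAt (psi p ν) (psi₁ p ν ζ) ζ := by
  refine ((holoFamily_termQ hν).hasDerivAt_integral hζ).congr_deriv ?_
  refine integral_congr_ae (Eventually.of_forall fun u => ?_)
  exact (((hasDerivAt_termQ ((abs_nonneg _).trans_lt hν)
      (add_ofReal_mem_wideStrip hζ (shift u))).comp_add_const ζ (shift u : ℂ)).const_mul _).deriv

theorem hasDerivAt_psi₁ {p : ℝ} {ν : ℂ} (hν : |ν.re| < p) {ζ : ℂ} (hζ : ζ ∈ wideStrip) :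
    HasDerivAt (psi₁ p ν) (psi₂ p ν ζ) ζ := by
  refine ((holoFamily_termQ₁ hν).hasDerivAt_integral hζ).congr_deriv ?_
  refine integral_congr_ae (Eventually.of_forall fun u => ?_)
  exact (((hasDerivAt_termQ₁ ((abs_nonneg _).trans_lt hν)
      (add_ofReal_mem_wideStrip hζ (shift u))).comp_add_const ζ (shift u : ℂ)).const_mul _).deriv

/-- The inhomogeneous form of the differential equation of `e ^ z K_ν(z)` satisfied by `psi`. The
kernel satisfies a partial differential equation in `ζ` and `u`, and the derivatives with respect to
`u` are moved to `e ^ (ν u)` by two integrations by parts. -/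
theorem psi_ode {p : ℝ} {ν : ℂ} (hν : |ν.re| < p) {ζ : ℂ} (hζ : ζ ∈ wideStrip) :
    ν ^ 2 * psi p ν ζ = psi₂ p ν ζ - 2 * Complex.exp ζ * psi₁ p ν ζ - Complex.exp ζ * psi p ν ζ +
      (1 - 2 * p) * Complex.exp ((1 - p) * ζ) * moment p ν := by
  have hp : 0 < p := (abs_nonneg _).trans_lt hν
  set E : ℝ → ℂ := fun u => Complex.exp (ν * u)
  set q : ℝ → ℂ := fun u => termQ p (ζ + shift u)
  set q₁ : ℝ → ℂ := fun u => termQ₁ p (ζ + shift u)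
  set q₂ : ℝ → ℂ := fun u => termQ₂ p (ζ + shift u)
  set m : ℝ → ℂ := fun u => (((1 + Real.cosh u) ^ (-p) : ℝ) : ℂ)
  set σ : ℝ → ℂ := fun u => ((Real.sinh u / (1 + Real.cosh u) : ℝ) : ℂ)
  have i0 : Integrable fun u => E u * q u := (holoFamily_termQ hν).integrable hζ
  have i1 : Integrable fun u => E u * q₁ u := (holoFamily_termQ₁ hν).integrable hζ
  have i2 : Integrable fun u => E u * q₂ u := (holoFamily_termQ₂ hν).integrable hζ
  have im : Integrable fun u => E u * m u := (integrable_moment hν).1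
  have iσ : Integrable fun u => σ u * (E u * q₁ u) := by
    refine i1.bdd_mul (c := 1) (Continuous.aestronglyMeasurable ?_)
      (Eventually.of_forall fun u => ?_)
    · exact Complex.continuous_ofReal.comp (Real.continuous_sinh.div₀ (by fun_prop)
        fun u => (one_add_cosh_pos u).ne')
    · rw [Complex.norm_real, Real.norm_eq_abs, abs_div, abs_of_pos (one_add_cosh_pos u),
        div_le_one (one_add_cosh_pos u), abs_le]
      constructor
      · linarith [Real.exp_pos u, Real.cosh_add_sinh u]
      · linarith [Real.exp_pos (-u), Real.cosh_sub_sinh u]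
  have hσ (u : ℝ) : HasDerivAt σ (1 / ((1 + Real.cosh u : ℝ) : ℂ)) u := by
    have h1 := ((Real.hasDerivAt_sinh u).div ((Real.hasDerivAt_cosh u).const_add 1)
      (one_add_cosh_pos u).ne').ofReal_comp
    refine h1.congr_deriv ?_
    rw [← Complex.ofReal_one, ← Complex.ofReal_div]
    congr 1
    have := (one_add_cosh_pos u).ne'
    field_simp
    linarith [Real.cosh_sq u]
  have hE (u : ℝ) : HasDerivAt E (ν * E u) u := by
    have h1 : HasDerivAt E (Complex.exp (ν * u) * (ν * ((1 : ℝ) : ℂ))) u :=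
      ((hasDerivAt_id u).ofReal_comp.const_mul ν).cexp
    refine h1.congr_deriv ?_
    push_cast
    ring
  have hs (u : ℝ) : HasDerivAt (fun u : ℝ => ζ + (shift u : ℂ)) (σ u) u :=
    (hasDerivAt_shift u).ofReal_comp.const_add ζ
  have hq (u : ℝ) : HasDerivAt q (q₁ u * σ u) u :=
    HasDerivAt.comp (h₂ := termQ p) u
      (hasDerivAt_termQ hp (add_ofReal_mem_wideStrip hζ (shift u))) (hs u)
  have hq₁ (u : ℝ) : HasDerivAt q₁ (q₂ u * σ u) u :=
    HasDerivAt.comp (h₂ := termQ₁ p) u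
      (hasDerivAt_termQ₁ hp (add_ofReal_mem_wideStrip hζ (shift u))) (hs u)
  set z := Complex.exp ζ with hz
  set r := (1 - 2 * (p : ℂ)) * Complex.exp ((1 - p) * ζ) with hr
  -- the partial differential equation of the kernel
  have hpde (u : ℝ) : q₁ u / ((1 + Real.cosh u : ℝ) : ℂ) + q₂ u * σ u ^ 2 =
      q₂ u - 2 * z * q₁ u - z * q u + r * m u := by
    have hc : ((1 + Real.cosh u : ℝ) : ℂ) ≠ 0 := by exact_mod_cast (one_add_cosh_pos u).ne'
    have e1 : Complex.exp (ζ + shift u) = z * ((1 + Real.cosh u : ℝ) : ℂ) := by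
      rw [Complex.exp_add, exp_shift]
    have e2 : Complex.exp ((1 - p) * (ζ + shift u)) =
        Complex.exp ((1 - p) * ζ) * ((1 + Real.cosh u : ℝ) : ℂ) * m u := by
      simp only [m]
      rw [← exp_mul_shift, ← exp_shift, Complex.ofReal_exp, ← Complex.exp_add, ← Complex.exp_add]
      congr 1
      push_cast
      ring
    have e3 : σ u ^ 2 = 1 - 2 / ((1 + Real.cosh u : ℝ) : ℂ) := by
      simp only [σ]
      rw [← Complex.ofReal_pow, ← Complex.ofReal_ofNat, ← Complex.ofReal_div, ← Complex.ofReal_one,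
        ← Complex.ofReal_sub]
      congr 1
      have := (one_add_cosh_pos u).ne'
      rw [div_pow, Real.sinh_sq]
      field_simp
      ring
    have e4 : q₁ u = z * ((1 + Real.cosh u : ℝ) : ℂ) * q u -
        Complex.exp ((1 - p) * ζ) * ((1 + Real.cosh u : ℝ) : ℂ) * m u := by
      simp only [q₁, q, termQ₁]
      rw [e1, e2]
    have e5 : q₂ u = z * ((1 + Real.cosh u : ℝ) : ℂ) * q u +
        z * ((1 + Real.cosh u : ℝ) : ℂ) * q₁ u -
        (1 - p) * (Complex.exp ((1 - p) * ζ) * ((1 + Real.cosh u : ℝ) : ℂ) * m u) := by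
      simp only [q₂, q₁, q, termQ₂]
      rw [e1, e2]
    rw [e3, e5, e4, hr]
    field_simp
    ring
  have hd (u : ℝ) : HasDerivAt (fun u => ν * (E u * q u) - σ u * (E u * q₁ u))
      (ν ^ 2 * (E u * q u) -
        (E u * q₂ u - 2 * z * (E u * q₁ u) - z * (E u * q u) + r * (E u * m u))) u := by
    refine ((((hE u).mul (hq u)).const_mul ν).sub
      ((hσ u).mul ((hE u).mul (hq₁ u)))).congr_deriv ?_
    simp only [Pi.mul_apply]
    linear_combination (-E u) * hpde u
  have j1 := (i2.sub (i1.const_mul (2 * z))).sub (i0.const_mul z)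
  have h := integral_eq_zero_of_hasDerivAt_of_integrable hd
    ((i0.const_mul (ν ^ 2)).sub (j1.add (im.const_mul r))) ((i0.const_mul ν).sub iσ)
  have s1 := integral_sub (i0.const_mul (ν ^ 2)) (j1.add (im.const_mul r))
  have s2 := integral_add j1 (im.const_mul r)
  have s3 := integral_sub (i2.sub (i1.const_mul (2 * z))) (i0.const_mul z)
  have s4 := integral_sub i2 (i1.const_mul (2 * z))
  simp only [Pi.add_apply, Pi.sub_apply] at s1 s2 s3 s4
  rw [s1, s2, s3, s4] at h
  simp only [integral_const_mul] at h
  simp only [psi, psi₁, psi₂, moment]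
  linear_combination h

/-! ### The remainder of the expansion of `K_ν` -/

/-- The truncated expansion of `(2 / π) ^ (1/2) e ^ z K_ν(z)` with its remainder in the form of a
superposition of terminants, at `z = e ^ ζ`. -/
noncomputable def expansionK (N : ℕ) (ν ζ : ℂ) : ℂ :=
  ∑ n ∈ Finset.range N, coeffA n ν * Complex.exp (-((n + 1 / 2) * ζ)) +
    momentConst N * Complex.cos (Real.pi * ν) * psi (N + 1 / 2) ν ζ

/-- The first derivative of `expansionK`. -/
noncomputable def expansionK₁ (N : ℕ) (ν ζ : ℂ) : ℂ :=
  ∑ n ∈ Finset.range N, coeffA n ν * (-(n + 1 / 2) * Complex.exp (-((n + 1 / 2) * ζ))) +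
    momentConst N * Complex.cos (Real.pi * ν) * psi₁ (N + 1 / 2) ν ζ

/-- The second derivative of `expansionK`. -/
noncomputable def expansionK₂ (N : ℕ) (ν ζ : ℂ) : ℂ :=
  ∑ n ∈ Finset.range N, coeffA n ν * ((n + 1 / 2) ^ 2 * Complex.exp (-((n + 1 / 2) * ζ))) +
    momentConst N * Complex.cos (Real.pi * ν) * psi₂ (N + 1 / 2) ν ζ

theorem hasDerivAt_exp_neg_mul (a ζ : ℂ) :
    HasDerivAt (fun ζ : ℂ => Complex.exp (-(a * ζ))) (-a * Complex.exp (-(a * ζ))) ζ := by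
  have h1 : HasDerivAt (fun ζ : ℂ => Complex.exp (-(a * ζ))) (Complex.exp (-(a * ζ)) * -(a * 1)) ζ :=
    ((hasDerivAt_id ζ).const_mul a).neg.cexp
  exact h1.congr_deriv (by ring)

theorem hasDerivAt_expansionK {N : ℕ} {ν : ℂ} (hν : |ν.re| < N + 1 / 2) {ζ : ℂ}
    (hζ : ζ ∈ wideStrip) : HasDerivAt (expansionK N ν) (expansionK₁ N ν ζ) ζ :=
  (HasDerivAt.fun_sum fun _ _ => (hasDerivAt_exp_neg_mul _ ζ).const_mul _).add
    ((hasDerivAt_psi hν hζ).const_mul _)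

theorem hasDerivAt_expansionK₁ {N : ℕ} {ν : ℂ} (hν : |ν.re| < N + 1 / 2) {ζ : ℂ}
    (hζ : ζ ∈ wideStrip) : HasDerivAt (expansionK₁ N ν) (expansionK₂ N ν ζ) ζ := by
  refine ((HasDerivAt.fun_sum fun n _ =>
    ((hasDerivAt_exp_neg_mul _ ζ).const_mul _).const_mul _).add
      ((hasDerivAt_psi₁ hν hζ).const_mul _)).congr_deriv ?_
  rw [expansionK₂]
  congr 1
  refine Finset.sum_congr rfl fun n _ => by ring

/-- The inhomogeneities of the truncated sum and of the superposition of terminants cancel. -/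
theorem expansionK_ode {N : ℕ} {ν : ℂ} (hν : |ν.re| < N + 1 / 2) {ζ : ℂ} (hζ : ζ ∈ wideStrip) :
    expansionK₂ N ν ζ - 2 * Complex.exp ζ * expansionK₁ N ν ζ - Complex.exp ζ * expansionK N ν ζ =
      ν ^ 2 * expansionK N ν ζ := by
  have hsum (M : ℕ) : ∑ n ∈ Finset.range M, coeffA n ν * (((n + 1 / 2) ^ 2 - ν ^ 2 +
      2 * n * Complex.exp ζ) * Complex.exp (-((n + 1 / 2) * ζ))) =
      -(2 * M * coeffA M ν * (Complex.exp ζ * Complex.exp (-((M + 1 / 2) * ζ)))) := by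
    induction M with
    | zero => simp
    | succ M ih =>
      have h1 : Complex.exp ζ * Complex.exp (-((((M + 1 : ℕ) : ℂ) + 1 / 2) * ζ)) =
          Complex.exp (-((M + 1 / 2) * ζ)) := by
        rw [← Complex.exp_add]
        congr 1
        push_cast
        ring
      rw [Finset.sum_range_succ, ih, h1]
      push_cast
      linear_combination Complex.exp (-((M + 1 / 2) * ζ)) * coeffA_succ M ν
  have hode := psi_ode hν hζ
  have hA := coeffA_eq_moment hν
  have hN := hsum N
  have hexp : Complex.exp ((1 - ((N + 1 / 2 : ℝ) : ℂ)) * ζ) =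
      Complex.exp ζ * Complex.exp (-((N + 1 / 2) * ζ)) := by
    rw [← Complex.exp_add]
    congr 1
    push_cast
    ring
  rw [hexp] at hode
  set S := ∑ n ∈ Finset.range N, coeffA n ν * Complex.exp (-((n + 1 / 2) * ζ)) with hS
  set S₁ := ∑ n ∈ Finset.range N, coeffA n ν * (-(n + 1 / 2) * Complex.exp (-((n + 1 / 2) * ζ)))
    with hS₁
  set S₂ := ∑ n ∈ Finset.range N, coeffA n ν * ((n + 1 / 2) ^ 2 * Complex.exp (-((n + 1 / 2) * ζ)))
    with hS₂
  have hS4 : S₂ - 2 * Complex.exp ζ * S₁ - Complex.exp ζ * S - ν ^ 2 * S =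
      -(2 * N * coeffA N ν * (Complex.exp ζ * Complex.exp (-((N + 1 / 2) * ζ)))) := by
    rw [← hN, hS, hS₁, hS₂, Finset.mul_sum, Finset.mul_sum, Finset.mul_sum, ← Finset.sum_sub_distrib,
      ← Finset.sum_sub_distrib, ← Finset.sum_sub_distrib]
    refine Finset.sum_congr rfl fun n _ => by ring
  rw [expansionK, expansionK₁, expansionK₂, ← hS, ← hS₁, ← hS₂]
  rw [hA] at hS4
  push_cast at hode
  linear_combination hS4 - (momentConst N * Complex.cos (Real.pi * ν)) * hode

theorem norm_psi_le {p : ℝ} {ν : ℂ} (hν : |ν.re| < p) {ζ : ℂ} (hζ : |ζ.im| ≤ 1) :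
    ‖psi p ν ζ‖ ≤ Real.exp (-p * ζ.re) * (Real.cos (1 / 3) ^ (-p) / Real.cos (1 / 3) *
      ∫ u : ℝ, ‖Complex.exp (ν * u) * (((1 + Real.cosh u) ^ (-p) : ℝ) : ℂ)‖) := by
  have hp : 0 < p := (abs_nonneg _).trans_lt hν
  have hπ := Real.pi_gt_three
  have hmem : ζ ∈ wideStrip := by
    rw [wideStrip, Set.mem_ofPred_eq]
    linarith
  have h13 : 0 < Real.cos (1 / 3) := Real.cos_pos_of_mem_Ioo ⟨by linarith, by linarith⟩
  have hcos : Real.cos (1 / 3) ≤ Real.cos (ζ.im / 3) := by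
    rw [← Real.cos_abs (ζ.im / 3), abs_div, abs_of_pos (three_pos : (0 : ℝ) < 3)]
    exact Real.cos_le_cos_of_nonneg_of_le_pi (by positivity) (by linarith) (by linarith)
  have hb : termBound p ζ ≤
      Real.exp (-p * ζ.re) * (Real.cos (1 / 3) ^ (-p) / Real.cos (1 / 3)) := by
    refine mul_le_mul_of_nonneg_left ?_ (Real.exp_pos _).le
    exact div_le_div₀ (Real.rpow_nonneg h13.le _)
      (Real.rpow_le_rpow_of_nonpos h13 hcos (by linarith)) h13 hcos
  rw [← mul_assoc, ← integral_const_mul]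
  refine norm_integral_le_of_norm_le ((integrable_moment hν).1.norm.const_mul _)
    (Eventually.of_forall fun u => ?_)
  have h2 : 0 ≤ (1 + Real.cosh u) ^ (-p) := Real.rpow_nonneg (one_add_cosh_pos u).le _
  rw [norm_mul, norm_mul, Complex.norm_real, Real.norm_of_nonneg h2, mul_left_comm]
  exact mul_le_mul_of_nonneg_left
    ((norm_termQ_shift_le hp hmem u).trans (mul_le_mul_of_nonneg_right hb h2)) (norm_nonneg _)

theorem tendsto_exp_mul_psi {N : ℕ} (hN : 1 ≤ N) {ν : ℂ} (hν : |ν.re| < N + 1 / 2) :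
    Tendsto (fun x : ℝ => Complex.exp (x / 2) * psi (N + 1 / 2) ν x) atTop (𝓝 0) ∧
    Tendsto (fun x : ℝ => Complex.exp (x / 2) * psi₁ (N + 1 / 2) ν x) atTop (𝓝 0) := by
  set p : ℝ := N + 1 / 2 with hp
  have hN' : (1 : ℝ) ≤ N := by exact_mod_cast hN
  set K : ℝ := Real.cos (1 / 3) ^ (-p) / Real.cos (1 / 3) *
      ∫ u : ℝ, ‖Complex.exp (ν * u) * (((1 + Real.cosh u) ^ (-p) : ℝ) : ℂ)‖ with hK
  have hle (ζ : ℂ) (hζ : |ζ.im| ≤ 1) : ‖psi p ν ζ‖ ≤ Real.exp (-p * ζ.re) * K := norm_psi_le hν hζ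
  have hK0 : 0 ≤ K := by
    have := (norm_nonneg _).trans (hle 0 (by simp))
    simpa using this
  have hexp (x : ℝ) : ‖Complex.exp (x / 2)‖ = Real.exp (x / 2) := by
    rw [Complex.norm_exp]
    congr 1
    simp
  have hlim (a C : ℝ) : Tendsto (fun x : ℝ => Real.exp (x / 2) * (Real.exp (-p * x + a) * C)) atTop
      (𝓝 0) := by
    have h1 : Tendsto (fun x : ℝ => Real.exp (-(N : ℝ) * x) * (Real.exp a * C)) atTop (𝓝 0) := by
      have := (Real.tendsto_exp_atBot.comp (tendsto_id.const_mul_atTop_of_neg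
        (show -(N : ℝ) < 0 by linarith))).mul_const (Real.exp a * C)
      simpa using this
    refine h1.congr fun x => ?_
    rw [← mul_assoc, ← mul_assoc, ← Real.exp_add, ← Real.exp_add]
    congr 2
    rw [hp]
    ring
  constructor
  · refine squeeze_zero_norm (fun x => ?_) (hlim 0 K)
    rw [norm_mul, hexp, add_zero]
    refine mul_le_mul_of_nonneg_left ?_ (Real.exp_pos _).le
    simpa using hle x (by simp)
  · refine squeeze_zero_norm (fun x => ?_) (hlim p K)
    rw [norm_mul, hexp]
    refine mul_le_mul_of_nonneg_left ?_ (Real.exp_pos _).le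
    -- Cauchy's estimate on the circle of radius 1 around `x`
    have him (z : ℂ) (hz : z ∈ Metric.closedBall (x : ℂ) 1) : |z.im| ≤ 1 := by
      have hz' : ‖z - x‖ ≤ 1 := by rw [← dist_eq_norm]; exact hz
      have := (Complex.abs_im_le_norm (z - x)).trans hz'
      simpa using this
    have hdiff : DifferentiableOn ℂ (psi p ν) (Metric.closedBall (x : ℂ) 1) := fun z hz => by
      refine (hasDerivAt_psi hν ?_).differentiableAt.differentiableWithinAt
      rw [wideStrip, Set.mem_ofPred_eq]
      linarith [him z hz, Real.pi_gt_three]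
    have h := Complex.norm_deriv_le_of_forall_mem_sphere_norm_le one_pos
      (hdiff.diffContOnCl_ball subset_rfl) (C := Real.exp (-p * x + p) * K) fun z hz => ?_
    · rwa [(hasDerivAt_psi hν (ofReal_mem_wideStrip x)).deriv, div_one] at h
    · refine (hle z (him z (Metric.sphere_subset_closedBall hz))).trans
        (mul_le_mul_of_nonneg_right (Real.exp_le_exp.2 ?_) hK0)
      have hz' : ‖z - x‖ ≤ 1 := by rw [← dist_eq_norm]; exact Metric.sphere_subset_closedBall hz
      have h1 := (Complex.abs_re_le_norm (z - x)).trans hz'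
      rw [Complex.sub_re, Complex.ofReal_re, abs_le] at h1
      have : 0 < p := (abs_nonneg _).trans_lt hν
      nlinarith

theorem tendsto_exp_mul_exp_neg (n : ℕ) :
    Tendsto (fun x : ℝ => Complex.exp (x / 2) * Complex.exp (-((n + 1 / 2) * x))) atTop
      (𝓝 (if n = 0 then 1 else 0)) := by
  have h0 (x : ℝ) : Complex.exp (x / 2) * Complex.exp (-((n + 1 / 2) * x)) =
      ((Real.exp (-n * x) : ℝ) : ℂ) := by
    rw [← Complex.exp_add, Complex.ofReal_exp]
    congr 1
    push_cast
    ring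
  simp only [h0]
  split_ifs with hn
  · simp [hn]
  · have hn' : -(n : ℝ) < 0 := by
      have : 0 < n := Nat.pos_of_ne_zero hn
      simpa using this
    have := (Complex.continuous_ofReal.tendsto 0).comp (Real.tendsto_exp_atBot.comp
      (tendsto_id.const_mul_atTop_of_neg hn'))
    simpa [Function.comp_def] using this

theorem tendsto_expansionK {N : ℕ} (hN : 1 ≤ N) {ν : ℂ} (hν : |ν.re| < N + 1 / 2) :
    Tendsto (fun x : ℝ => Complex.exp (x / 2) * expansionK N ν x) atTop (𝓝 1) ∧
    Tendsto (fun x : ℝ => Complex.exp (x / 2) * expansionK₁ N ν x) atTop (𝓝 (-(1 / 2))) := by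
  obtain ⟨l0, l1⟩ := tendsto_exp_mul_psi hN hν
  have h0 : 0 ∈ Finset.range N := Finset.mem_range.2 hN
  constructor
  · have h1 := tendsto_finsetSum (Finset.range N) fun n _ =>
      (tendsto_exp_mul_exp_neg n).const_mul (coeffA n ν)
    have h2 := h1.add (l0.const_mul (momentConst N * Complex.cos (Real.pi * ν)))
    simp only [mul_ite, mul_one, mul_zero, Finset.sum_ite_eq', h0, if_true, add_zero] at h2
    rw [show coeffA 0 ν = 1 by simp [coeffA]] at h2
    refine h2.congr fun x => ?_
    rw [expansionK, mul_add, Finset.mul_sum]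
    refine congrArg₂ _ (Finset.sum_congr rfl fun n _ => by ring) (by ring)
  · have h1 := tendsto_finsetSum (Finset.range N) fun n _ =>
      (tendsto_exp_mul_exp_neg n).const_mul (coeffA n ν * -(n + 1 / 2))
    have h2 := h1.add (l1.const_mul (momentConst N * Complex.cos (Real.pi * ν)))
    simp only [mul_ite, mul_one, mul_zero, Finset.sum_ite_eq', h0, if_true, add_zero] at h2
    rw [show coeffA 0 ν * -(((0 : ℕ) : ℂ) + 1 / 2) = -(1 / 2) by simp [coeffA]] at h2
    refine h2.congr fun x => ?_
    rw [expansionK₁, mul_add, Finset.mul_sum]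
    refine congrArg₂ _ (Finset.sum_congr rfl fun n _ => by ring) (by ring)

/-- Both sides are solutions of the same equation that are recessive at `+∞`, hence their Wronskian
vanishes; the constant of proportionality comes from the leading asymptotics. -/
theorem eventually_besselKInt_eq {N : ℕ} (hN : 1 ≤ N) {ν : ℂ} (hν : |ν.re| < N + 1 / 2) :
    ∀ᶠ x : ℝ in atTop, besselKInt ν x =
      Real.sqrt (Real.pi / 2) * (Complex.exp (-Complex.exp x) * expansionK N ν x) := by
  set f : ℝ → ℂ := fun x => Complex.exp (-Complex.exp x) * expansionK N ν x with hf
  set f₁ : ℝ → ℂ := fun x =>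
    Complex.exp (-Complex.exp x) * (expansionK₁ N ν x - Complex.exp x * expansionK N ν x) with hf₁
  set h : ℝ → ℂ := fun x => besselKInt ν x with hh
  set h₁ : ℝ → ℂ := fun x => ν * besselKInt ν x - Complex.exp x * besselKInt (ν + 1) x with hh₁
  have de (x : ℝ) : HasDerivAt (fun ζ : ℂ => Complex.exp (-Complex.exp ζ))
      (Complex.exp (-Complex.exp x) * -Complex.exp x) x := (Complex.hasDerivAt_exp _).neg.cexp
  have df (x : ℝ) : HasDerivAt f (f₁ x) x := by
    refine (((de x).mul (hasDerivAt_expansionK hν (ofReal_mem_wideStrip x))).comp_ofReal).congr_deriv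
      ?_
    simp only [hf₁]
    ring
  have df₁ (x : ℝ) : HasDerivAt f₁ ((Complex.exp x ^ 2 + ν ^ 2) * f x) x := by
    have hx := ofReal_mem_wideStrip x
    have h1 := hasDerivAt_expansionK hν hx
    refine (((de x).mul ((hasDerivAt_expansionK₁ hν hx).sub
      ((Complex.hasDerivAt_exp _).mul h1))).comp_ofReal).congr_deriv ?_
    simp only [hf, Pi.sub_apply, Pi.mul_apply]
    linear_combination Complex.exp (-Complex.exp x) * expansionK_ode hν hx
  have dh (x : ℝ) : HasDerivAt h (h₁ x) x := by
    have hx := ofReal_mem_rightHalf x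
    refine (hasDerivAt_besselKInt ν hx).comp_ofReal.congr_deriv ?_
    simp only [hh₁]
    linear_combination (1 / 2) * besselKInt_rec ν hx
  have dh₁ (x : ℝ) : HasDerivAt h₁ ((Complex.exp x ^ 2 + ν ^ 2) * h x) x := by
    have hx := ofReal_mem_rightHalf x
    have e1 := besselKInt_rec ν hx
    have e2 := besselKInt_rec (ν + 1) hx
    refine (((hasDerivAt_besselKInt ν hx).const_mul ν).sub ((Complex.hasDerivAt_exp _).mul
      (hasDerivAt_besselKInt (ν + 1) hx))).comp_ofReal.congr_deriv ?_
    rw [add_sub_cancel_right] at *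
    simp only [hh]
    linear_combination ν / 2 * e1 + Complex.exp x / 2 * e2
  set W : ℝ → ℂ := fun x => h x * f₁ x - h₁ x * f x with hW
  have dW (x : ℝ) : HasDerivAt W 0 x := by
    refine (((dh x).mul (df₁ x)).sub ((dh₁ x).mul (df x))).congr_deriv ?_
    ring
  have hWc (x y : ℝ) : W x = W y :=
    is_const_of_deriv_eq_zero (fun x => (dW x).differentiableAt) (fun x => (dW x).deriv) x y
  obtain ⟨lk, lk₁⟩ := tendsto_expansionK hN hν
  have lh := tendsto_besselKInt_atTop ν
  have lh' := tendsto_besselKInt_atTop (ν + 1)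
  have hW0 (x : ℝ) : W x = 0 := by
    have hr (c : ℝ) (hc : 0 < c) : Tendsto (fun x : ℝ => Complex.exp (-2 * Complex.exp x - c * x))
        atTop (𝓝 0) := by
      have h1 : Tendsto (fun x : ℝ => -2 * Real.exp x + -(c * x)) atTop atBot :=
        (Real.tendsto_exp_atTop.const_mul_atTop_of_neg (by norm_num)).atBot_add_atBot
          (tendsto_neg_atTop_atBot.comp (tendsto_id.const_mul_atTop hc))
      have h2 := (Complex.continuous_ofReal.tendsto 0).comp (Real.tendsto_exp_atBot.comp h1)
      rw [Complex.ofReal_zero] at h2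
      refine h2.congr fun x => ?_
      simp only [Function.comp]
      push_cast
      ring_nf
    have hr0 : Tendsto (fun x : ℝ => Complex.exp (-2 * Complex.exp x)) atTop (𝓝 0) := by
      have h1 : Tendsto (fun x : ℝ => -2 * Real.exp x) atTop atBot :=
        Real.tendsto_exp_atTop.const_mul_atTop_of_neg (by norm_num)
      have h2 := (Complex.continuous_ofReal.tendsto 0).comp (Real.tendsto_exp_atBot.comp h1)
      rw [Complex.ofReal_zero] at h2
      refine h2.congr fun x => ?_
      simp only [Function.comp]
      push_cast
      ring_nf
    have hr1 := hr 1 one_pos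
    have t1 := (lh.mul lk₁).mul hr1
    have t2 := (lh.mul lk).mul hr0
    have t3 := ((lh.mul lk).mul hr1).const_mul ν
    have t4 := (lh'.mul lk).mul hr0
    have t := ((t1.sub t2).sub t3).add t4
    simp only [mul_zero, sub_zero, add_zero] at t
    have hWlim : Tendsto W atTop (𝓝 0) := by
      refine t.congr fun x => ?_
      simp only [hW, hf, hf₁, hh, hh₁]
      have e1 : Complex.exp (-2 * Complex.exp x) = Complex.exp (-Complex.exp x) ^ 2 := by
        rw [← Complex.exp_nat_mul]; push_cast; ring_nf
      have e2 : Complex.exp (Complex.exp x + x / 2) =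
          (Complex.exp (-Complex.exp x))⁻¹ * Complex.exp (x / 2) := by
        rw [← Complex.exp_neg, neg_neg, Complex.exp_add]
      have e3 : Complex.exp (-2 * Complex.exp x - ((1 : ℝ) : ℂ) * x) =
          Complex.exp (-Complex.exp x) ^ 2 / Complex.exp (x / 2) ^ 2 := by
        rw [Complex.exp_sub, e1, ← Complex.exp_nat_mul (x / 2 : ℂ)]; push_cast; ring_nf
      have e4 : Complex.exp x = Complex.exp (x / 2) ^ 2 := by
        rw [← Complex.exp_nat_mul]; push_cast; ring_nf
      have n1 := Complex.exp_ne_zero (-Complex.exp x)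
      have n2 := Complex.exp_ne_zero ((x : ℂ) / 2)
      rw [e3, e2, e1]
      generalize Complex.exp (-Complex.exp x) = d at *
      rw [e4]
      field_simp
      ring
    exact tendsto_nhds_unique (tendsto_const_nhds.congr fun y => hWc x y) hWlim
  have hs0 : (Real.sqrt (Real.pi / 2) : ℂ) ≠ 0 := by
    exact_mod_cast (Real.sqrt_pos.2 (by positivity)).ne'
  obtain ⟨x₀, hx₀⟩ := eventually_atTop.1 (lh.eventually_ne hs0)
  have hne (x : ℝ) (hx : x₀ ≤ x) : h x ≠ 0 := right_ne_zero_of_mul (hx₀ x hx)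
  have hd (x : ℝ) (hx : x₀ ≤ x) : HasDerivAt (fun x => f x / h x) 0 x := by
    refine ((df x).div (dh x) (hne x hx)).congr_deriv ?_
    rw [show f₁ x * h x - f x * h₁ x = W x by simp only [hW]; ring, hW0, zero_div]
  have hconst (x y : ℝ) (hx : x ∈ Set.Ioi x₀) (hy : y ∈ Set.Ioi x₀) : f x / h x = f y / h y :=
    isOpen_Ioi.is_const_of_deriv_eq_zero isPreconnected_Ioi
      (fun z hz => (hd z (le_of_lt hz)).differentiableAt.differentiableWithinAt)
      (fun z hz => (hd z (le_of_lt hz)).deriv) hx hy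
  have hlim : Tendsto (fun x => f x / h x) atTop (𝓝 (1 / (Real.sqrt (Real.pi / 2) : ℂ))) := by
    refine (lk.div lh hs0).congr fun x => ?_
    simp only [hf, hh, Pi.div_apply]
    rw [Complex.exp_add, Complex.exp_neg]
    have n1 := Complex.exp_ne_zero (Complex.exp x)
    have n2 := Complex.exp_ne_zero ((x : ℂ) / 2)
    rw [mul_comm (Complex.exp (Complex.exp x)), mul_assoc, mul_div_mul_left _ _ n2, inv_mul_eq_div,
      div_div]
  filter_upwards [eventually_gt_atTop x₀] with x hx
  have h1 : f x / h x = 1 / (Real.sqrt (Real.pi / 2) : ℂ) :=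
    tendsto_nhds_unique (tendsto_const_nhds.congr' ((eventually_gt_atTop x₀).mono fun y hy =>
      hconst x y hx hy)) hlim
  rw [div_eq_div_iff (hne x hx.le) hs0] at h1
  linear_combination -h1

/-! ### Continuation to the wide sector and to integer orders -/

theorem eqOn_wideStrip_of_eventually_eq {f g : ℂ → ℂ} (hf : DifferentiableOn ℂ f wideStrip)
    (hg : DifferentiableOn ℂ g wideStrip) (h : ∀ᶠ x : ℝ in atTop, f x = g x) :
    Set.EqOn f g wideStrip := by
  obtain ⟨x₀, hx₀⟩ := eventually_atTop.1 h
  have hconv : Convex ℝ wideStrip := by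
    have : wideStrip = Complex.imCLM ⁻¹' Metric.ball 0 (3 * Real.pi / 2) := by
      ext ζ
      simp [wideStrip]
    rw [this]
    exact (convex_ball _ _).linear_preimage Complex.imCLM.toLinearMap
  refine (hf.analyticOnNhd isOpen_wideStrip).eqOn_of_preconnected_of_frequently_eq
    (hg.analyticOnNhd isOpen_wideStrip) hconv.isPreconnected
    (ofReal_mem_wideStrip (x₀ + 1)) ?_
  have ht : Tendsto (fun x : ℝ => (x : ℂ)) (𝓝[≠] (x₀ + 1)) (𝓝[≠] ((x₀ + 1 : ℝ) : ℂ)) := by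
    refine tendsto_nhdsWithin_iff.2 ⟨?_, ?_⟩
    · exact (Complex.continuous_ofReal.tendsto _).mono_left nhdsWithin_le_nhds
    · filter_upwards [self_mem_nhdsWithin] with x hx
      exact fun h => hx (Complex.ofReal_injective h)
  refine ht.frequently (Eventually.frequently ?_)
  filter_upwards [nhdsWithin_le_nhds (lt_mem_nhds (lt_add_one x₀))] with x hx
  exact hx₀ x (le_of_lt hx)

theorem eventually_sin_ne_zero (ν : ℂ) : ∀ᶠ μ in 𝓝[≠] ν, Complex.sin (Real.pi * μ) ≠ 0 := by
  by_cases h : Complex.sin (Real.pi * ν) = 0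
  · have hd : HasDerivAt (fun μ : ℂ => Complex.sin (Real.pi * μ))
        (Complex.cos (Real.pi * ν) * (Real.pi * 1)) ν :=
      ((hasDerivAt_id ν).const_mul (Real.pi : ℂ)).csin
    refine hd.eventually_ne (mul_ne_zero (fun hc => ?_) ?_)
    · have := Complex.sin_sq_add_cos_sq (Real.pi * ν)
      simp [h, hc] at this
    · simp
  · have hc : Continuous fun μ : ℂ => Complex.sin (Real.pi * μ) := by fun_prop
    exact nhdsWithin_le_nhds (hc.continuousAt.eventually_ne h)

theorem continuousAt_expansionK_order {N : ℕ} {ν : ℂ} (hν : |ν.re| < N + 1 / 2) {ζ : ℂ}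
    (hζ : ζ ∈ wideStrip) : ContinuousAt (fun μ => expansionK N μ ζ) ν := by
  have hp : (0 : ℝ) < N + 1 / 2 := by positivity
  have h := (holoFamily_exp_mul (continuous_termQ_shift hp hζ).aestronglyMeasurable
    (norm_termQ_shift_le hp hζ)).hasDerivAt_integral (show ν ∈ {ν : ℂ | |ν.re| < N + 1 / 2} from hν)
  have hA (n : ℕ) : Continuous fun μ => coeffA n μ := by
    unfold coeffA
    fun_prop
  refine ContinuousAt.add (Continuous.continuousAt ?_) (ContinuousAt.mul ?_ h.continuousAt)
  · fun_prop
  · exact Continuous.continuousAt (by fun_prop)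

theorem isOpen_abs_re_lt (a : ℝ) : IsOpen {ν : ℂ | |ν.re| < a} :=
  isOpen_lt (by fun_prop) continuous_const

/-- For integer orders the limit that defines `K_ν` is computed from the formula itself, which is
continuous in the order. -/
theorem besselK_eq_expansionK {N : ℕ} (hN : 1 ≤ N) {ν : ℂ} (hν : |ν.re| < N + 1 / 2) {ζ : ℂ}
    (hζ : ζ ∈ wideStrip) :
    besselK ν ζ =
      Real.sqrt (Real.pi / 2) * (Complex.exp (-Complex.exp ζ) * expansionK N ν ζ) := by
  have key {μ : ℂ} (hμ : |μ.re| < N + 1 / 2) (hs : Complex.sin (Real.pi * μ) ≠ 0) :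
      besselK μ ζ =
        Real.sqrt (Real.pi / 2) * (Complex.exp (-Complex.exp ζ) * expansionK N μ ζ) := by
    refine eqOn_wideStrip_of_eventually_eq (f := besselK μ) (g := fun ζ =>
      Real.sqrt (Real.pi / 2) * (Complex.exp (-Complex.exp ζ) * expansionK N μ ζ)) ?_ ?_ ?_ hζ
    · have hI (μ : ℂ) : Differentiable ℂ (besselI μ) := fun x =>
        (hasDerivAt_besselI μ x).differentiableAt
      have : besselK μ = fun ζ => (Real.pi : ℂ) / 2 * (besselI (-μ) ζ - besselI μ ζ) /
          Complex.sin (Real.pi * μ) := funext fun ζ => by rw [besselK, if_neg hs]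
      rw [this]
      exact ((((hI (-μ)).sub (hI μ)).const_mul _).div_const _).differentiableOn
    · intro ξ hξ
      have h1 := (hasDerivAt_expansionK hμ hξ).differentiableAt
      have h2 : DifferentiableAt ℂ (fun ζ => Complex.exp (-Complex.exp ζ)) ξ := by fun_prop
      exact ((h2.mul h1).const_mul _).differentiableWithinAt
    · filter_upwards [eventually_besselKInt_eq hN hμ] with x hx
      rw [besselK_eq_besselKInt hs, hx]
  by_cases hs : Complex.sin (Real.pi * ν) = 0
  · rw [besselK, if_pos hs]
    refine Tendsto.limUnder_eq ?_
    have hc : Tendsto (fun μ => Real.sqrt (Real.pi / 2) *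
        (Complex.exp (-Complex.exp ζ) * expansionK N μ ζ)) (𝓝[≠] ν)
        (𝓝 (Real.sqrt (Real.pi / 2) * (Complex.exp (-Complex.exp ζ) * expansionK N ν ζ))) :=
      (((continuousAt_expansionK_order hν hζ).tendsto.const_mul _).const_mul _).mono_left
        nhdsWithin_le_nhds
    refine hc.congr' ?_
    filter_upwards [eventually_sin_ne_zero ν,
      nhdsWithin_le_nhds ((isOpen_abs_re_lt _).mem_nhds hν)] with μ h1 h2
    rw [← key h2 h1, besselK, if_neg h1]
  · exact key hν hs

theorem exists_order_bound (ν : ℂ) : ∃ N : ℕ, 1 ≤ N ∧ |ν.re| < N + 1 / 2 := by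
  obtain ⟨n, hn⟩ := exists_nat_gt |ν.re|
  exact ⟨n + 1, by omega, by push_cast; linarith⟩

theorem differentiableOn_besselK (ν : ℂ) : DifferentiableOn ℂ (besselK ν) wideStrip := by
  obtain ⟨N, hN, hν⟩ := exists_order_bound ν
  refine DifferentiableOn.congr (fun ξ hξ => ?_) fun ζ hζ => besselK_eq_expansionK hN hν hζ
  have h1 := (hasDerivAt_expansionK hν hξ).differentiableAt
  have h2 : DifferentiableAt ℂ (fun ζ => Complex.exp (-Complex.exp ζ)) ξ := by fun_prop
  exact ((h2.mul h1).const_mul _).differentiableWithinAt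

theorem continuousAt_besselK_order (ν : ℂ) {ζ : ℂ} (hζ : ζ ∈ wideStrip) :
    ContinuousAt (fun μ => besselK μ ζ) ν := by
  obtain ⟨N, hN, hν⟩ := exists_order_bound ν
  refine ContinuousAt.congr (((continuousAt_expansionK_order hν hζ).const_mul
    (Complex.exp (-Complex.exp ζ))).const_mul (Real.sqrt (Real.pi / 2) : ℂ)) ?_
  filter_upwards [(isOpen_abs_re_lt _).mem_nhds hν] with μ hμ
  exact (besselK_eq_expansionK hN hμ hζ).symm

theorem eventually_besselK_eq_besselKInt (ν : ℂ) :
    ∀ᶠ x : ℝ in atTop, besselK ν x = besselKInt ν x := by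
  obtain ⟨N, hN, hν⟩ := exists_order_bound ν
  filter_upwards [eventually_besselKInt_eq hN hν] with x hx
  rw [hx, besselK_eq_expansionK hN hν (ofReal_mem_wideStrip x)]

theorem hasDerivAt_besselK (ν : ℂ) {ζ : ℂ} (hζ : ζ ∈ wideStrip) :
    HasDerivAt (besselK ν) (-(Complex.exp ζ / 2) * (besselK (ν + 1) ζ + besselK (ν - 1) ζ)) ζ := by
  have hd (ν : ℂ) {ζ : ℂ} (hζ : ζ ∈ wideStrip) : DifferentiableAt ℂ (besselK ν) ζ :=
    (differentiableOn_besselK ν).differentiableAt (isOpen_wideStrip.mem_nhds hζ)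
  refine (hd ν hζ).hasDerivAt.congr_deriv ?_
  refine eqOn_wideStrip_of_eventually_eq (f := deriv (besselK ν))
    (g := fun ζ => -(Complex.exp ζ / 2) * (besselK (ν + 1) ζ + besselK (ν - 1) ζ))
    ((differentiableOn_besselK ν).deriv isOpen_wideStrip) ?_ ?_ hζ
  · exact DifferentiableOn.mul (Differentiable.differentiableOn (by fun_prop))
      ((differentiableOn_besselK _).add (differentiableOn_besselK _))
  · obtain ⟨x₀, hx₀⟩ := eventually_atTop.1 (eventually_besselK_eq_besselKInt ν)
    filter_upwards [eventually_gt_atTop x₀, eventually_besselK_eq_besselKInt (ν + 1),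
      eventually_besselK_eq_besselKInt (ν - 1)] with x hx h1 h2
    rw [h1, h2]
    have e1 := (hd ν (ofReal_mem_wideStrip x)).hasDerivAt.comp_ofReal
    have e2 := (hasDerivAt_besselKInt ν (ofReal_mem_rightHalf x)).comp_ofReal
    refine e1.unique (e2.congr_of_eventuallyEq ?_)
    filter_upwards [lt_mem_nhds hx] with y hy
    exact hx₀ y hy.le

theorem derivZ_besselK (ν : ℂ) {ζ : ℂ} (hζ : ζ ∈ wideStrip) :
    derivZ (besselK ν) ζ = -(1 / 2) * (besselK (ν + 1) ζ + besselK (ν - 1) ζ) := by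
  rw [derivZ, (hasDerivAt_besselK ν hζ).deriv, div_eq_iff (Complex.exp_ne_zero ζ)]
  ring

/-! ### The remainder of the expansion of `K_ν'` -/

/-- The positive weight `cosh u (1 + cosh u) ^ (-N - 1/2)`. -/
noncomputable def weight (N : ℕ) (u : ℝ) : ℝ :=
  Real.cosh u * (1 + Real.cosh u) ^ (-((N : ℝ) + 1 / 2))

theorem weight_pos (N : ℕ) (u : ℝ) : 0 < weight N u :=
  mul_pos (Real.cosh_pos u) (Real.rpow_pos_of_pos (one_add_cosh_pos u) _)

theorem continuous_weight (N : ℕ) : Continuous (weight N) :=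
  Real.continuous_cosh.mul (Continuous.rpow_const (by fun_prop)
    fun u => Or.inl (one_add_cosh_pos u).ne')

theorem weight_le (N : ℕ) (u : ℝ) :
    weight N u ≤ (1 + Real.cosh u) ^ (-((N : ℝ) - 1 / 2)) := by
  have h : (1 + Real.cosh u) ^ (-((N : ℝ) - 1 / 2)) =
      (1 + Real.cosh u) * (1 + Real.cosh u) ^ (-((N : ℝ) + 1 / 2)) := by
    rw [show -((N : ℝ) - 1 / 2) = 1 + -((N : ℝ) + 1 / 2) by ring,
      Real.rpow_add (one_add_cosh_pos u), Real.rpow_one]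
  rw [h, weight]
  exact mul_le_mul_of_nonneg_right (by linarith)
    (Real.rpow_nonneg (one_add_cosh_pos u).le _)

theorem holoFamily_weight {N : ℕ} {f : ℝ → ℂ} (hf : AEStronglyMeasurable f volume) {C : ℝ}
    (hC : ∀ u, ‖f u‖ ≤ C) :
    HoloFamily volume {ν | |ν.re| < (N : ℝ) - 1 / 2}
      fun ν u => Complex.exp (ν * u) * ((weight N u : ℂ) * f u) := by
  refine holoFamily_exp_mul (C := C) (AEStronglyMeasurable.mul
    (Complex.continuous_ofReal.comp (continuous_weight N)).aestronglyMeasurable hf) fun u => ?_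
  rw [norm_mul, Complex.norm_real, Real.norm_of_nonneg (weight_pos N u).le, mul_comm]
  exact mul_le_mul (hC u) (weight_le N u) (weight_pos N u).le ((norm_nonneg _).trans (hC u))

theorem norm_integral_weight_le {N : ℕ} {ν : ℂ} (hν : |ν.re| < (N : ℝ) - 1 / 2) {f : ℝ → ℂ} {C : ℝ}
    (hC : ∀ u, ‖f u‖ ≤ C) :
    ‖∫ u : ℝ, Complex.exp (ν * u) * ((weight N u : ℂ) * f u)‖ ≤
      (∫ u : ℝ, Real.exp (ν.re * u) * weight N u) * C := by
  have h1 := ((holoFamily_weight (f := fun _ => 1) (N := N) (C := 1)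
    aestronglyMeasurable_const (by simp)).integrable hν).norm
  have h2 (u : ℝ) : ‖Complex.exp (ν * u) * ((weight N u : ℂ) * 1)‖ =
      Real.exp (ν.re * u) * weight N u := by
    rw [mul_one, norm_mul, Complex.norm_exp, Complex.norm_real,
      Real.norm_of_nonneg (weight_pos N u).le, Complex.re_mul_ofReal]
  simp only [h2] at h1
  rw [← integral_mul_const]
  refine norm_integral_le_of_norm_le (h1.mul_const C) (Eventually.of_forall fun u => ?_)
  rw [← mul_assoc, norm_mul, ← h2 u, mul_one]
  exact mul_le_mul_of_nonneg_left (hC u) (norm_nonneg _)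

theorem continuous_termLambda_shift {p : ℝ} (hp : 0 < p) {ζ : ℂ} (hζ : ζ ∈ wideStrip) :
    Continuous fun u => termLambda p (ζ + shift u) := by
  refine continuous_iff_continuousAt.2 fun u => ?_
  refine ContinuousAt.comp (g := termLambda p)
    (hasDerivAt_termLambda hp (add_ofReal_mem_wideStrip hζ (shift u))).continuousAt ?_
  exact (continuous_const.add (Complex.continuous_ofReal.comp continuous_shift)).continuousAt

theorem norm_termLambda_add_le {p : ℝ} (hp : 0 < p) {ζ : ℂ} (hζ : ζ ∈ wideStrip) (s : ℝ) :
    ‖termLambda p (ζ + s)‖ ≤ Real.cos (ζ.im / 3) ^ (-p) / Real.cos (ζ.im / 3) := by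
  simpa using norm_termLambda_le hp (add_ofReal_mem_wideStrip hζ s)

theorem remK'_eq {N : ℕ} (hN : 1 ≤ N) {ν : ℂ} (hν : |ν.re| < (N : ℝ) - 1 / 2) {ζ : ℂ}
    (hζ : ζ ∈ wideStrip) :
    remK' N ν ζ = -(momentConst N * Complex.cos (Real.pi * ν) * Complex.exp (-(N * ζ))) *
      ∫ u : ℝ, Complex.exp (ν * u) *
        ((weight N u : ℂ) * termLambda ((N : ℝ) + 1 / 2 : ℝ) (ζ + shift u)) := by
  have hν1 : |(ν + 1).re| < (N : ℝ) + 1 / 2 := by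
    rw [Complex.add_re, Complex.one_re]
    rw [abs_lt] at *
    constructor <;> linarith
  have hν2 : |(ν - 1).re| < (N : ℝ) + 1 / 2 := by
    rw [Complex.sub_re, Complex.one_re]
    rw [abs_lt] at *
    constructor <;> linarith
  have hc1 : Complex.cos (Real.pi * (ν + 1)) = -Complex.cos (Real.pi * ν) := by
    rw [mul_add, mul_one, Complex.cos_add_pi]
  have hc2 : Complex.cos (Real.pi * (ν - 1)) = -Complex.cos (Real.pi * ν) := by
    rw [mul_sub, mul_one, Complex.cos_sub_pi]
  have hpsi : Complex.exp (ζ / 2) * (1 / 2 * (psi (N + 1 / 2) (ν + 1) ζ +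
      psi (N + 1 / 2) (ν - 1) ζ)) = Complex.exp (-(N * ζ)) * ∫ u : ℝ, Complex.exp (ν * u) *
        ((weight N u : ℂ) * termLambda ((N : ℝ) + 1 / 2 : ℝ) (ζ + shift u)) := by
    rw [psi, psi, ← integral_add ((holoFamily_termQ hν1).integrable hζ)
      ((holoFamily_termQ hν2).integrable hζ), ← integral_const_mul, ← integral_const_mul,
      ← integral_const_mul]
    congr 1
    ext u
    have e1 : Complex.exp ((ν + 1) * u) = Complex.exp (ν * u) * Complex.exp u := by
      rw [← Complex.exp_add]; ring_nf
    have e2 : Complex.exp ((ν - 1) * u) = Complex.exp (ν * u) * Complex.exp (-u) := by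
      rw [← Complex.exp_add]; ring_nf
    have e3 : Complex.exp (ζ / 2) * Complex.exp (-(((N : ℝ) + 1 / 2 : ℝ) * (ζ + shift u))) =
        Complex.exp (-(N * ζ)) * (((1 + Real.cosh u) ^ (-((N : ℝ) + 1 / 2)) : ℝ) : ℂ) := by
      rw [← exp_mul_shift, Complex.ofReal_exp, ← Complex.exp_add, ← Complex.exp_add]
      congr 1
      push_cast
      ring
    rw [e1, e2, termQ, weight, Complex.ofReal_mul, Complex.ofReal_cosh, Complex.cosh]
    linear_combination (Complex.exp (ν * u) * ((Complex.exp u + Complex.exp (-u)) / 2) *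
      termLambda ((N : ℝ) + 1 / 2 : ℝ) (ζ + shift u)) * e3
  have hsum : ∑ n ∈ Finset.range N, coeffB n ν / Complex.exp ζ ^ n = Complex.exp (ζ / 2) * (1 / 2 *
      (∑ n ∈ Finset.range N, coeffA n (ν + 1) * Complex.exp (-((n + 1 / 2) * ζ)) +
        ∑ n ∈ Finset.range N, coeffA n (ν - 1) * Complex.exp (-((n + 1 / 2) * ζ)))) := by
    rw [← Finset.sum_add_distrib, Finset.mul_sum, Finset.mul_sum]
    refine Finset.sum_congr rfl fun n _ => ?_
    have e : (Complex.exp ζ ^ n)⁻¹ = Complex.exp (ζ / 2) * Complex.exp (-((n + 1 / 2) * ζ)) := by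
      rw [← Complex.exp_nat_mul, ← Complex.exp_neg, ← Complex.exp_add]
      ring_nf
    rw [coeffB_eq_coeffA, div_eq_mul_inv, e]
    ring
  have hs0 : (Real.sqrt (Real.pi / 2) : ℂ) ≠ 0 := by
    exact_mod_cast (Real.sqrt_pos.2 (by positivity)).ne'
  have hE : Complex.exp (-ζ / 2) = (Complex.exp (ζ / 2))⁻¹ := by
    rw [← Complex.exp_neg]; ring_nf
  rw [remK', derivZ_besselK ν hζ, besselK_eq_expansionK hN hν1 hζ, besselK_eq_expansionK hN hν2 hζ,
    hsum, hE, expansionK, expansionK, hc1, hc2]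
  have n1 := Complex.exp_ne_zero (-Complex.exp ζ)
  have n2 := Complex.exp_ne_zero (ζ / 2)
  generalize Complex.exp (-Complex.exp ζ) = d at *
  generalize (Real.sqrt (Real.pi / 2) : ℂ) = s at *
  generalize ∑ n ∈ Finset.range N, coeffA n (ν + 1) * Complex.exp (-((n + 1 / 2) * ζ)) = S₁ at *
  generalize ∑ n ∈ Finset.range N, coeffA n (ν - 1) * Complex.exp (-((n + 1 / 2) * ζ)) = S₂ at *
  generalize psi (N + 1 / 2) (ν + 1) ζ = ψ₁ at *
  generalize psi (N + 1 / 2) (ν - 1) ζ = ψ₂ at *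
  generalize ∫ u : ℝ, Complex.exp (ν * u) *
    ((weight N u : ℂ) * termLambda ((N : ℝ) + 1 / 2 : ℝ) (ζ + shift u)) = X at *
  generalize Complex.exp (-(N * ζ)) = y at *
  generalize Complex.exp (ζ / 2) = e at *
  generalize Complex.cos (Real.pi * ν) = c at *
  field_simp
  linear_combination (-2 * (momentConst N * c)) * hpsi

/-! ### The Bessel functions of the first and second kind -/

/-- The logarithm `π i / 2` of the rotation by a right angle. -/
noncomputable def quarter : ℂ := Real.pi / 2 * Complex.I

theorem exp_quarter : Complex.exp quarter = Complex.I := by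
  rw [quarter, Complex.exp_pi_div_two_mul_I]

theorem exp_add_quarter (ζ : ℂ) : Complex.exp (ζ + quarter) = Complex.I * Complex.exp ζ := by
  rw [Complex.exp_add, exp_quarter, mul_comm]

theorem exp_sub_quarter (ζ : ℂ) : Complex.exp (ζ - quarter) = -Complex.I * Complex.exp ζ := by
  rw [Complex.exp_sub, exp_quarter, Complex.div_I, mul_comm, neg_mul]

theorem add_quarter_mem {ζ : ℂ} (hζ : |ζ.im| < Real.pi) : ζ + quarter ∈ wideStrip := by
  rw [wideStrip, Set.mem_ofPred_eq, quarter]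
  have : (ζ + Real.pi / 2 * Complex.I).im = ζ.im + Real.pi / 2 := by simp
  rw [this]
  rw [abs_lt] at *
  constructor <;> linarith [Real.pi_pos]

theorem sub_quarter_mem {ζ : ℂ} (hζ : |ζ.im| < Real.pi) : ζ - quarter ∈ wideStrip := by
  rw [wideStrip, Set.mem_ofPred_eq, quarter]
  have : (ζ - Real.pi / 2 * Complex.I).im = ζ.im - Real.pi / 2 := by simp
  rw [this]
  rw [abs_lt] at *
  constructor <;> linarith [Real.pi_pos]

theorem besselI_add_quarter (ν ζ : ℂ) :
    besselI ν (ζ + quarter) = Complex.exp (ν * quarter) * besselJ ν ζ := by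
  rw [besselI_eq, besselJ_eq, exp_add_quarter, ← mul_assoc, ← Complex.exp_add,
    show (Complex.I * Complex.exp ζ / 2) ^ 2 = -(Complex.exp ζ / 2) ^ 2 by
      linear_combination (Complex.exp ζ / 2) ^ 2 * Complex.I_sq]
  ring_nf

theorem besselI_sub_quarter (ν ζ : ℂ) :
    besselI ν (ζ - quarter) = Complex.exp (-(ν * quarter)) * besselJ ν ζ := by
  rw [besselI_eq, besselJ_eq, exp_sub_quarter, ← mul_assoc, ← Complex.exp_add,
    show (-Complex.I * Complex.exp ζ / 2) ^ 2 = -(Complex.exp ζ / 2) ^ 2 by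
      linear_combination (Complex.exp ζ / 2) ^ 2 * Complex.I_sq]
  ring_nf

theorem continuous_besselJ_order (ζ : ℂ) : Continuous fun ν => besselJ ν ζ := by
  simp only [besselJ_eq]
  exact Continuous.mul (by fun_prop) (continuous_besselS_order _)

/-- `J_ν` and `Y_ν` in terms of `K_ν`, i.e. through the two Hankel functions. -/
theorem besselJ_besselY_eq (ν : ℂ) {ζ : ℂ} (hζ : |ζ.im| < Real.pi) :
    besselJ ν ζ = Complex.I / Real.pi * (Complex.exp (ν * quarter) * besselK ν (ζ + quarter) -
        Complex.exp (-(ν * quarter)) * besselK ν (ζ - quarter)) ∧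
    besselY ν ζ = -(1 / Real.pi) * (Complex.exp (ν * quarter) * besselK ν (ζ + quarter) +
        Complex.exp (-(ν * quarter)) * besselK ν (ζ - quarter)) := by
  have hπ : (Real.pi : ℂ) ≠ 0 := by exact_mod_cast Real.pi_ne_zero
  have key {μ : ℂ} (hs : Complex.sin (Real.pi * μ) ≠ 0) :
      besselJ μ ζ = Complex.I / Real.pi * (Complex.exp (μ * quarter) * besselK μ (ζ + quarter) -
          Complex.exp (-(μ * quarter)) * besselK μ (ζ - quarter)) ∧
      (besselJ μ ζ * Complex.cos (Real.pi * μ) - besselJ (-μ) ζ) / Complex.sin (Real.pi * μ) =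
        -(1 / Real.pi) * (Complex.exp (μ * quarter) * besselK μ (ζ + quarter) +
          Complex.exp (-(μ * quarter)) * besselK μ (ζ - quarter)) := by
    have e1 : Complex.exp (μ * quarter) ^ 2 =
        Complex.cos (Real.pi * μ) + Complex.sin (Real.pi * μ) * Complex.I := by
      rw [← Complex.exp_mul_I, ← Complex.exp_nat_mul, quarter]
      push_cast
      ring_nf
    have e2 : (Complex.exp (μ * quarter))⁻¹ ^ 2 =
        Complex.cos (Real.pi * μ) - Complex.sin (Real.pi * μ) * Complex.I := by
      have := Complex.exp_mul_I (-(Real.pi * μ))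
      rw [Complex.cos_neg, Complex.sin_neg, neg_mul (Complex.sin _), ← sub_eq_add_neg] at this
      rw [← this, ← Complex.exp_neg, ← Complex.exp_nat_mul, quarter]
      push_cast
      ring_nf
    have n := Complex.exp_ne_zero (μ * quarter)
    have hp : Complex.exp (μ * quarter) * besselK μ (ζ + quarter) = Real.pi / 2 *
        (besselJ (-μ) ζ - Complex.exp (μ * quarter) ^ 2 * besselJ μ ζ) /
          Complex.sin (Real.pi * μ) := by
      rw [besselK, if_neg hs, besselI_add_quarter, besselI_add_quarter, neg_mul, Complex.exp_neg]
      field_simp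
    have hm : Complex.exp (-(μ * quarter)) * besselK μ (ζ - quarter) = Real.pi / 2 *
        (besselJ (-μ) ζ - (Complex.exp (μ * quarter))⁻¹ ^ 2 * besselJ μ ζ) /
          Complex.sin (Real.pi * μ) := by
      rw [besselK, if_neg hs, besselI_sub_quarter, besselI_sub_quarter, neg_mul, neg_neg,
        Complex.exp_neg]
      field_simp
    rw [hp, hm, e1, e2]
    constructor
    · field_simp
      linear_combination (2 * besselJ μ ζ * Complex.sin (Real.pi * μ)) * Complex.I_sq
    · field_simp
      ring
  have hp := continuousAt_besselK_order ν (add_quarter_mem hζ)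
  have hm := continuousAt_besselK_order ν (sub_quarter_mem hζ)
  have hc1 : ContinuousAt (fun μ => Complex.exp (μ * quarter)) ν := by fun_prop
  have hc2 : ContinuousAt (fun μ => Complex.exp (-(μ * quarter))) ν := by fun_prop
  have hsin := eventually_sin_ne_zero ν
  constructor
  · have l1 := (continuous_besselJ_order ζ).continuousAt (x := ν)
    have l2 := ((hc1.mul hp).sub (hc2.mul hm)).const_mul (Complex.I / Real.pi)
    refine tendsto_nhds_unique (l1.tendsto.mono_left (nhdsWithin_le_nhds (s := {ν}ᶜ))) ?_
    refine (l2.tendsto.mono_left nhdsWithin_le_nhds).congr' ?_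
    filter_upwards [hsin] with μ hμ
    exact (key hμ).1.symm
  · by_cases hs : Complex.sin (Real.pi * ν) = 0
    · rw [besselY, if_pos hs]
      refine Tendsto.limUnder_eq ?_
      have l2 := ((hc1.mul hp).add (hc2.mul hm)).const_mul (-(1 / (Real.pi : ℂ)))
      refine (l2.tendsto.mono_left nhdsWithin_le_nhds).congr' ?_
      filter_upwards [hsin] with μ hμ
      exact (key hμ).2.symm
    · rw [besselY, if_neg hs]
      exact (key hs).2

theorem isOpen_abs_im_lt (a : ℝ) : IsOpen {ζ : ℂ | |ζ.im| < a} :=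
  isOpen_lt (by fun_prop) continuous_const

theorem derivZ_besselJ_besselY (ν : ℂ) {ζ : ℂ} (hζ : |ζ.im| < Real.pi) :
    derivZ (besselJ ν) ζ = -(1 / Real.pi) *
      (Complex.exp (ν * quarter) * derivZ (besselK ν) (ζ + quarter) +
        Complex.exp (-(ν * quarter)) * derivZ (besselK ν) (ζ - quarter)) ∧
    derivZ (besselY ν) ζ = -(Complex.I / Real.pi) *
      (Complex.exp (ν * quarter) * derivZ (besselK ν) (ζ + quarter) -
        Complex.exp (-(ν * quarter)) * derivZ (besselK ν) (ζ - quarter)) := by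
  have hnhds : ∀ᶠ ξ in 𝓝 ζ, |ξ.im| < Real.pi := (isOpen_abs_im_lt _).mem_nhds hζ
  have hd {ξ : ℂ} (hξ : ξ ∈ wideStrip) : HasDerivAt (besselK ν)
      (derivZ (besselK ν) ξ * Complex.exp ξ) ξ := by
    rw [derivZ, div_mul_cancel₀ _ (Complex.exp_ne_zero ξ)]
    exact (hasDerivAt_besselK ν hξ).differentiableAt.hasDerivAt
  have hp := ((hd (add_quarter_mem hζ)).comp_add_const ζ quarter).const_mul
    (Complex.exp (ν * quarter))
  have hm := ((hd (sub_quarter_mem hζ)).comp_sub_const ζ quarter).const_mul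
    (Complex.exp (-(ν * quarter)))
  have n := Complex.exp_ne_zero ζ
  constructor
  · have h := ((hp.sub hm).const_mul (Complex.I / Real.pi)).congr_of_eventuallyEq
      (hnhds.mono fun ξ hξ => (besselJ_besselY_eq ν hξ).1)
    rw [derivZ, h.deriv, exp_add_quarter, exp_sub_quarter, div_eq_iff n]
    linear_combination (1 / Real.pi * Complex.exp ζ *
      (Complex.exp (ν * quarter) * derivZ (besselK ν) (ζ + quarter) +
        Complex.exp (-(ν * quarter)) * derivZ (besselK ν) (ζ - quarter))) * Complex.I_sq
  · have h := ((hp.add hm).const_mul (-(1 / (Real.pi : ℂ)))).congr_of_eventuallyEq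
      (hnhds.mono fun ξ hξ => (besselJ_besselY_eq ν hξ).2)
    rw [derivZ, h.deriv, exp_add_quarter, exp_sub_quarter, div_eq_iff n]
    ring

/-- The truncated expansion of `K_ν'` together with its remainder. -/
noncomputable def bracketK' (N : ℕ) (ν ζ : ℂ) : ℂ :=
  (∑ n ∈ Finset.range N, coeffB n ν / Complex.exp ζ ^ n) + remK' N ν ζ

theorem derivZ_besselK_eq_bracket (N : ℕ) (ν ζ : ℂ) :
    derivZ (besselK ν) ζ = -(Real.sqrt (Real.pi / 2) * Complex.exp (-ζ / 2) *
      Complex.exp (-Complex.exp ζ)) * bracketK' N ν ζ := by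
  have hs0 : (Real.sqrt (Real.pi / 2) : ℂ) ≠ 0 := by
    exact_mod_cast (Real.sqrt_pos.2 (by positivity)).ne'
  rw [bracketK', remK', add_sub_cancel]
  have := Complex.exp_ne_zero (-ζ / 2)
  have := Complex.exp_ne_zero (-Complex.exp ζ)
  field_simp

theorem oscA_oscB_eq (N : ℕ) (ν : ℂ) {ζ : ℂ} (hζ : |ζ.im| < Real.pi) :
    oscA ν ζ = 1 / 2 * (bracketK' N ν (ζ + quarter) + bracketK' N ν (ζ - quarter)) ∧
    oscB ν ζ = Complex.I / 2 * (bracketK' N ν (ζ + quarter) - bracketK' N ν (ζ - quarter)) := by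
  obtain ⟨hJ, hY⟩ := derivZ_besselJ_besselY ν hζ
  rw [derivZ_besselK_eq_bracket N ν (ζ + quarter), derivZ_besselK_eq_bracket N ν (ζ - quarter)]
    at hJ hY
  generalize bracketK' N ν (ζ + quarter) = T₁ at *
  generalize bracketK' N ν (ζ - quarter) = T₂ at *
  have hω1 : Complex.exp (ν * quarter) * (Complex.exp (-(ζ + quarter) / 2) *
      Complex.exp (-Complex.exp (ζ + quarter))) = -Complex.I * Complex.exp (-ζ / 2) *
        (Complex.cos (omega ν ζ) - Complex.sin (omega ν ζ) * Complex.I) := by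
    have h1 := Complex.exp_mul_I (-omega ν ζ)
    rw [Complex.cos_neg, Complex.sin_neg, neg_mul (Complex.sin _), ← sub_eq_add_neg] at h1
    have h2 : -Complex.I = Complex.exp (-quarter) := by
      rw [Complex.exp_neg, exp_quarter, Complex.inv_I]
    rw [← h1, h2, ← Complex.exp_add, ← Complex.exp_add, ← Complex.exp_add, ← Complex.exp_add,
      exp_add_quarter, omega, quarter]
    ring_nf
  have hω2 : Complex.exp (-(ν * quarter)) * (Complex.exp (-(ζ - quarter) / 2) *
      Complex.exp (-Complex.exp (ζ - quarter))) = Complex.I * Complex.exp (-ζ / 2) *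
        (Complex.cos (omega ν ζ) + Complex.sin (omega ν ζ) * Complex.I) := by
    have h2 : Complex.I * Complex.exp (-ζ / 2) = Complex.exp (quarter + -ζ / 2) := by
      rw [Complex.exp_add, exp_quarter]
    rw [h2, ← Complex.exp_mul_I, ← Complex.exp_add, ← Complex.exp_add, ← Complex.exp_add,
      exp_sub_quarter, omega, quarter]
    ring_nf
  have hs0 : (Real.sqrt (Real.pi / 2) : ℂ) ≠ 0 := by
    exact_mod_cast (Real.sqrt_pos.2 (by positivity)).ne'
  have hπ : (Real.pi : ℂ) ≠ 0 := by exact_mod_cast Real.pi_ne_zero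
  have hamp : amp ζ = 2 / Real.pi * (Real.sqrt (Real.pi / 2) * Complex.exp (-ζ / 2)) := by
    have h : Real.sqrt (2 / Real.pi) = 2 / Real.pi * Real.sqrt (Real.pi / 2) := by
      rw [Real.sqrt_eq_iff_mul_self_eq (by positivity) (by positivity)]
      have := Real.mul_self_sqrt (show 0 ≤ Real.pi / 2 by positivity)
      have := Real.pi_ne_zero
      field_simp
      nlinarith
    rw [amp, h]
    push_cast
    ring
  have hsc := Complex.sin_sq_add_cos_sq (omega ν ζ)
  have hI := Complex.I_sq
  have n1 := amp_ne_zero ζ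
  have hJ' : derivZ (besselJ ν) ζ = amp ζ / 2 * -Complex.I *
      ((Complex.cos (omega ν ζ) - Complex.sin (omega ν ζ) * Complex.I) * T₁ -
        (Complex.cos (omega ν ζ) + Complex.sin (omega ν ζ) * Complex.I) * T₂) := by
    rw [hJ, hamp]
    linear_combination (1 / Real.pi * Real.sqrt (Real.pi / 2)) * (T₁ * hω1 + T₂ * hω2)
  have hY' : derivZ (besselY ν) ζ = amp ζ / 2 *
      ((Complex.cos (omega ν ζ) - Complex.sin (omega ν ζ) * Complex.I) * T₁ +
        (Complex.cos (omega ν ζ) + Complex.sin (omega ν ζ) * Complex.I) * T₂) := by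
    rw [hY, hamp]
    linear_combination (Complex.I / Real.pi * Real.sqrt (Real.pi / 2)) * (T₁ * hω1 - T₂ * hω2) -
      (1 / Real.pi * Real.sqrt (Real.pi / 2) * Complex.exp (-ζ / 2) *
        ((Complex.cos (omega ν ζ) - Complex.sin (omega ν ζ) * Complex.I) * T₁ +
        (Complex.cos (omega ν ζ) + Complex.sin (omega ν ζ) * Complex.I) * T₂)) * hI
  rw [oscA, oscB, div_eq_iff n1, div_eq_iff n1, hJ', hY']
  generalize Complex.cos (omega ν ζ) = c at *
  generalize Complex.sin (omega ν ζ) = s at *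
  constructor
  · linear_combination (amp ζ / 2 * (T₁ + T₂)) * hsc -
      (amp ζ / 2 * s ^ 2 * (T₁ + T₂)) * hI
  · linear_combination (Complex.I * amp ζ / 2 * (T₁ - T₂)) * hsc -
      (amp ζ / 2 * c * s * (T₁ + T₂)) * hI

theorem sum_even_eq (M : ℕ) (ν ζ : ℂ) :
    1 / 2 * ((∑ n ∈ Finset.range (2 * M), coeffB n ν / (Complex.I * Complex.exp ζ) ^ n) +
      ∑ n ∈ Finset.range (2 * M), coeffB n ν / (-Complex.I * Complex.exp ζ) ^ n) =
    ∑ k ∈ Finset.range M, (-1) ^ k * coeffB (2 * k) ν / Complex.exp ζ ^ (2 * k) := by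
  induction M with
  | zero => simp
  | succ M ih =>
    rw [show 2 * (M + 1) = 2 * M + 1 + 1 by ring, Finset.sum_range_succ, Finset.sum_range_succ,
      Finset.sum_range_succ, Finset.sum_range_succ, Finset.sum_range_succ, ← ih]
    have n := Complex.exp_ne_zero ζ
    have e1 : (Complex.I * Complex.exp ζ) ^ (2 * M) = (-1) ^ M * Complex.exp ζ ^ (2 * M) := by
      rw [mul_pow, pow_mul, Complex.I_sq]
    have e2 : (-Complex.I * Complex.exp ζ) ^ (2 * M) = (-1) ^ M * Complex.exp ζ ^ (2 * M) := by
      rw [mul_pow, pow_mul, neg_sq, Complex.I_sq]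
    rw [pow_succ, pow_succ (-Complex.I * Complex.exp ζ), e1, e2]
    have e3 : ((-1 : ℂ) ^ M)⁻¹ = (-1) ^ M := by rw [← inv_pow, inv_neg_one]
    simp only [div_eq_mul_inv, mul_inv, e3, Complex.inv_I, inv_neg]
    ring

theorem sum_odd_eq (M : ℕ) (ν ζ : ℂ) :
    Complex.I / 2 *
      ((∑ n ∈ Finset.range (2 * M + 1), coeffB n ν / (Complex.I * Complex.exp ζ) ^ n) -
        ∑ n ∈ Finset.range (2 * M + 1), coeffB n ν / (-Complex.I * Complex.exp ζ) ^ n) =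
    ∑ k ∈ Finset.range M, (-1) ^ k * coeffB (2 * k + 1) ν / Complex.exp ζ ^ (2 * k + 1) := by
  induction M with
  | zero => simp
  | succ M ih =>
    rw [show 2 * (M + 1) + 1 = 2 * M + 1 + 1 + 1 by ring, Finset.sum_range_succ _ (2 * M + 1 + 1),
      Finset.sum_range_succ _ (2 * M + 1), Finset.sum_range_succ _ (2 * M + 1 + 1),
      Finset.sum_range_succ _ (2 * M + 1), Finset.sum_range_succ _ M, ← ih]
    have e1 : (Complex.I * Complex.exp ζ) ^ (2 * M) = (-1) ^ M * Complex.exp ζ ^ (2 * M) := by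
      rw [mul_pow, pow_mul, Complex.I_sq]
    have e2 : (-Complex.I * Complex.exp ζ) ^ (2 * M) = (-1) ^ M * Complex.exp ζ ^ (2 * M) := by
      rw [mul_pow, pow_mul, neg_sq, Complex.I_sq]
    have e3 : ((-1 : ℂ) ^ M)⁻¹ = (-1) ^ M := by rw [← inv_pow, inv_neg_one]
    have e4 : (Complex.I * Complex.exp ζ) ^ (2 * M + 1 + 1) =
        (-Complex.I * Complex.exp ζ) ^ (2 * M + 1 + 1) := by
      rw [show 2 * M + 1 + 1 = 2 * (M + 1) by ring, pow_mul, pow_mul]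
      congr 1
      ring
    rw [e4, pow_succ _ (2 * M), pow_succ (-Complex.I * Complex.exp ζ) (2 * M), e1, e2]
    simp only [div_eq_mul_inv, mul_inv, e3, Complex.inv_I, inv_neg]
    linear_combination (-(coeffB (2 * M + 1) ν * (-1) ^ M * (Complex.exp ζ ^ (2 * M))⁻¹ *
      (Complex.exp ζ)⁻¹)) * Complex.I_sq

theorem termPi_add_eq (p ζ : ℂ) (s : ℝ) :
    termPi p (ζ + s) =
      1 / 2 * (termLambda p (ζ + quarter + s) + termLambda p (ζ - quarter + s)) := by
  rw [termPi, ← quarter, add_right_comm, sub_add_eq_add_sub]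
  ring

/-- The two remainders of `K_ν'` at `z e ^ (± π i / 2)` combine to the terminant `Π`. -/
theorem norm_remJ'_eq {N : ℕ} (hN : 1 ≤ N) {ν : ℂ} (hν : |ν.re| < (N : ℝ) - 1 / 2) {ζ : ℂ}
    (hζ : |ζ.im| < Real.pi) :
    ‖remJ' N ν ζ‖ = ‖momentConst N * Complex.cos (Real.pi * ν) * Complex.exp (-(N * ζ)) *
      ∫ u : ℝ, Complex.exp (ν * u) *
        ((weight N u : ℂ) * termPi ((N : ℝ) + 1 / 2 : ℝ) (ζ + shift u))‖ := by
  have hp : (0 : ℝ) < N + 1 / 2 := by positivity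
  have hint {ξ : ℂ} (hξ : ξ ∈ wideStrip) := (holoFamily_weight (N := N)
    (continuous_termLambda_shift hp hξ).aestronglyMeasurable
      (fun u => norm_termLambda_add_le hp hξ (shift u))).integrable hν
  have hPi : ∫ u : ℝ, Complex.exp (ν * u) *
        ((weight N u : ℂ) * termPi ((N : ℝ) + 1 / 2 : ℝ) (ζ + shift u)) =
      1 / 2 * ((∫ u : ℝ, Complex.exp (ν * u) *
        ((weight N u : ℂ) * termLambda ((N : ℝ) + 1 / 2 : ℝ) (ζ + quarter + shift u))) +
      ∫ u : ℝ, Complex.exp (ν * u) *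
        ((weight N u : ℂ) * termLambda ((N : ℝ) + 1 / 2 : ℝ) (ζ - quarter + shift u))) := by
    rw [← integral_add (hint (add_quarter_mem hζ)) (hint (sub_quarter_mem hζ)),
      ← integral_const_mul]
    congr 1
    ext u
    rw [termPi_add_eq]
    ring
  rw [hPi]
  have r1 := remK'_eq hN hν (add_quarter_mem hζ)
  have r2 := remK'_eq hN hν (sub_quarter_mem hζ)
  obtain ⟨hA, hB⟩ := oscA_oscB_eq N ν hζ
  rw [bracketK', bracketK', exp_add_quarter, exp_sub_quarter] at hA hB
  have e1 : Complex.exp (-(N * (ζ + quarter))) = Complex.exp (-(N * ζ)) * (-Complex.I) ^ N := by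
    have h : -Complex.I = Complex.exp (-quarter) := by
      rw [Complex.exp_neg, exp_quarter, Complex.inv_I]
    rw [h, ← Complex.exp_nat_mul, ← Complex.exp_add]
    ring_nf
  have e2 : Complex.exp (-(N * (ζ - quarter))) = Complex.exp (-(N * ζ)) * Complex.I ^ N := by
    conv_rhs => rw [← exp_quarter]
    rw [← Complex.exp_nat_mul, ← Complex.exp_add]
    ring_nf
  rw [e1] at r1
  rw [e2] at r2
  generalize ∫ u : ℝ, Complex.exp (ν * u) * ((weight N u : ℂ) *
    termLambda ((N : ℝ) + 1 / 2 : ℝ) (ζ + quarter + shift u)) = X₁ at *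
  generalize ∫ u : ℝ, Complex.exp (ν * u) * ((weight N u : ℂ) *
    termLambda ((N : ℝ) + 1 / 2 : ℝ) (ζ - quarter + shift u)) = X₂ at *
  generalize Complex.exp (-(N * ζ)) = y at *
  have hsign (M : ℕ) : ‖(-1 : ℂ) ^ M‖ = 1 := by simp
  rcases Nat.even_or_odd' N with ⟨M, hM | hM⟩
  · have h1 : N % 2 = 0 := by omega
    have h2 : N / 2 = M := by omega
    have h3 := sum_even_eq M ν ζ
    rw [← hM] at h3
    have h4 : remJ' N ν ζ = -(-1) ^ M * (momentConst N * Complex.cos (Real.pi * ν) * y *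
        (1 / 2 * (X₁ + X₂))) := by
      rw [remJ', if_pos h1, h2, ← h3, hA, r1, r2, hM, pow_mul, pow_mul, neg_sq, Complex.I_sq]
      ring
    rw [h4, norm_mul, norm_neg, hsign, one_mul]
  · have h1 : N % 2 = 1 := by omega
    have h2 : N / 2 = M := by omega
    have h3 := sum_odd_eq M ν ζ
    rw [← hM] at h3
    have h4 : remJ' N ν ζ = (-1) ^ M * (momentConst N * Complex.cos (Real.pi * ν) * y *
        (1 / 2 * (X₁ + X₂))) := by
      rw [remJ', if_neg (by omega), h2, ← h3, hB, r1, r2, hM, pow_succ, pow_succ, pow_mul, pow_mul,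
        neg_sq, Complex.I_sq]
      linear_combination (-(1 / 2 * (-1) ^ M * (X₁ + X₂) * y * (momentConst (2 * M + 1) *
        Complex.cos (Real.pi * ν)))) * Complex.I_sq
    rw [h4, norm_mul, hsign, one_mul]

/-! ### The bounds -/

/-- The quotient `|b_N(x)| / |cos (π x)|`, freed from its removable singularities. -/
noncomputable def coeffRatio (N : ℕ) (x : ℝ) : ℝ :=
  |momentConst N| * ∫ u : ℝ, Real.exp (x * u) * weight N u

theorem coeffB_eq_integral {N : ℕ} {x : ℝ} (hx : |x| < (N : ℝ) - 1 / 2) :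
    coeffB N x = ((-(momentConst N * Real.cos (Real.pi * x) *
      ∫ u : ℝ, Real.exp (x * u) * weight N u) : ℝ) : ℂ) := by
  have hν1 : |((x : ℂ) + 1).re| < (N : ℝ) + 1 / 2 := by
    rw [Complex.add_re, Complex.one_re, Complex.ofReal_re]
    rw [abs_lt] at *
    constructor <;> linarith
  have hν2 : |((x : ℂ) - 1).re| < (N : ℝ) + 1 / 2 := by
    rw [Complex.sub_re, Complex.one_re, Complex.ofReal_re]
    rw [abs_lt] at *
    constructor <;> linarith
  have h : moment (N + 1 / 2) (x + 1) + moment (N + 1 / 2) (x - 1) =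
      2 * ((∫ u : ℝ, Real.exp (x * u) * weight N u : ℝ) : ℂ) := by
    rw [moment, moment, ← integral_add (integrable_moment hν1).1 (integrable_moment hν2).1,
      ← integral_complex_ofReal, ← integral_const_mul]
    congr 1
    ext u
    have e1 : Complex.exp (((x : ℂ) + 1) * u) = Complex.exp (x * u) * Complex.exp u := by
      rw [← Complex.exp_add]; ring_nf
    have e2 : Complex.exp (((x : ℂ) - 1) * u) = Complex.exp (x * u) * Complex.exp (-u) := by
      rw [← Complex.exp_add]; ring_nf
    rw [e1, e2, weight]
    simp only [Complex.ofReal_mul, Complex.ofReal_exp, Complex.ofReal_cosh, Complex.cosh]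
    ring
  rw [coeffB_eq_coeffA, coeffA_eq_moment hν1, coeffA_eq_moment hν2, mul_add (Real.pi : ℂ),
    mul_sub (Real.pi : ℂ), mul_one, Complex.cos_add_pi, Complex.cos_sub_pi]
  push_cast
  linear_combination (-(1 / 2) * momentConst N * Complex.cos (Real.pi * x)) * h

theorem integral_weight_nonneg (N : ℕ) (x : ℝ) :
    0 ≤ ∫ u : ℝ, Real.exp (x * u) * weight N u :=
  integral_nonneg fun u => (mul_pos (Real.exp_pos _) (weight_pos N u)).le

theorem norm_coeffB_div {N : ℕ} {x : ℝ} (hx : |x| < (N : ℝ) - 1 / 2)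
    (hc : Real.cos (Real.pi * x) ≠ 0) :
    ‖coeffB N x‖ / |Real.cos (Real.pi * x)| = coeffRatio N x := by
  rw [coeffB_eq_integral hx, Complex.norm_real, Real.norm_eq_abs, abs_neg, abs_mul, abs_mul,
    abs_of_nonneg (integral_weight_nonneg N x), coeffRatio,
    div_eq_iff (abs_ne_zero.2 hc)]
  ring

theorem continuousAt_coeffRatio {N : ℕ} {x : ℝ} (hx : |x| < (N : ℝ) - 1 / 2) :
    ContinuousAt (coeffRatio N) x := by
  have hH := holoFamily_weight (f := fun _ => 1) (N := N) (C := 1) aestronglyMeasurable_const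
    (by simp)
  have h := (hH.hasDerivAt_integral (show (x : ℂ) ∈ {ν : ℂ | |ν.re| < (N : ℝ) - 1 / 2} by
    simpa using! hx)).continuousAt
  have h2 : ContinuousAt (fun y : ℝ => (∫ u : ℝ, Complex.exp ((y : ℂ) * u) *
      ((weight N u : ℂ) * 1)).re) x :=
    Complex.continuous_re.continuousAt.comp
      (ContinuousAt.comp (f := fun y : ℝ => (y : ℂ)) h Complex.continuous_ofReal.continuousAt)
  refine (h2.const_mul |momentConst N|).congr (Eventually.of_forall fun y => ?_)
  have e (u : ℝ) : Complex.exp ((y : ℂ) * u) * ((weight N u : ℂ) * 1) =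
      ((Real.exp (y * u) * weight N u : ℝ) : ℂ) := by
    push_cast
    ring
  simp only [e, integral_complex_ofReal, Complex.ofReal_re]
  rfl

theorem tendsto_norm_coeffB_div {N : ℕ} {x : ℝ} (hx : |x| < (N : ℝ) - 1 / 2) :
    Tendsto (fun x : ℝ => ‖coeffB N (x : ℂ)‖ / |Real.cos (Real.pi * x)|) (𝓝[≠] x)
      (𝓝 (coeffRatio N x)) := by
  have hcos : ∀ᶠ y in 𝓝[≠] x, Real.cos (Real.pi * y) ≠ 0 := by
    by_cases h : Real.cos (Real.pi * x) = 0
    · have hd : HasDerivAt (fun y : ℝ => Real.cos (Real.pi * y))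
          (-Real.sin (Real.pi * x) * (Real.pi * 1)) x :=
        ((hasDerivAt_id x).const_mul Real.pi).cos
      refine hd.eventually_ne (mul_ne_zero (neg_ne_zero.2 fun hs => ?_) (by simp))
      have := Real.sin_sq_add_cos_sq (Real.pi * x)
      simp [h, hs] at this
    · have hc : Continuous fun y : ℝ => Real.cos (Real.pi * y) := by fun_prop
      exact nhdsWithin_le_nhds (hc.continuousAt.eventually_ne h)
  refine ((continuousAt_coeffRatio hx).tendsto.mono_left nhdsWithin_le_nhds).congr' ?_
  filter_upwards [hcos, nhdsWithin_le_nhds (continuous_abs.continuousAt.eventually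
    (gt_mem_nhds hx))] with y h1 h2
  exact (norm_coeffB_div h2 h1).symm

theorem norm_le_of_integral_weight {N : ℕ} {ν : ℂ} (hν : |ν.re| < (N : ℝ) - 1 / 2) (ζ : ℂ)
    {f : ℝ → ℂ} {C : ℝ} (hC : ∀ u, ‖f u‖ ≤ C) :
    ‖momentConst N * Complex.cos (Real.pi * ν) * Complex.exp (-(N * ζ)) *
      ∫ u : ℝ, Complex.exp (ν * u) * ((weight N u : ℂ) * f u)‖ ≤
    ‖Complex.cos (Real.pi * ν)‖ * coeffRatio N ν.re / ‖Complex.exp ζ‖ ^ N * C := by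
  have h1 : ‖Complex.exp (-(N * ζ))‖ = (‖Complex.exp ζ‖ ^ N)⁻¹ := by
    rw [Complex.exp_neg, Complex.exp_nat_mul, norm_inv, norm_pow]
  rw [norm_mul, norm_mul, norm_mul, h1, Complex.norm_real, Real.norm_eq_abs, coeffRatio]
  refine (mul_le_mul_of_nonneg_left (norm_integral_weight_le hν hC) (by positivity)).trans_eq ?_
  rw [div_eq_mul_inv]
  ring

/-- `1 + cosh u = 2 r` with `r ≥ 1`. -/
theorem exists_shift_eq (u : ℝ) : ∃ r : Set.Ici (1 : ℝ), shift u = Real.log (2 * r) :=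
  ⟨⟨(1 + Real.cosh u) / 2, by
    have := Real.one_le_cosh u
    rw [Set.mem_Ici]
    linarith⟩, by rw [shift, mul_div_cancel₀ _ two_ne_zero]⟩

theorem le_iSup_shift {f : ℝ → ℝ}
    (hf : BddAbove (Set.range fun r : Set.Ici (1 : ℝ) => f (Real.log (2 * r)))) (u : ℝ) :
    f (shift u) ≤ ⨆ r : Set.Ici (1 : ℝ), f (Real.log (2 * r)) := by
  obtain ⟨r, hr⟩ := exists_shift_eq u
  rw [hr]
  exact le_ciSup hf r

end BesselRemainder

/-- Here `ζ` is the logarithm of the point `z` of the Riemann surface of the logarithm, so that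
`Im ζ = arg z`, and `ζ + log (2 r)` is the logarithm of `2 z r`. The number `L` is the value of
`|b_N(Re ν)| / |cos (π Re ν)|` if the denominator is not zero, and its limiting value otherwise. -/
theorem theorem7 (N : ℕ) (hN : 1 ≤ N) (ν : ℂ) (hν : |ν.re| < (N : ℝ) - 1 / 2) :
    ∃ L : ℝ,
      (Real.cos (Real.pi * ν.re) ≠ 0 →
        L = ‖BesselRemainder.coeffB N (ν.re : ℂ)‖ / |Real.cos (Real.pi * ν.re)|) ∧
      Tendsto (fun x : ℝ => ‖BesselRemainder.coeffB N (x : ℂ)‖ / |Real.cos (Real.pi * x)|)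
        (𝓝[≠] ν.re) (𝓝 L) ∧
      (∀ ζ : ℂ, |ζ.im| < 3 * Real.pi / 2 →
        BddAbove (Set.range fun r : Set.Ici (1 : ℝ) =>
          ‖BesselRemainder.termLambda ((N : ℂ) + 1 / 2) (ζ + (Real.log (2 * r) : ℂ))‖) ∧
        ‖BesselRemainder.remK' N ν ζ‖ ≤
          ‖Complex.cos (Real.pi * ν)‖ * L / ‖Complex.exp ζ‖ ^ N *
            ⨆ r : Set.Ici (1 : ℝ),
              ‖BesselRemainder.termLambda ((N : ℂ) + 1 / 2) (ζ + (Real.log (2 * r) : ℂ))‖) ∧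
      (∀ ζ : ℂ, |ζ.im| < Real.pi →
        BddAbove (Set.range fun r : Set.Ici (1 : ℝ) =>
          ‖BesselRemainder.termPi ((N : ℂ) + 1 / 2) (ζ + (Real.log (2 * r) : ℂ))‖) ∧
        ‖BesselRemainder.remJ' N ν ζ‖ ≤
          ‖Complex.cos (Real.pi * ν)‖ * L / ‖Complex.exp ζ‖ ^ N *
            ⨆ r : Set.Ici (1 : ℝ),
              ‖BesselRemainder.termPi ((N : ℂ) + 1 / 2) (ζ + (Real.log (2 * r) : ℂ))‖) := by
  have hp : (0 : ℝ) < N + 1 / 2 := by positivity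
  have hpc : (N : ℂ) + 1 / 2 = (((N : ℝ) + 1 / 2 : ℝ) : ℂ) := by push_cast; rfl
  refine ⟨BesselRemainder.coeffRatio N ν.re,
    fun hc => (BesselRemainder.norm_coeffB_div hν hc).symm,
    BesselRemainder.tendsto_norm_coeffB_div hν, fun ζ hζ => ?_, fun ζ hζ => ?_⟩ <;> rw [hpc]
  · have hbdd : BddAbove (Set.range fun r : Set.Ici (1 : ℝ) =>
        ‖BesselRemainder.termLambda ((N : ℝ) + 1 / 2 : ℝ) (ζ + (Real.log (2 * r) : ℂ))‖) :=
      ⟨_, Set.forall_mem_range.2 fun r => BesselRemainder.norm_termLambda_add_le hp hζ _⟩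
    refine ⟨hbdd, ?_⟩
    rw [BesselRemainder.remK'_eq hN hν hζ, neg_mul, norm_neg]
    exact BesselRemainder.norm_le_of_integral_weight hν ζ fun u => BesselRemainder.le_iSup_shift
      (f := fun s => ‖BesselRemainder.termLambda ((N : ℝ) + 1 / 2 : ℝ) (ζ + s)‖) hbdd u
  · have hbdd : BddAbove (Set.range fun r : Set.Ici (1 : ℝ) =>
        ‖BesselRemainder.termPi ((N : ℝ) + 1 / 2 : ℝ) (ζ + (Real.log (2 * r) : ℂ))‖) := by
      have hLambda {ξ : ℂ} (hξ : |ξ.im| < 3 * Real.pi / 2) : ∃ C, ∀ s : ℝ,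
          ‖BesselRemainder.termLambda ((N : ℝ) + 1 / 2 : ℝ) (ξ + s)‖ ≤ C :=
        ⟨_, fun s => BesselRemainder.norm_termLambda_add_le hp hξ s⟩
      obtain ⟨C₁, h₁⟩ := hLambda (BesselRemainder.add_quarter_mem hζ)
      obtain ⟨C₂, h₂⟩ := hLambda (BesselRemainder.sub_quarter_mem hζ)
      refine ⟨‖(1 / 2 : ℂ)‖ * (C₁ + C₂), Set.forall_mem_range.2 fun r => ?_⟩
      rw [BesselRemainder.termPi_add_eq, norm_mul]
      exact mul_le_mul_of_nonneg_left ((norm_add_le _ _).trans (add_le_add (h₁ _) (h₂ _)))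
        (norm_nonneg _)
    refine ⟨hbdd, ?_⟩
    rw [BesselRemainder.norm_remJ'_eq hN hν hζ]
    exact BesselRemainder.norm_le_of_integral_weight hν ζ fun u => BesselRemainder.le_iSup_shift
      (f := fun s => ‖BesselRemainder.termPi ((N : ℝ) + 1 / 2 : ℝ) (ζ + s)‖) hbdd u
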